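/- **Setting.** For $c\in\{0,1,2,\dots\}$, a *twisted $n$-gon indexed by $\frac c2+\mathbb Z$* is a sequence $A=(A_i)_{i\in \frac c2+\mathbb Z}$ of points of the real projective plane such that $A_{i+n}=\phi(A_i)$ for all $i$, for some projective transformation $\phi$, and such that no three of any four consecutive points are collinear. Let $\mathcal P_n$ (for $c$ even) and $\mathcal P_n^*$ (for $c$ odd) be the spaces of such polygons modulo projective equivalence. The pentagram map $T$ sends $A$ to the polygon $B$ with $B_i=\overline{A_{i-3/2}A_{i+1/2}}\cap\overline{A_{i-1/2}A_{i+3/2}}$, where this is again a twisted polygon; it exchanges index sets $\mathbb Z$ and $\frac12+\mathbb Z$. With $[a,b,c,d]=\frac{(a-b)(c-d)}{(b-c)(d-a)}$ and $\chi(a,b,c,d)=[b,a,c,d]$, set for each index $k$ of $A$ $$x_{2k}(A)=\chi(A_{k-2},A_{k-1},B,D),\qquad x_{2k+1}(A)=\chi(A_{k+2},A_{k+1},C,D),$$ where $B=\overline{A_{k-2}A_{k-1}}\cap\overline{A_kA_{k+1}}$, $C=\overline{A_{k-1}A_k}\cap\overline{A_{k+1}A_{k+2}}$, $D=\overline{A_{k-2}A_{k-1}}\cap\overline{A_{k+1}A_{k+2}}$.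 Then $x_{j+2n}=x_j$, and $x_1,\dots,x_{2n}$ are coordinates on $\mathcal P_n$ and on $\mathcal P_n^*$, in which the iterates $T^k$ are rational maps. On $\mathcal P_n$ put $y_j=-(x_jx_{j+1})^{-1}$ for $j$ even and $y_j=-x_jx_{j+1}$ for $j$ odd; on $\mathcal P_n^*$ exchange the two cases. For a set $S$ of vertex indices let $X_S$ be the set of polygons with $y_{2s}=-1$ for all $s\in S$; for a set $S$ of side indices (i.e. $S\subseteq\frac12+\mathbb Z$ for $\mathcal P_n$ and $S\subseteq\mathbb Z$ for $\mathcal P_n^*$) let $Y_S$ be the set of polygons with $y_{2s}=-1$ for all $s\in S$. Write $[a,b]_d=\{a,a+d,a+2d,\dots,b\}$. $T^k$ is *nonsingular* at $A\in\mathcal P_n$, with value $T^k(A)=B$ in $\mathcal P_n$ ($k$ even) or $\mathcal P_n^*$ ($k$ odd), if each of the rational functions $x_j\circ T^k$ of $x_1,\dots,x_{2n}$ ($1\le j\le 2n$) can be written as a quotient of polynomials whose denominator does not vanish at $A$ and whose value at $A$ is $x_j(B)$; otherwise $T^k$ is *singular* at $A$. "Generic $A\in X_S$" means all $A$ in some Zariski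 open and dense subset of $X_S$. **Theorem.** Let $i,m\in\mathbb Z$ with $1\le m<\frac n3-1$, and let $$S=[i-(m-1),\,i+(m-1)]_2,\qquad S'=\left[i-\tfrac12(m-1),\,i+\tfrac12(m-1)\right]_1 .$$ Then $X_S\subseteq\mathcal P_n$ consists of the polygons $A$ for which $A_{i-m-1},A_{i-m+1},A_{i-m+3},\dots,A_{i+m+1}$ are collinear, and: 1. for $1\le k\le m+1$, the map $T^k$ is singular at every $A\in X_S$; 2. $T^{m+2}$ is nonsingular at generic $A\in X_S$; 3. $T^{m+2}(A)\in Y_{S'}$ for every $A\in X_S$ at which $T^{m+2}$ is nonsingular. -/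

import Mathlib

open scoped LinearAlgebra.Projectivization Matrix

noncomputable section

namespace Pentagram

/-- Points of the real projective plane. -/
abbrev Pt : Type := ℙ ℝ (Fin 3 → ℝ)

/-- Lines of the real projective plane, i.e. points of the dual plane: the class of `v` is the
line of all points `[w]` with `v ⬝ᵥ w = 0`. -/
abbrev Ln : Type := ℙ ℝ (Fin 3 → ℝ)

/-- The line through two distinct points. -/
def join (P Q : Pt) : Ln := Projectivization.cross P Q

/-- The intersection point of two distinct lines. -/
def meet (l l' : Ln) : Pt := Projectivization.cross l l'

/-- The projective transformation induced by an invertible linear map. -/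
def act (φ : (Fin 3 → ℝ) ≃ₗ[ℝ] (Fin 3 → ℝ)) : Pt → Pt :=
  Projectivization.map φ.toLinearMap φ.injective

/-- Four points of the plane, no three of which are collinear. -/
def GeneralPosition (P Q R S : Pt) : Prop :=
  Projectivization.Independent ![P, Q, R] ∧ Projectivization.Independent ![P, Q, S] ∧
    Projectivization.Independent ![P, R, S] ∧ Projectivization.Independent ![Q, R, S]

/-- The cross ratio `[a, b, c, d] = (a - b)(c - d) / ((b - c)(d - a))` of four points of a line in
the projective plane. If `a`, `b` lie on the line with normal vector `v` then the cross product of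
representatives is a multiple of `v`; in an affine coordinate on the line the factor is
proportional to `a - b`. -/
def crossRatio (a b c d : Pt) : ℝ :=
  ((a.rep ⨯₃ b.rep) ⬝ᵥ (c.rep ⨯₃ d.rep)) / ((b.rep ⨯₃ c.rep) ⬝ᵥ (d.rep ⨯₃ a.rep))

/-- The cross ratio in the order `χ(a, b, c, d) = [b, a, c, d]`. -/
def chi (a b c d : Pt) : ℝ := crossRatio b a c d

/-- `χ(P, Q, B, D)`, where `B` and `D` are the intersections of the line `PQ` with the lines `RS`
and `SU`. -/
def cornerRatio (P Q R S U : Pt) : ℝ :=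
  chi P Q (meet (join P Q) (join R S)) (meet (join P Q) (join S U))

/-- A twisted `n`-gon indexed by `c/2 + ℤ`: here `vertex r` is the vertex `A_{c/2 + r}`. Thus `c`
even (for instance `c = 0`) gives polygons indexed by `ℤ`, and `c` odd gives polygons indexed by
`1/2 + ℤ`. -/
structure TwistedPolygon (n c : ℕ) where
  vertex : ℤ → Pt
  twisted : ∃ φ : (Fin 3 → ℝ) ≃ₗ[ℝ] (Fin 3 → ℝ), ∀ r, vertex (r + n) = act φ (vertex r)
  generalPosition :
    ∀ r, GeneralPosition (vertex r) (vertex (r + 1)) (vertex (r + 2)) (vertex (r + 3))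

variable {n c : ℕ}

/-- The coordinate `x_j` of a twisted polygon `A`. For an index `k = c/2 + r` of `A`,
`x_{2k} = χ(A_{k-2}, A_{k-1}, B, D)` and `x_{2k+1} = χ(A_{k+2}, A_{k+1}, C, D)` with
`B = A_{k-2}A_{k-1} ∩ A_kA_{k+1}`, `C = A_{k-1}A_k ∩ A_{k+1}A_{k+2}` and
`D = A_{k-2}A_{k-1} ∩ A_{k+1}A_{k+2}`. Note `2k = c + 2r`. -/
def TwistedPolygon.x (A : TwistedPolygon n c) (j : ℤ) : ℝ :=
  let r := (j - c) / 2
  if Even (j - c) then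
    cornerRatio (A.vertex (r - 2)) (A.vertex (r - 1)) (A.vertex r) (A.vertex (r + 1))
      (A.vertex (r + 2))
  else
    cornerRatio (A.vertex (r + 2)) (A.vertex (r + 1)) (A.vertex r) (A.vertex (r - 1))
      (A.vertex (r - 2))

/-- `B = T(A)` for the pentagram map `T`:
`B_i = A_{i-3/2}A_{i+1/2} ∩ A_{i-1/2}A_{i+3/2}`, with `i = (c+1)/2 + r`. The requirement that `B` be
a twisted polygon again is part of its type. -/
def TwistedPolygon.IsPentagram (A : TwistedPolygon n c) (B : TwistedPolygon n (c + 1)) : Prop :=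
  ∀ r, B.vertex r =
    meet (join (A.vertex (r - 1)) (A.vertex (r + 1))) (join (A.vertex r) (A.vertex (r + 2)))

/-! ### Projective equivalence -/

theorem act_mk (φ : (Fin 3 → ℝ) ≃ₗ[ℝ] (Fin 3 → ℝ)) (v : Fin 3 → ℝ) (hv : v ≠ 0) :
    act φ (Projectivization.mk ℝ v hv) =
      Projectivization.mk ℝ (φ v) (by simpa using hv) := rfl

theorem act_refl (P : Pt) : act (LinearEquiv.refl ℝ _) P = P := by
  induction P using Projectivization.ind with | h v hv => rfl

theorem act_trans (φ ψ : (Fin 3 → ℝ) ≃ₗ[ℝ] (Fin 3 → ℝ)) (P : Pt) :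
    act (φ.trans ψ) P = act ψ (act φ P) := by
  induction P using Projectivization.ind with | h v hv => rfl

/-- Projective equivalence of twisted polygons. -/
instance TwistedPolygon.setoid (n c : ℕ) : Setoid (TwistedPolygon n c) where
  r A B := ∃ ψ : (Fin 3 → ℝ) ≃ₗ[ℝ] (Fin 3 → ℝ), ∀ r, B.vertex r = act ψ (A.vertex r)
  iseqv := by
    refine ⟨fun A => ⟨LinearEquiv.refl ℝ _, fun r => (act_refl _).symm⟩, ?_, ?_⟩
    · rintro A B ⟨ψ, h⟩
      refine ⟨ψ.symm, fun r => ?_⟩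
      rw [h, ← act_trans, LinearEquiv.self_trans_symm, act_refl]
    · rintro A B C ⟨ψ, h⟩ ⟨ψ', h'⟩
      exact ⟨ψ.trans ψ', fun r => by rw [h', h, act_trans]⟩

/-- The space of twisted `n`-gons indexed by `c/2 + ℤ` modulo projective equivalence: the space
`𝒫_n` for `c` even, the space `𝒫_n^*` for `c` odd. -/
def PolygonSpace (n c : ℕ) : Type := Quotient (TwistedPolygon.setoid n c)

/-- The class of a twisted polygon. -/
def PolygonSpace.mk (A : TwistedPolygon n c) : PolygonSpace n c := Quotient.mk _ A

/-- The cofactor map `ψ` of `φ`, which describes the action of `φ` on lines. -/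
theorem exists_cofactor (φ : (Fin 3 → ℝ) ≃ₗ[ℝ] (Fin 3 → ℝ)) :
    ∃ ψ : (Fin 3 → ℝ) ≃ₗ[ℝ] (Fin 3 → ℝ), ∃ d : ℝ, d ≠ 0 ∧
      (∀ v w, φ v ⨯₃ φ w = ψ (v ⨯₃ w)) ∧ ∀ v w, ψ v ⨯₃ ψ w = d • φ (v ⨯₃ w) := by
  set M : Matrix (Fin 3) (Fin 3) ℝ := LinearMap.toMatrix' φ.toLinearMap with hM
  have hφ : ∀ v, φ v = M *ᵥ v := fun v => by
    rw [hM, LinearMap.toMatrix'_mulVec]; rfl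
  have hdet : IsUnit M.det := by
    rw [hM, LinearMap.det_toMatrix']
    exact LinearEquiv.isUnit_det' φ
  have hu : IsUnit (M.adjugateᵀ) := by
    rw [Matrix.isUnit_iff_isUnit_det, Matrix.det_transpose, Matrix.det_adjugate]
    exact hdet.pow _
  refine ⟨LinearEquiv.ofBijective (Matrix.mulVecLin M.adjugateᵀ)
    ⟨Matrix.mulVec_injective_iff_isUnit.2 hu, Matrix.mulVec_surjective_iff_isUnit.2 hu⟩,
    M.det, hdet.ne_zero, ?_, ?_⟩
  · intro v w
    rw [hφ, hφ]
    ext i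
    fin_cases i <;>
      simp [cross_apply, Matrix.mulVec, dotProduct, Fin.sum_univ_three,
        Matrix.adjugate_fin_three] <;> ring
  · intro v w
    rw [hφ]
    ext i
    fin_cases i <;>
      simp [cross_apply, Matrix.mulVec, dotProduct, Fin.sum_univ_three,
        Matrix.adjugate_fin_three, Matrix.det_fin_three, Matrix.vecHead, Matrix.vecTail] <;> ring

theorem join_act {φ ψ : (Fin 3 → ℝ) ≃ₗ[ℝ] (Fin 3 → ℝ)}
    (h : ∀ v w, φ v ⨯₃ φ w = ψ (v ⨯₃ w)) {P Q : Pt} (hPQ : P ≠ Q) :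
    join (act φ P) (act φ Q) = act ψ (join P Q) := by
  induction P using Projectivization.ind with | h v hv =>
  induction Q using Projectivization.ind with | h w hw =>
  have h0 : v ⨯₃ w ≠ 0 :=
    mt (Projectivization.mk_eq_mk_iff_crossProduct_eq_zero hv hw).2 hPQ
  have h1 : φ v ⨯₃ φ w ≠ 0 := by rw [h]; simpa using h0
  rw [join, join, act_mk, act_mk, Projectivization.cross_mk_of_cross_ne_zero _ _ h0,
    Projectivization.cross_mk_of_cross_ne_zero _ _ h1, act_mk]
  congr 1
  exact h v w

theorem meet_act {φ ψ : (Fin 3 → ℝ) ≃ₗ[ℝ] (Fin 3 → ℝ)} {d : ℝ} (hd : d ≠ 0)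
    (h : ∀ v w, ψ v ⨯₃ ψ w = d • φ (v ⨯₃ w)) {l l' : Ln} (hl : l ≠ l') :
    meet (act ψ l) (act ψ l') = act φ (meet l l') := by
  induction l using Projectivization.ind with | h v hv =>
  induction l' using Projectivization.ind with | h w hw =>
  have h0 : v ⨯₃ w ≠ 0 :=
    mt (Projectivization.mk_eq_mk_iff_crossProduct_eq_zero hv hw).2 hl
  have h1 : ψ v ⨯₃ ψ w ≠ 0 := by rw [h]; simpa [hd] using h0
  rw [meet, meet, act_mk, act_mk, Projectivization.cross_mk_of_cross_ne_zero _ _ h0,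
    Projectivization.cross_mk_of_cross_ne_zero _ _ h1, act_mk, Projectivization.mk_eq_mk_iff']
  exact ⟨d, (h v w).symm⟩

/-- The cross ratio can be computed from arbitrary representatives. -/
theorem crossRatio_mk {a b c d : Fin 3 → ℝ} (ha : a ≠ 0) (hb : b ≠ 0) (hc : c ≠ 0) (hd : d ≠ 0) :
    crossRatio (Projectivization.mk ℝ a ha) (Projectivization.mk ℝ b hb)
      (Projectivization.mk ℝ c hc) (Projectivization.mk ℝ d hd) =
      ((a ⨯₃ b) ⬝ᵥ (c ⨯₃ d)) / ((b ⨯₃ c) ⬝ᵥ (d ⨯₃ a)) := by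
  obtain ⟨s, hs⟩ := Projectivization.exists_smul_eq_mk_rep ℝ a ha
  obtain ⟨t, ht⟩ := Projectivization.exists_smul_eq_mk_rep ℝ b hb
  obtain ⟨u, hu⟩ := Projectivization.exists_smul_eq_mk_rep ℝ c hc
  obtain ⟨v, hv⟩ := Projectivization.exists_smul_eq_mk_rep ℝ d hd
  rw [crossRatio, ← hs, ← ht, ← hu, ← hv]
  simp only [Units.smul_def, map_smul, LinearMap.smul_apply, smul_dotProduct, dotProduct_smul,
    smul_eq_mul]
  have h1 := s.ne_zero
  have h2 := t.ne_zero
  have h3 := u.ne_zero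
  have h4 := v.ne_zero
  rw [← mul_div_mul_left ((a ⨯₃ b) ⬝ᵥ (c ⨯₃ d)) ((b ⨯₃ c) ⬝ᵥ (d ⨯₃ a))
    (mul_ne_zero (mul_ne_zero h1 h2) (mul_ne_zero h3 h4))]
  congr 1 <;> ring

/-- The cross product of two vectors in a plane is a multiple of its normal vector. -/
theorem exists_cross_eq_smul {l a b : Fin 3 → ℝ} (hl : l ≠ 0) (ha : l ⬝ᵥ a = 0)
    (hb : l ⬝ᵥ b = 0) : ∃ s : ℝ, a ⨯₃ b = s • l := by
  have h : l ⨯₃ (a ⨯₃ b) = 0 := by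
    have e : l ⨯₃ (a ⨯₃ b) = (l ⬝ᵥ b) • a - (l ⬝ᵥ a) • b := by
      ext i
      fin_cases i <;> simp [cross_apply, dotProduct, Fin.sum_univ_three] <;> ring
    rw [e, ha, hb]
    simp
  by_cases h0 : a ⨯₃ b = 0
  · exact ⟨0, by simp [h0]⟩
  · obtain ⟨s, hs⟩ := (Projectivization.mk_eq_mk_iff' ℝ _ _ h0 hl).1
      ((Projectivization.mk_eq_mk_iff_crossProduct_eq_zero hl h0).2 h).symm
    exact ⟨s, hs.symm⟩

/-- The cross ratio of collinear points is a projective invariant. -/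
theorem crossRatio_act (φ : (Fin 3 → ℝ) ≃ₗ[ℝ] (Fin 3 → ℝ)) {l : Ln} {P Q R S : Pt}
    (hP : l.orthogonal P) (hQ : l.orthogonal Q) (hR : l.orthogonal R) (hS : l.orthogonal S) :
    crossRatio (act φ P) (act φ Q) (act φ R) (act φ S) = crossRatio P Q R S := by
  obtain ⟨ψ, -, -, h, -⟩ := exists_cofactor φ
  induction l using Projectivization.ind with | h l hl =>
  induction P using Projectivization.ind with | h a ha =>
  induction Q using Projectivization.ind with | h b hb =>
  induction R using Projectivization.ind with | h c hc =>
  induction S using Projectivization.ind with | h d hd =>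
  rw [Projectivization.orthogonal_mk] at hP hQ hR hS
  obtain ⟨s, hs⟩ := exists_cross_eq_smul hl hP hQ
  obtain ⟨t, ht⟩ := exists_cross_eq_smul hl hR hS
  obtain ⟨u, hu⟩ := exists_cross_eq_smul hl hQ hR
  obtain ⟨v, hv⟩ := exists_cross_eq_smul hl hS hP
  simp only [act_mk, crossRatio_mk, h, hs, ht, hu, hv, map_smul, smul_dotProduct, dotProduct_smul,
    smul_eq_mul]
  have h1 : l ⬝ᵥ l ≠ 0 := by simpa using hl
  have h2 : ψ l ⬝ᵥ ψ l ≠ 0 := by simpa using hl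
  rw [← mul_assoc, ← mul_assoc, mul_div_mul_right _ _ h2, ← mul_assoc, ← mul_assoc,
    mul_div_mul_right _ _ h1]

theorem ne_of_independent {P Q R : Pt} (h : Projectivization.Independent ![P, Q, R]) :
    P ≠ Q ∧ P ≠ R ∧ Q ≠ R := by
  rw [Projectivization.independent_iff] at h
  have := h.injective
  refine ⟨?_, ?_, ?_⟩ <;> rintro rfl
  · exact absurd (@this 0 1 rfl) (by decide)
  · exact absurd (@this 0 2 rfl) (by decide)
  · exact absurd (@this 1 2 rfl) (by decide)

theorem not_orthogonal_of_independent {P Q R : Pt}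
    (h : Projectivization.Independent ![P, Q, R]) : ¬ (join P Q).orthogonal R := by
  intro ho
  have hPQ := (ne_of_independent h).1
  rw [Projectivization.independent_iff] at h
  have e : (Projectivization.rep ∘ ![P, Q, R] : Fin 3 → Fin 3 → ℝ) =
      ![P.rep, Q.rep, R.rep] := by
    ext i; fin_cases i <;> rfl
  rw [e] at h
  have hdet : Matrix.det ![P.rep, Q.rep, R.rep] ≠ 0 := by
    have := (Matrix.linearIndependent_rows_iff_isUnit (A := ![P.rep, Q.rep, R.rep])).1 h
    exact ((Matrix.isUnit_iff_isUnit_det _).1 this).ne_zero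
  apply hdet
  rw [← triple_product_eq_det, triple_product_permutation, triple_product_permutation]
  rw [← P.mk_rep, ← Q.mk_rep] at hPQ
  rw [join, ← P.mk_rep, ← Q.mk_rep, ← R.mk_rep, Projectivization.cross_mk_of_ne _ _ hPQ,
    Projectivization.orthogonal_mk, dotProduct_comm] at ho
  exact ho

theorem cornerRatio_act (φ : (Fin 3 → ℝ) ≃ₗ[ℝ] (Fin 3 → ℝ)) {P Q R S U : Pt}
    (h1 : Projectivization.Independent ![P, Q, R]) (h2 : Projectivization.Independent ![P, Q, S])
    (hRS : R ≠ S) (hSU : S ≠ U) :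
    cornerRatio (act φ P) (act φ Q) (act φ R) (act φ S) (act φ U) = cornerRatio P Q R S U := by
  obtain ⟨ψ, d, hd, h, h'⟩ := exists_cofactor φ
  have hPQ := (ne_of_independent h1).1
  have hl : join P Q ≠ join R S := fun e =>
    not_orthogonal_of_independent h1 (e ▸ Projectivization.cross_orthogonal_left hRS)
  have hl' : join P Q ≠ join S U := fun e =>
    not_orthogonal_of_independent h2 (e ▸ Projectivization.cross_orthogonal_left hSU)
  rw [cornerRatio, join_act h hPQ, join_act h hRS, join_act h hSU, meet_act hd h' hl,
    meet_act hd h' hl']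
  exact crossRatio_act φ (l := join P Q) (Projectivization.cross_orthogonal_right hPQ)
    (Projectivization.cross_orthogonal_left hPQ) (Projectivization.orthogonal_cross_left hl)
    (Projectivization.orthogonal_cross_left hl')

theorem independent_perm {P Q R : Pt} (h : Projectivization.Independent ![P, Q, R]) :
    Projectivization.Independent ![R, Q, P] := by
  rw [Projectivization.independent_iff] at h ⊢
  have := h.comp (![2, 1, 0] : Fin 3 → Fin 3) (by decide)
  convert this using 1
  ext i; fin_cases i <;> rfl

theorem TwistedPolygon.x_congr {A B : TwistedPolygon n c} (h : A ≈ B) : A.x = B.x := by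
  obtain ⟨φ, h⟩ := h
  ext j
  set r := (j - c) / 2 with hr
  obtain ⟨a1, a2, a3, a4⟩ := A.generalPosition (r - 2)
  obtain ⟨b1, b2, b3, b4⟩ := A.generalPosition (r - 1)
  rw [show r - 2 + 1 = r - 1 by ring, show r - 2 + 2 = r by ring,
    show r - 2 + 3 = r + 1 by ring] at *
  rw [show r - 1 + 1 = r by ring, show r - 1 + 2 = r + 1 by ring,
    show r - 1 + 3 = r + 2 by ring] at *
  simp only [TwistedPolygon.x, ← hr, h]
  split_ifs
  · exact (cornerRatio_act φ a1 a2 (ne_of_independent b1).2.2 (ne_of_independent b4).2.2).symm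
  · exact (cornerRatio_act φ (independent_perm b4) (independent_perm b3)
      (ne_of_independent a1).2.2.symm (ne_of_independent a1).1.symm).symm

/-! ### Coordinates, rational maps and singularities -/

namespace PolygonSpace

/-- The coordinates `x_j` on the space of twisted polygons. -/
def x (p : PolygonSpace n c) (j : ℤ) : ℝ :=
  Quotient.lift (fun A : TwistedPolygon n c => A.x j)
    (fun _ _ h => congrFun (TwistedPolygon.x_congr h) j) p

/-- The coordinate vector `(x_1, …, x_{2n})`. -/
def coords (p : PolygonSpace n c) : Fin (2 * n) → ℝ := fun t => p.x ((t : ℤ) + 1)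

/-- The `y`-parameters: on `𝒫_n` (`c` even) `y_j = -(x_j x_{j+1})⁻¹` for `j` even and
`y_j = -x_j x_{j+1}` for `j` odd; on `𝒫_n^*` (`c` odd) the other way around. -/
def y (p : PolygonSpace n c) (j : ℤ) : ℝ :=
  if Even (j - c) then -(p.x j * p.x (j + 1))⁻¹ else -(p.x j * p.x (j + 1))

/-- `q = T(p)` for the pentagram map on projective equivalence classes. -/
def IsPentagram (p : PolygonSpace n c) (q : PolygonSpace n (c + 1)) : Prop :=
  ∃ (A : TwistedPolygon n c) (B : TwistedPolygon n (c + 1)),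
    mk A = p ∧ mk B = q ∧ A.IsPentagram B

/-- `q` is obtained from `p ∈ 𝒫_n` by carrying out the pentagram construction `k` times, all
intermediate polygons being twisted polygons. -/
def IsIterate : (k : ℕ) → PolygonSpace n 0 → PolygonSpace n k → Prop
  | 0, p, q => q = p
  | k + 1, p, q => ∃ q' : PolygonSpace n k, IsIterate k p q' ∧ IsPentagram q' q

/-- The rational map `T^k` is regular at `p`, with value `q`. For each coordinate `x_t`, the
rational function `x_t ∘ T^k` of the coordinates `x_1, …, x_{2n}` (which is determined by the
polygons at which the pentagram construction can be carried out `k` times) has an expression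
`f / g` whose denominator does not vanish at `p`, and `f / g` at `p` is `x_t(q)`. -/
def HasValueAt (k : ℕ) (p : PolygonSpace n 0) (q : PolygonSpace n k) : Prop :=
  ∀ t : Fin (2 * n), ∃ f g : MvPolynomial (Fin (2 * n)) ℝ,
    (∀ (p' : PolygonSpace n 0) (q' : PolygonSpace n k), IsIterate k p' q' →
      q'.coords t * MvPolynomial.eval p'.coords g = MvPolynomial.eval p'.coords f) ∧
    MvPolynomial.eval p.coords g ≠ 0 ∧
    q.coords t = MvPolynomial.eval p.coords f / MvPolynomial.eval p.coords g

/-- The rational map `T^k` from `𝒫_n` to `𝒫_n` or `𝒫_n^*` is regular at `p`. -/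
def IsNonsingularAt (k : ℕ) (p : PolygonSpace n 0) : Prop :=
  ∃ q : PolygonSpace n k, HasValueAt k p q

/-- `p` is a singular point of `T^k`. -/
def IsSingularAt (k : ℕ) (p : PolygonSpace n 0) : Prop := ¬ IsNonsingularAt k p

/-- `Q` holds at a generic point of `X`: it holds on the set of points of `X` where some polynomial
`g` in the coordinates does not vanish, and this Zariski open subset of `X` is Zariski dense
in `X`. -/
def HoldsGenerically (X : Set (PolygonSpace n c)) (Q : PolygonSpace n c → Prop) : Prop :=
  ∃ g : MvPolynomial (Fin (2 * n)) ℝ,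
    (∀ p ∈ X, MvPolynomial.eval p.coords g ≠ 0 → Q p) ∧
    ∀ h : MvPolynomial (Fin (2 * n)) ℝ,
      (∀ p ∈ X, MvPolynomial.eval p.coords g ≠ 0 → MvPolynomial.eval p.coords h = 0) →
      ∀ p ∈ X, MvPolynomial.eval p.coords h = 0

/-- `X_S = ⋂_{s ∈ S} {y_{2s} = -1}`, for a set `S` of indices of vertices, `S ⊆ c/2 + ℤ`. -/
def XLocus (n c : ℕ) (S : Set ℚ) : Set (PolygonSpace n c) :=
  {p | ∀ j : ℤ, (j : ℚ) / 2 ∈ S → p.y j = -1}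

/-- `Y_S = ⋂_{s ∈ S} {y_{2s} = -1}`, for a set `S` of indices of sides, `S ⊆ (c+1)/2 + ℤ`. -/
def YLocus (n c : ℕ) (S : Set ℚ) : Set (PolygonSpace n c) :=
  {p | ∀ j : ℤ, (j : ℚ) / 2 ∈ S → p.y j = -1}

end PolygonSpace

/-- The arithmetic progression `[a, b]_d = {a, a + d, a + 2d, …, b}`, for `b - a` a nonnegative
multiple of `d`. -/
def arithProg (a b : ℚ) (d : ℕ) : Set ℚ := {s | ∃ t : ℕ, s = a + d * t ∧ s ≤ b}

end Pentagram

end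

open Pentagram

/-! The iterates are governed by polynomials `tau s a b` on a square lattice, solutions of an
octahedron recurrence with monomial coefficients and initial values `1` (`octaAt`). Put `y_{3a+b}`
for the variable at `(a, b)` to get `tauVal y s j`. Then, for `j ≡ k` mod 2, each of `x_j ∘ T^k` and
`x_{j+1} ∘ T^k` is a Laurent monomial times a quotient of products of two values, one at level `k`
and one at level `k + 1` (`IsIterate.isValue`). Singularities of `T^k` are therefore read off from
the zeros of `tauVal` on `X_S`. By a Plücker relation, `y_{2s} = -1` says that `A_{s-2}, A_s,
A_{s+2}` are collinear, which gives the description of `X_S`. In the lattice, the `m` conditions put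
`-1` at the diagonal points `(t, t)`, `0 ≤ t < m`. Replacing `-1` by `ε - 1` and counting powers of
`ε` in the recurrence shows that `tauVal` vanishes on a finite pattern at the levels `2, …, m + 1`
(`X_dvd_perturb_tau`). Conversely, the values just beyond the pattern, and all values of the
relevant parity at the levels `m + 2` and `m + 3`, are not identically zero on `X_S`. To see this,
set the odd `y_j` equal to `-1` and take cross-ratio-like quotients of a positive sequence `g` as
the even ones: the recurrence turns into Dodgson condensation and `tauVal` into a determinant of
values of `g` (`tauVal_detCoef`). Suitable `g` respecting the conditions of `X_S` make this
determinant close to that of a permutation matrix (`exists_tauVal_ne_zero`). Finally `X_S` is a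
retract of a torus, so Laurent polynomials have no zero divisors on it
(`IsLaurent.eq_zero_or_eq_zero_on`). For `1 ≤ k ≤ m + 1`, a zero of `tauVal` on one side of a
polynomial identity forces a numerator or denominator of a supposed regular expression to vanish on
all of `X_S`, a contradiction. At `k = m + 2` the denominators are generically nonzero, and the
zeros at level `m + 1` reduce the recurrence to `x_j x_{j+1} = 1`, which is membership in `Y_{S'}`.
-/

namespace Pentagram

/-! ### Products over symmetric intervals -/

section Slab

variable {M : Type*} [CommMonoid M]

/-- The product of `f i` over `-k ≤ i ≤ k`. -/
noncomputable def slab (f : ℤ → M) (k : ℕ) : M := ∏ i ∈ Finset.Icc (-(k : ℤ)) k, f i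

theorem slab_zero (f : ℤ → M) : slab f 0 = f 0 := by simp [slab]

theorem slab_succ (f : ℤ → M) (k : ℕ) :
    slab f (k + 1) = f (-((k : ℤ) + 1)) * (f ((k : ℤ) + 1) * slab f k) := by
  have h : Finset.Icc (-((k + 1 : ℕ) : ℤ)) ((k + 1 : ℕ) : ℤ) =
      insert (-((k : ℤ) + 1)) (insert ((k : ℤ) + 1) (Finset.Icc (-(k : ℤ)) k)) := by
    ext i; simp only [Finset.mem_Icc, Finset.mem_insert]; push_cast; omega
  rw [slab, h, Finset.prod_insert, Finset.prod_insert]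
  · rfl
  · simp
  · simp only [Finset.mem_insert, Finset.mem_Icc]; omega

theorem slab_shift_right (f : ℤ → M) (k : ℕ) :
    slab (fun i => f (i + 1)) (k + 1) = f ((k : ℤ) + 1) * (f ((k : ℤ) + 2) * slab f k) := by
  have h : Finset.Icc (-(k : ℤ)) ((k : ℤ) + 2) =
      insert ((k : ℤ) + 1) (insert ((k : ℤ) + 2) (Finset.Icc (-(k : ℤ)) k)) := by
    ext i; simp only [Finset.mem_Icc, Finset.mem_insert]; omega
  have h2 : slab (fun i => f (i + 1)) (k + 1) = ∏ i ∈ Finset.Icc (-(k : ℤ)) ((k : ℤ) + 2), f i := by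
    rw [slab]
    refine Finset.prod_bij' (fun i _ => i + 1) (fun i _ => i - 1) ?_ ?_ ?_ ?_ ?_ <;>
      simp only [Finset.mem_Icc] <;> intros <;> first | trivial | rfl | (push_cast at *; omega)
  rw [h2, h, Finset.prod_insert, Finset.prod_insert]
  · rfl
  · simp
  · simp only [Finset.mem_insert, Finset.mem_Icc]; omega

theorem slab_neg (f : ℤ → M) (k : ℕ) : slab (fun i => f (-i)) k = slab f k := by
  refine Finset.prod_bij' (fun i _ => -i) (fun i _ => -i) ?_ ?_ ?_ ?_ ?_ <;>
    simp only [Finset.mem_Icc] <;> intros <;> first | trivial | rfl | omega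

theorem slab_shift_left (f : ℤ → M) (k : ℕ) :
    slab (fun i => f (i - 1)) (k + 1) =
      f (-((k : ℤ) + 1)) * (f (-((k : ℤ) + 2)) * slab f k) := by
  have h := slab_shift_right (fun i => f (-i)) k
  rw [slab_neg] at h
  rw [← h, ← slab_neg]
  congr 1; ext i; congr 1; ring

/-- The shifted intervals `[-k, k+2]` and `[-k-2, k]` meet in `[-k, k]` and cover `[-k-2, k+2]`.
This is the compatibility of the coefficients on which polynomiality of `tau` rests. -/
theorem slab_shift_mul_slab_shift (f : ℤ → M) (k : ℕ) :
    slab (fun i => f (i + 1)) (k + 1) * slab (fun i => f (i - 1)) (k + 1) =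
      slab f k * slab f (k + 2) := by
  rw [slab_shift_right, slab_shift_left, slab_succ f (k + 1), slab_succ f k]
  push_cast
  rw [show (k : ℤ) + 1 + 1 = k + 2 by ring]
  ac_rfl

end Slab

/-! ### The octahedron recurrence with coefficients -/

open MvPolynomial

/-- Polynomials in variables indexed by the square lattice. -/
abbrev LatPoly : Type := MvPolynomial (ℤ × ℤ) ℝ

/-- The coefficient of the octahedron recurrence. -/
noncomputable def coef (k : ℕ) (a b : ℤ) : LatPoly := slab (fun i => X (a + i, b)) k

open Classical in
/-- A solution `q` of `a * q = b`, if there is one. -/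
noncomputable def exactQuot (a b : LatPoly) : LatPoly := if h : a ∣ b then h.choose else 0

theorem mul_exactQuot {a b : LatPoly} (h : a ∣ b) : a * exactQuot a b = b := by
  rw [exactQuot, dif_pos h]; exact h.choose_spec.symm

/-- The solution of the octahedron recurrence with initial values `1`. -/
noncomputable def tau : ℕ → ℤ → ℤ → LatPoly
  | 0, _, _ => 1
  | 1, _, _ => 1
  | (k + 2), a, b => exactQuot (tau k a b)
      (tau (k + 1) (a - 1) b * tau (k + 1) (a + 1) b +
        coef k a b * (tau (k + 1) a (b - 1) * tau (k + 1) a (b + 1)))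

/-- The right hand side of the octahedron recurrence. -/
noncomputable def octa (k : ℕ) (a b : ℤ) : LatPoly :=
  tau (k + 1) (a - 1) b * tau (k + 1) (a + 1) b +
    coef k a b * (tau (k + 1) a (b - 1) * tau (k + 1) a (b + 1))

/-- The octahedron recurrence holds at level `k`. -/
def OctaAt (k : ℕ) : Prop := ∀ a b, tau k a b * tau (k + 2) a b = octa k a b

/-- Without divisibility `exactQuot` returns the default `0`. Until `octaAt` is proved by induction
on the level, the recurrence is therefore carried as a hypothesis for the levels already reached. -/
theorem octaAt_of_dvd {k : ℕ} (h : ∀ a b, tau k a b ∣ octa k a b) : OctaAt k := fun a b => by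
  rw [tau]; exact mul_exactQuot (h a b)

/-! ### Constant terms, variables and coprimality of the values of `tau`. -/

theorem constantCoeff_coef (k : ℕ) (a b : ℤ) : constantCoeff (coef k a b) = 0 := by
  rw [coef, slab, map_prod, Finset.prod_eq_zero (i := 0)]
  · simp
  · simp

/-- The coefficients have constant term zero, so modulo the variables the recurrence reads `1 * 1 =
1`. Hence `tau` is nonzero and no variable divides it. -/
theorem constantCoeff_tau {s : ℕ} (h : ∀ k, k + 2 ≤ s → OctaAt k) (a b : ℤ) :
    constantCoeff (tau s a b) = 1 := by
  induction s using Nat.strong_induction_on generalizing a b with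
  | _ s ih =>
    match s, ih, h with
    | 0, _, _ => simp [tau]
    | 1, _, _ => simp [tau]
    | k + 2, ih, h =>
      have e := congrArg constantCoeff (h k le_rfl a b)
      have i1 : ∀ a b, constantCoeff (tau (k + 1) a b) = 1 :=
        ih (k + 1) (by omega) (fun l hl => h l (by omega))
      rw [octa, map_mul, map_add, map_mul, map_mul, constantCoeff_coef,
        ih k (by omega) (fun l hl => h l (by omega)), i1, i1] at e
      simpa using e

theorem tau_ne_zero_of {s : ℕ} (h : ∀ k, k + 2 ≤ s → OctaAt k) (a b : ℤ) : tau s a b ≠ 0 := by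
  intro e
  have := constantCoeff_tau h a b
  simp [e] at this

theorem degreeOf_eq_zero_of_dvd {v : ℤ × ℤ} {p q : LatPoly} (hq : q ≠ 0) (h : p ∣ q)
    (h0 : degreeOf v q = 0) : degreeOf v p = 0 := by
  obtain ⟨r, rfl⟩ := h
  rw [degreeOf_mul_eq (left_ne_zero_of_mul hq) (right_ne_zero_of_mul hq)] at h0
  omega

theorem degreeOf_coef {v : ℤ × ℤ} {k : ℕ} {a b : ℤ} (h : (k : ℤ) < |v.1 - a| + |v.2 - b|) :
    degreeOf v (coef k a b) = 0 := by
  rw [← Nat.le_zero]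
  refine (degreeOf_prod_le v _ _).trans ?_
  rw [Nat.le_zero, Finset.sum_eq_zero]
  intro i hi
  rw [Finset.mem_Icc] at hi
  rw [degreeOf_X, if_neg]
  rintro rfl
  simp only [add_sub_cancel_left, sub_self, abs_zero, add_zero] at h
  rw [lt_abs] at h
  omega

/-- Each level enlarges by one the ℓ¹-ball of variables that can occur, and a divisor of a nonzero
polynomial contains no new variable. So only variables at distance at most `s - 2` from `(a, b)`
occur. -/
theorem degreeOf_tau {s : ℕ} (h : ∀ k, k + 2 ≤ s → OctaAt k) {v : ℤ × ℤ} {a b : ℤ}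
    (hv : (s : ℤ) < |v.1 - a| + |v.2 - b| + 2) : degreeOf v (tau s a b) = 0 := by
  induction s using Nat.strong_induction_on generalizing a b with
  | _ s ih =>
    match s, ih, h, hv with
    | 0, _, _, _ => simp [tau]
    | 1, _, _, _ => simp [tau]
    | k + 2, ih, h, hv =>
      refine degreeOf_eq_zero_of_dvd (q := octa k a b) ?_ ⟨tau k a b, ?_⟩ ?_
      · rw [← h k le_rfl]
        exact mul_ne_zero (tau_ne_zero_of (fun l hl => h l (by omega)) _ _)
          (tau_ne_zero_of h _ _)
      · rw [← h k le_rfl, mul_comm]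
      · have i1 : ∀ a' b', |a' - a| + |b' - b| ≤ 1 → degreeOf v (tau (k + 1) a' b') = 0 := by
          intro a' b' hab
          refine ih (k + 1) (by omega) (fun l hl => h l (by omega)) ?_
          push_cast at hv ⊢
          have h1 := abs_sub_le v.1 a' a
          have h2 := abs_sub_le v.2 b' b
          linarith
        have i2 : degreeOf v (coef k a b) = 0 := degreeOf_coef (by push_cast at hv; linarith)
        rw [← Nat.le_zero]
        refine (degreeOf_add_le _ _ _).trans (max_le ?_ ?_)
        · refine (degreeOf_mul_le _ _ _).trans ?_
          rw [i1 (a - 1) b (by simp), i1 (a + 1) b (by simp)]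
        · refine (degreeOf_mul_le _ _ _).trans ?_
          rw [i2, zero_add]
          refine (degreeOf_mul_le _ _ _).trans ?_
          rw [i1 a (b - 1) (by simp), i1 a (b + 1) (by simp)]

/-- Setting the variable `v` to zero. -/
noncomputable def kill (v : ℤ × ℤ) : LatPoly →ₐ[ℝ] LatPoly :=
  aeval (fun w => if w = v then 0 else X w)

theorem kill_of_degreeOf {v : ℤ × ℤ} {p : LatPoly} (h : degreeOf v p = 0) : kill v p = p := by
  have h' : v ∉ p.vars := by
    classical
    rw [vars_def, Multiset.mem_toFinset, ← Multiset.count_eq_zero, ← degreeOf_def]; exact h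
  conv_rhs => rw [← aeval_X_left_apply p]
  refine eval₂Hom_congr' rfl ?_ rfl
  rintro i hi -
  rw [if_neg]
  rintro rfl
  exact h' hi

/-- The killed variable is the extreme one in direction `δ`. It occurs in the coefficient, which
dies. Of the remaining product, one factor does not contain it and the other becomes, by induction,
the value `tau k a b` that is divided out. -/
theorem kill_tau {s : ℕ} (h : ∀ k, k + 2 ≤ s + 1 → OctaAt k) {δ : ℤ} (hδ : δ = 1 ∨ δ = -1)
    (a b : ℤ) : kill (a + δ * ((s : ℤ) - 1), b) (tau (s + 1) a b) = tau s (a - δ) b := by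
  induction s generalizing a b with
  | zero => simp [tau]
  | succ k ih =>
    have hk := h k le_rfl a b
    have e := congrArg (kill (a + δ * (((k + 1 : ℕ) : ℤ) - 1), b)) hk
    push_cast at e ⊢
    rw [add_sub_cancel_right] at e ⊢
    have h1 : kill (a + δ * k, b) (tau k a b) = tau k a b :=
      kill_of_degreeOf (degreeOf_tau (fun l hl => h l (by omega)) (by
        rcases hδ with rfl | rfl <;> simp))
    have h2 : kill (a + δ * k, b) (tau (k + 1) (a - δ) b) = tau (k + 1) (a - δ) b :=
      kill_of_degreeOf (degreeOf_tau (fun l hl => h l (by omega)) (by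
        rcases hδ with rfl | rfl <;> simp
        · rw [abs_of_nonneg (by omega)]; omega
        · rw [abs_of_nonpos (by omega)]; omega))
    have h3 : kill (a + δ * k, b) (tau (k + 1) (a + δ) b) = tau k a b := by
      have := ih (fun l hl => h l (by omega)) (a + δ) b
      rwa [add_sub_cancel_right, show a + δ + δ * ((k : ℤ) - 1) = a + δ * k by ring] at this
    have h4 : kill (a + δ * k, b) (coef k a b) = 0 := by
      rw [coef, slab, map_prod, Finset.prod_eq_zero (i := δ * k)]
      · rcases hδ with rfl | rfl <;> simp
      · simp [kill]
    have h5 : tau k a b ≠ 0 := tau_ne_zero_of (fun l hl => h l (by omega)) _ _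
    refine mul_left_cancel₀ h5 ?_
    rw [map_mul, h1, octa, map_add, map_mul, map_mul (kill _) (coef k a b), h4, zero_mul, add_zero]
      at e
    rw [e]
    rcases hδ with rfl | rfl
    · rw [h2, h3, mul_comm]
    · rw [sub_neg_eq_add] at *
      rw [← sub_eq_add_neg] at h3
      rw [h2, h3]

/-- A prime divisor of a value of `tau` does not divide the coefficients. -/
theorem not_dvd_coef {d p : LatPoly} (hd : Prime d) (hp : constantCoeff p = 1) (hdp : d ∣ p)
    (k : ℕ) (a b : ℤ) : ¬ d ∣ coef k a b := by
  intro h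
  obtain ⟨i, -, hi⟩ := hd.exists_mem_finset_dvd
    (show d ∣ ∏ i ∈ Finset.Icc (-(k : ℤ)) k, (X (a + i, b) : LatPoly) from h)
  obtain ⟨q, hq⟩ := hi
  have hX : Prime (X (a + i, b) : LatPoly) := X_prime
  have h0 : constantCoeff d ≠ 0 := by
    obtain ⟨r, rfl⟩ := hdp
    intro h0
    simp [h0] at hp
  rcases (hX.dvd_mul).1 (dvd_of_eq hq) with ⟨r, hr⟩ | ⟨r, hr⟩
  · apply h0; rw [hr]; simp
  · apply hd.not_isUnit
    rw [hr, mul_left_comm] at hq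
    have : d * r = 1 := mul_left_cancel₀ hX.ne_zero (by rw [← hq, mul_one])
    exact IsUnit.of_mul_eq_one _ this

/-- The extreme variable of the first value does not occur in the second, hence not in the common
divisor `d`. Killing it fixes `d` and lowers the level of the first value by one. -/
theorem dvd_tau_sub {s : ℕ} (h : ∀ k, k + 2 ≤ s + 1 → OctaAt k) {d : LatPoly}
    {δ : ℤ} (hδ : δ = 1 ∨ δ = -1) {a b a' b' : ℤ} (hd : d ∣ tau (s + 1) a b)
    (hd' : d ∣ tau (s + 1) a' b') (hlt : (s : ℤ) < |a + δ * ((s : ℤ) - 1) - a'| + |b - b'| + 1) :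
    d ∣ tau s (a - δ) b := by
  have h0 : degreeOf (a + δ * ((s : ℤ) - 1), b) d = 0 :=
    degreeOf_eq_zero_of_dvd (tau_ne_zero_of h _ _) hd' (degreeOf_tau h (by push_cast; omega))
  rw [← kill_tau h hδ, ← kill_of_degreeOf h0]
  exact map_dvd _ hd

/-- Descent on the level: two values with a common prime divisor are replaced by two values one
level lower, until the level where `tau` is `1`. The new points are obtained by moving the old ones
along the first axis. -/
theorem not_dvd_tau_and_dvd_tau {s : ℕ} (h : ∀ k, k + 1 ≤ s → OctaAt k) {d : LatPoly}
    (hd : Prime d) {a b a' b' : ℤ} (hne : (a, b) ≠ (a', b')) (h1 : d ∣ tau s a b)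
    (h2 : d ∣ tau s a' b') : False := by
  induction s generalizing a b a' b' with
  | zero => exact hd.not_isUnit (isUnit_of_dvd_one (by simpa [tau] using h1))
  | succ s ih =>
    have hs : ∀ k, k + 2 ≤ s + 1 → OctaAt k := fun k hk => h k (by omega)
    have ih' := @ih (fun k hk => h k (by omega))
    rcases Nat.eq_zero_or_pos s with rfl | hpos
    · exact hd.not_isUnit (isUnit_of_dvd_one (by simpa [tau] using h1))
    have key : ∀ a b a' b' : ℤ, a < a' → ¬ (a + 1 = a' - 1 ∧ b = b') → d ∣ tau (s + 1) a b →
        d ∣ tau (s + 1) a' b' → False := by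
      intro a b a' b' hlt hne h1 h2
      have e1 : d ∣ tau s (a + 1) b := by
        have := dvd_tau_sub hs (δ := -1) (Or.inr rfl) h1 h2 (by
          rw [abs_of_nonpos (by omega)]
          have := abs_nonneg (b - b'); omega)
        rwa [sub_neg_eq_add] at this
      have e2 : d ∣ tau s (a' - 1) b' :=
        dvd_tau_sub hs (δ := 1) (Or.inl rfl) h2 h1 (by
          rw [abs_of_nonneg (by omega)]
          have := abs_nonneg (b' - b); omega)
      exact ih' (fun e => hne (by simpa using e)) e1 e2
    have main : ∀ a b a' b' : ℤ, a < a' → d ∣ tau (s + 1) a b →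
        d ∣ tau (s + 1) a' b' → False := by
      intro a b a' b' hlt h1 h2
      -- Points at distance two in one row would collapse to a single point. Then the recurrence
      -- centred between them shows that `d` also divides one of the values above and below the
      -- centre, and the descent applies to that pair.
      by_cases hc : a + 1 = a' - 1 ∧ b = b'
      · obtain ⟨ha, rfl⟩ := hc
        obtain rfl : a' = a + 2 := by omega
        have e := h s le_rfl (a + 1) b
        rw [octa, add_sub_cancel_right, show a + 1 + 1 = a + 2 by ring] at e
        have h3 : d ∣ coef s (a + 1) b * (tau (s + 1) (a + 1) (b - 1) *
            tau (s + 1) (a + 1) (b + 1)) := by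
          rw [← dvd_add_right (h1.mul_right _), ← e]
          obtain ⟨t, rfl⟩ : ∃ t, s = t + 1 := ⟨s - 1, by omega⟩
          have e3 : d ∣ tau (t + 1) (a + 1) b := by
            have := dvd_tau_sub hs (δ := -1) (Or.inr rfl) h1 h2 (by
              rw [abs_of_nonpos (by omega)]; simp)
            rwa [sub_neg_eq_add] at this
          exact e3.mul_right _
        rcases (hd.dvd_mul).1 h3 with h4 | h4
        · exact not_dvd_coef hd (constantCoeff_tau hs _ _) h1 _ _ _ h4
        · rcases (hd.dvd_mul).1 h4 with h5 | h5
          · exact key a b (a + 1) (b - 1) (by omega) (by omega) h1 h5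
          · exact key a b (a + 1) (b + 1) (by omega) (by omega) h1 h5
      · exact key a b a' b' hlt hc h1 h2
    rcases lt_trichotomy a a' with hlt | rfl | hlt
    · exact main _ _ _ _ hlt h1 h2
    · have hb : b ≠ b' := fun e => hne (by rw [e])
      have hb' : 0 < |b - b'| := abs_pos.2 (sub_ne_zero.2 hb)
      have hb'' : 0 < |b' - b| := abs_pos.2 (sub_ne_zero.2 hb.symm)
      have e1 : d ∣ tau s (a - 1) b := dvd_tau_sub hs (δ := 1) (Or.inl rfl) h1 h2 (by
          rw [abs_of_nonneg (by omega)]; omega)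
      have e2 : d ∣ tau s (a - 1) b' := dvd_tau_sub hs (δ := 1) (Or.inl rfl) h2 h1 (by
          rw [abs_of_nonneg (by omega)]; omega)
      exact ih' (fun e => hb (by simpa using e)) e1 e2
    · exact main _ _ _ _ hlt h2 h1

/-- Adjacent values in consecutive layers are coprime. -/
theorem isRelPrime_tau {k : ℕ} (h : ∀ l, l ≤ k → OctaAt l) (a b : ℤ) {a' b' : ℤ}
    (hab : (a' = a - 1 ∧ b' = b) ∨ (a' = a + 1 ∧ b' = b) ∨ (a' = a ∧ b' = b - 1) ∨
      (a' = a ∧ b' = b + 1)) : IsRelPrime (tau (k + 2) a b) (tau (k + 1) a' b') := by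
  have hs : ∀ l, l + 2 ≤ k + 2 → OctaAt l := fun l hl => h l (by omega)
  have hs1 : ∀ l, l + 2 ≤ k + 1 → OctaAt l := fun l hl => h l (by omega)
  rw [UniqueFactorizationMonoid.isRelPrime_iff_no_prime_factors (tau_ne_zero_of hs a b)]
  intro d h1 h2 hd
  have e := h k le_rfl a b
  have same := fun (a b a' b' : ℤ) => @not_dvd_tau_and_dvd_tau (k + 1) (fun l hl => h l (by omega))
    d hd a b a' b'
  have h3 : d ∣ octa k a b := e ▸ h1.mul_left _
  rw [octa] at h3
  have hM : ∀ q, d ∣ coef k a b * q → d ∣ q := fun q hq =>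
    ((hd.dvd_mul).1 hq).resolve_left
      (not_dvd_coef hd (constantCoeff_tau hs1 _ _) h2 _ _ _)
  rcases hab with ⟨rfl, rfl⟩ | ⟨rfl, rfl⟩ | ⟨rfl, rfl⟩ | ⟨rfl, rfl⟩
  · have h4 := hM _ ((dvd_add_right (h2.mul_right _)).1 h3)
    rcases (hd.dvd_mul).1 h4 with h5 | h5 <;> exact same _ _ _ _ (by simp) h2 h5
  · have h4 := hM _ ((dvd_add_right (h2.mul_left _)).1 h3)
    rcases (hd.dvd_mul).1 h4 with h5 | h5 <;> exact same _ _ _ _ (by simp) h2 h5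
  · have h4 := (dvd_add_left ((h2.mul_right _).mul_left _)).1 h3
    rcases (hd.dvd_mul).1 h4 with h5 | h5 <;> exact same _ _ _ _ (by simp) h2 h5
  · have h4 := (dvd_add_left ((h2.mul_left _).mul_left _)).1 h3
    rcases (hd.dvd_mul).1 h4 with h5 | h5 <;> exact same _ _ _ _ (by simp) h2 h5

theorem coef_mul_coef (k : ℕ) (a b : ℤ) :
    coef (k + 1) (a + 1) b * coef (k + 1) (a - 1) b = coef k a b * coef (k + 2) a b := by
  rw [coef, coef, coef, coef, ← slab_shift_mul_slab_shift (fun i => (X (a + i, b) : LatPoly))]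
  congr 2 <;> ext1 i <;> congr 2 <;> ring

/-- Laurent phenomenon. Let `f = tau (k + 2) a b`. Its four neighbours one level lower are coprime
to it, so divisibility may be tested after multiplying by them. Modulo `f`, each of the recurrences
centred at the neighbours loses the term containing `f`; with `coef_mul_coef`, the multiplied right
hand side becomes a multiple of `octa k a b = tau k a b * f`, which is zero. -/
theorem octaAt (k : ℕ) : OctaAt k := by
  induction k using Nat.strong_induction_on with
  | _ k ih =>
    match k, ih with
    | 0, _ => exact octaAt_of_dvd fun a b => by simp [tau]
    | 1, _ => exact octaAt_of_dvd fun a b => by simp [tau]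
    | k + 2, ih =>
      refine octaAt_of_dvd fun a b => ?_
      have hr := @isRelPrime_tau k (fun l hl => ih l (by omega)) a b
      have rE := hr (a' := a + 1) (b' := b) (by simp)
      have rW := hr (a' := a - 1) (b' := b) (by simp)
      have rN := hr (a' := a) (b' := b + 1) (by simp)
      have rS := hr (a' := a) (b' := b - 1) (by simp)
      have oE := ih (k + 1) (by omega) (a + 1) b
      have oW := ih (k + 1) (by omega) (a - 1) b
      have oN := ih (k + 1) (by omega) a (b + 1)
      have oS := ih (k + 1) (by omega) a (b - 1)
      have o := ih k (by omega) a b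
      have c := coef_mul_coef k a b
      simp only [octa, add_sub_cancel_right, sub_add_cancel, Nat.reduceAdd, add_assoc] at *
      refine rE.dvd_of_dvd_mul_left (rW.dvd_of_dvd_mul_left (rN.dvd_of_dvd_mul_left
        (rS.dvd_of_dvd_mul_left ?_)))
      generalize tau (k + 2) a b = f at *
      generalize tau (k + 1) (a + 1) b = e at *
      generalize tau (k + 1) (a - 1) b = w at *
      generalize tau (k + 1) a (b + 1) = n at *
      generalize tau (k + 1) a (b - 1) = s at *
      generalize coef (k + 1) (a + 1) b = mE at *
      generalize coef (k + 1) (a - 1) b = mW at *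
      generalize coef (k + 1) a (b + 1) = mN at *
      generalize coef (k + 1) a (b - 1) = mS at *
      generalize coef k a b = m0 at *
      generalize coef (k + 2) a b = m2 at *
      rw [← Ideal.mem_span_singleton, ← Ideal.Quotient.eq_zero_iff_mem]
      have hf : Ideal.Quotient.mk (Ideal.span {f}) f = 0 := by
        rw [Ideal.Quotient.eq_zero_iff_mem]; exact Ideal.mem_span_singleton_self f
      replace oE := congrArg (Ideal.Quotient.mk (Ideal.span {f})) oE
      replace oW := congrArg (Ideal.Quotient.mk (Ideal.span {f})) oW
      replace oN := congrArg (Ideal.Quotient.mk (Ideal.span {f})) oN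
      replace oS := congrArg (Ideal.Quotient.mk (Ideal.span {f})) oS
      replace o := congrArg (Ideal.Quotient.mk (Ideal.span {f})) o
      replace c := congrArg (Ideal.Quotient.mk (Ideal.span {f})) c
      generalize Ideal.Quotient.mk (Ideal.span {f}) = φ at *
      simp only [map_mul, map_add, hf, zero_mul, mul_zero, zero_add, add_zero] at *
      generalize φ (tau (k + 3) (a + 1) b) = tE at *
      generalize φ (tau (k + 3) (a - 1) b) = tW at *
      generalize φ (tau (k + 3) a (b + 1)) = tN at *
      generalize φ (tau (k + 3) a (b - 1)) = tS at *
      generalize φ (tau (k + 2) (a + 1) (b + 1)) = c₁ at *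
      generalize φ (tau (k + 2) (a + 1) (b - 1)) = c₂ at *
      generalize φ (tau (k + 2) (a - 1) (b + 1)) = c₃ at *
      generalize φ (tau (k + 2) (a - 1) (b - 1)) = c₄ at *
      linear_combination φ n * φ s * (φ w * tW) * oE + φ n * φ s * φ mE * c₁ * c₂ * oW +
        φ e * φ w * φ m2 * (φ s * tS) * oN + φ e * φ w * φ m2 * c₃ * c₁ * oS +
        φ n * φ s * (c₁ * c₂ * c₃ * c₄) * c - φ m2 * (c₁ * c₂ * c₃ * c₄) * o

end Pentagram

namespace Pentagram

open MvPolynomial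

/-! ### Vanishing of `tau` along a row of zeros -/

/-- The substitution `y = ε - 1` along the points `(t, t)`, `0 ≤ t < m`. -/
noncomputable def perturb (m : ℕ) : LatPoly →+* Polynomial LatPoly :=
  eval₂Hom (Polynomial.C.comp C) fun v =>
    if v.1 = v.2 ∧ 0 ≤ v.1 ∧ v.1 < m then Polynomial.X - 1 else Polynomial.C (X v)

/-- Setting the variables off the row to zero. -/
noncomputable def perturbZero (m : ℕ) : LatPoly →+* Polynomial ℝ :=
  (Polynomial.mapRingHom constantCoeff).comp (perturb m)

theorem perturb_X (m : ℕ) (v : ℤ × ℤ) : perturb m (X v) =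
    if v.1 = v.2 ∧ 0 ≤ v.1 ∧ v.1 < m then Polynomial.X - 1 else Polynomial.C (X v) := by
  rw [perturb, coe_eval₂Hom, eval₂_X]

theorem perturbZero_X (m : ℕ) (v : ℤ × ℤ) : perturbZero m (X v) =
    if v.1 = v.2 ∧ 0 ≤ v.1 ∧ v.1 < m then Polynomial.X - 1 else 0 := by
  rw [perturbZero, RingHom.comp_apply, perturb_X]
  split_ifs <;> simp

theorem tau_two (a b : ℤ) : tau 2 a b = 1 + X (a, b) := by
  have h := octaAt 0 a b
  rw [octa, coef, slab_zero, show tau 0 a b = 1 from rfl] at h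
  simpa [tau] using h

theorem perturbZero_coef (m k : ℕ) (a b : ℤ) : perturbZero m (coef (k + 1) a b) = 0 := by
  rw [coef, slab, map_prod]
  by_cases h : a = b
  · refine Finset.prod_eq_zero (i := 1) (by simp; omega) ?_
    rw [perturbZero_X, if_neg (by simp; omega)]
  · refine Finset.prod_eq_zero (i := 0) (by simp; omega) ?_
    rw [perturbZero_X, if_neg (by simp; omega)]

/-- Every slab of positive level contains a variable off the diagonal, so those coefficients vanish
and the recurrence splits into separate rows `b = const`, started by `tau 2 = 1 + X (a, b)`. The
result bounds the order in `ε` of `tau` by one, and by zero outside a cone. -/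
theorem perturbZero_tau (m s : ℕ) (a b : ℤ) : perturbZero m (tau s a b) =
    if |a - b| + 2 ≤ s ∧ (a - b) % 2 = s % 2 ∧ 0 ≤ b ∧ b < m then Polynomial.X else 1 := by
  induction s using Nat.strong_induction_on generalizing a b with
  | _ s ih =>
    match s, ih with
    | 0, _ =>
      rw [if_neg]
      · simp [tau]
      · have := abs_nonneg (a - b); push_cast; omega
    | 1, _ =>
      rw [if_neg]
      · simp [tau]
      · have := abs_nonneg (a - b); push_cast; omega
    | 2, _ =>
      rw [tau_two, map_add, map_one, perturbZero_X]
      by_cases h : a = b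
      · subst h
        by_cases h' : 0 ≤ a ∧ a < m
        · rw [if_pos (by simpa using h'), if_pos (by simpa using h')]; ring
        · rw [if_neg (by simpa using h'), if_neg (by simpa using h')]; ring
      · rw [if_neg, if_neg]
        · ring
        · have := abs_pos.2 (sub_ne_zero.2 h); push_cast; omega
        · simp [h]
    | k + 3, ih =>
      have h := congrArg (perturbZero m) (octaAt (k + 1) a b)
      rw [octa, map_add, map_mul, map_mul, map_mul _ (coef _ _ _), perturbZero_coef, zero_mul,
        add_zero, ih (k + 1) (by omega), ih (k + 2) (by omega), ih (k + 2) (by omega)] at h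
      have hX : (Polynomial.X : Polynomial ℝ) ≠ 0 := Polynomial.X_ne_zero
      have hne : (if |a - b| + 2 ≤ ((k + 1 : ℕ) : ℤ) ∧ (a - b) % 2 = ((k + 1 : ℕ) : ℤ) % 2 ∧
          0 ≤ b ∧ b < m then (Polynomial.X : Polynomial ℝ) else 1) ≠ 0 := by
        split_ifs <;> simp
      refine mul_left_cancel₀ hne (h.trans ?_)
      clear h hne ih
      simp only [sub_right_comm a 1 b, add_sub_right_comm a 1 b]
      generalize a - b = D
      push_cast
      by_cases hb : 0 ≤ b ∧ b < m
      swap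
      · rw [if_neg (by tauto), if_neg (by tauto), if_neg (by tauto), if_neg (by tauto)]
      simp only [hb, and_self, and_true]
      rcases abs_cases D with ⟨h1, h2⟩ | ⟨h1, h2⟩ <;>
      rcases abs_cases (D - 1) with ⟨h3, h4⟩ | ⟨h3, h4⟩ <;>
      rcases abs_cases (D + 1) with ⟨h5, h6⟩ | ⟨h5, h6⟩ <;>
      rw [h1, h3, h5] <;> split_ifs <;> first | rfl | (exfalso; omega) | ring

/-- Orders in `ε` (the variable `Polynomial.X`) are compared in the recurrence. For `1 ≤ r ≤ k` (at
level `k + 1` of the induction) all four neighbours are divisible by `ε`, so the right hand side has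
order at least two and the factor divided out has order at most one. At the two ends only one factor
of each product is known to be divisible, but there the factor divided out has order zero. -/
theorem X_dvd_perturb_tau (m k : ℕ) {t r : ℤ} (ht : 0 ≤ t) (htk : t + k < m) (hr : 0 ≤ r)
    (hrk : r ≤ k) : Polynomial.X ∣ perturb m (tau (k + 2) (t + r) (t + k - r)) := by
  induction k using Nat.strong_induction_on generalizing t r with
  | _ k ih =>
    match k, ih with
    | 0, _ =>
      rw [zero_add, tau_two, map_add, map_one, perturb_X, if_pos]
      · simp
      · push_cast at *; omega
    | k + 1, ih =>
      have h := congrArg (perturb m) (octaAt (k + 1) (t + r) (t + (k + 1 : ℕ) - r))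
      rw [octa, map_add, map_mul _ (tau (k + 1 + 1) _ _), map_mul _ (coef _ _ _),
        map_mul _ (tau (k + 1 + 1) _ _)] at h
      push_cast at htk hrk
      have ihk := fun {t r : ℤ} => @ih k (by omega) t r
      have hE : r ≤ k → Polynomial.X ∣
          perturb m (tau (k + 1 + 1) (t + r + 1) (t + (k + 1 : ℕ) - r)) := fun hr' => by
        have := @ihk (t + 1) r (by omega) (by omega) (by omega) (by omega)
        rwa [show t + 1 + r = t + r + 1 by ring,
          show t + 1 + k - r = t + ((k + 1 : ℕ) : ℤ) - r by push_cast; ring] at this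
      have hS : r ≤ k → Polynomial.X ∣
          perturb m (tau (k + 1 + 1) (t + r) (t + (k + 1 : ℕ) - r - 1)) := fun hr' => by
        have := @ihk t r (by omega) (by omega) (by omega) (by omega)
        rwa [show t + k - r = t + ((k + 1 : ℕ) : ℤ) - r - 1 by push_cast; ring] at this
      have hW : 1 ≤ r → Polynomial.X ∣
          perturb m (tau (k + 1 + 1) (t + r - 1) (t + (k + 1 : ℕ) - r)) := fun hr' => by
        have := @ihk t (r - 1) (by omega) (by omega) (by omega) (by omega)
        rwa [show t + (r - 1) = t + r - 1 by ring,
          show t + k - (r - 1) = t + ((k + 1 : ℕ) : ℤ) - r by push_cast; ring] at this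
      have hN : 1 ≤ r → Polynomial.X ∣
          perturb m (tau (k + 1 + 1) (t + r) (t + (k + 1 : ℕ) - r + 1)) := fun hr' => by
        have := @ihk (t + 1) (r - 1) (by omega) (by omega) (by omega) (by omega)
        rwa [show t + 1 + (r - 1) = t + r by ring,
          show t + 1 + k - (r - 1) = t + ((k + 1 : ℕ) : ℤ) - r + 1 by push_cast; ring] at this
      have hp : Prime (Polynomial.X : Polynomial LatPoly) := Polynomial.prime_X
      have hz := perturbZero_tau m (k + 1) (t + r) (t + (k + 1 : ℕ) - r)
      rw [perturbZero, RingHom.comp_apply] at hz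
      by_cases hr' : 1 ≤ r ∧ r ≤ k
      · by_contra hc
        have h2 : Polynomial.X ^ 2 ∣ perturb m (tau (k + 1) (t + r) (t + (k + 1 : ℕ) - r)) := by
          refine hp.pow_dvd_of_dvd_mul_right 2 hc ?_
          rw [← map_mul, h, sq]
          exact dvd_add (mul_dvd_mul (hW hr'.1) (hE hr'.2))
            ((mul_dvd_mul (hS hr'.2) (hN hr'.1)).mul_left _)
        have h3 := map_dvd (Polynomial.mapRingHom constantCoeff) h2
        rw [hz] at h3
        simp only [map_pow, Polynomial.coe_mapRingHom, Polynomial.map_X] at h3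
        have h4 := Polynomial.degree_le_of_dvd h3 (by split_ifs <;> simp)
        rw [Polynomial.degree_X_pow] at h4
        split_ifs at h4 <;> simp at h4
        exact absurd h4 (by decide)
      · have h1 : ¬ Polynomial.X ∣
            perturb m (tau (k + 1) (t + r) (t + (k + 1 : ℕ) - r)) := by
          intro h2
          have h3 := map_dvd (Polynomial.mapRingHom constantCoeff) h2
          rw [hz, if_neg] at h3
          · simp only [Polynomial.coe_mapRingHom, Polynomial.map_X] at h3
            exact Polynomial.not_isUnit_X (isUnit_of_dvd_one h3)
          · push_cast
            rcases abs_cases (t + r - (t + ((k : ℤ) + 1) - r)) with ⟨h1, h2⟩ | ⟨h1, h2⟩ <;>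
              rw [h1] <;> omega
        refine (hp.dvd_or_dvd (a := perturb m (tau (k + 1) (t + r) (t + (k + 1 : ℕ) - r)))
          ?_).resolve_left h1
        rw [← map_mul, h]
        by_cases h0 : 1 ≤ r
        · exact dvd_add ((hW h0).mul_right _) (((hN h0).mul_left _).mul_left _)
        · exact dvd_add ((hE (by omega)).mul_left _) (((hS (by omega)).mul_right _).mul_left _)

theorem eval_tau_eq_zero {m k : ℕ} {f : ℤ × ℤ → ℝ} (hf : ∀ t : ℤ, 0 ≤ t → t < m → f (t, t) = -1)
    {t r : ℤ} (ht : 0 ≤ t) (htk : t + k < m) (hr : 0 ≤ r) (hrk : r ≤ k) :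
    eval f (tau (k + 2) (t + r) (t + k - r)) = 0 := by
  have h : eval f = ((eval f).comp (Polynomial.evalRingHom (0 : LatPoly))).comp (perturb m) := by
    refine ringHom_ext (fun x => by simp [perturb]) fun v => ?_
    simp only [RingHom.comp_apply, perturb_X, eval_X]
    split_ifs with h
    · obtain ⟨v1, v2⟩ := v
      obtain ⟨h0, h1, h2⟩ := h
      simp only at h0 h1 h2
      subst h0
      simp [hf v1 h1 h2]
    · simp
  obtain ⟨q, hq⟩ := X_dvd_perturb_tau m k ht htk hr hrk
  rw [h, RingHom.comp_apply, hq]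
  simp

/-! ### Values of `tau` at sequences -/

theorem tau_add (s : ℕ) (a b p q : ℤ) :
    tau s (a + p) (b + q) = rename (fun v => (v.1 + p, v.2 + q)) (tau s a b) := by
  induction s using Nat.strong_induction_on generalizing a b with
  | _ s ih =>
    match s, ih with
    | 0, _ => simp [tau]
    | 1, _ => simp [tau]
    | k + 2, ih =>
      have h1 := octaAt k (a + p) (b + q)
      have h2 := congrArg (rename (fun v : ℤ × ℤ => (v.1 + p, v.2 + q))) (octaAt k a b)
      have hne := tau_ne_zero_of (fun k' _ => octaAt k') (s := k) (a + p) (b + q)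
      refine mul_left_cancel₀ hne (h1.trans ?_)
      rw [ih k (by omega), ← map_mul, octaAt k a b, octa, octa, map_add, map_mul, map_mul, map_mul,
        ← ih (k + 1) (by omega), ← ih (k + 1) (by omega), ← ih (k + 1) (by omega),
        ← ih (k + 1) (by omega)]
      congr 1
      · congr 2 <;> ring
      · congr 1
        · rw [coef, coef, slab, slab, map_prod]
          refine Finset.prod_congr rfl fun i _ => ?_
          rw [rename_X]; congr 2; ring
        · congr 2 <;> ring

/-- The value of `tau s` at `j` for the coefficients `y`. -/
noncomputable def tauVal (y : ℤ → ℝ) (s : ℕ) (j : ℤ) : ℝ :=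
  eval (fun v : ℤ × ℤ => y (3 * v.1 + v.2)) (tau s 0 j)

/-- The weights `y (3a + b)` are invariant under the translation by `(1, -3)`, so only `3a + b`
matters. Lattice steps along the two axes become shifts of the index by `3` and by `1`. -/
theorem eval_tau (y : ℤ → ℝ) (s : ℕ) (a b : ℤ) :
    eval (fun v : ℤ × ℤ => y (3 * v.1 + v.2)) (tau s a b) = tauVal y s (3 * a + b) := by
  have h := tau_add s 0 (3 * a + b) a (-(3 * a))
  rw [zero_add, show 3 * a + b + -(3 * a) = b by ring] at h
  rw [h, eval_rename, tauVal]
  congr 2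
  ext v
  simp only [Function.comp_apply]
  congr 1; ring

@[simp] theorem tauVal_zero (y : ℤ → ℝ) (j : ℤ) : tauVal y 0 j = 1 := by simp [tauVal, tau]

@[simp] theorem tauVal_one (y : ℤ → ℝ) (j : ℤ) : tauVal y 1 j = 1 := by simp [tauVal, tau]

theorem tauVal_rec (y : ℤ → ℝ) (s : ℕ) (j : ℤ) : tauVal y s j * tauVal y (s + 2) j =
    tauVal y (s + 1) (j - 3) * tauVal y (s + 1) (j + 3) +
      slab (fun i => y (j + 3 * i)) s * (tauVal y (s + 1) (j - 1) * tauVal y (s + 1) (j + 1)) := by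
  have h := congrArg (eval (fun v : ℤ × ℤ => y (3 * v.1 + v.2))) (octaAt s 0 j)
  rw [octa, map_add, map_mul, map_mul, map_mul, map_mul] at h
  simp only [eval_tau] at h
  rw [coef, slab, map_prod] at h
  simp only [eval_X] at h
  rw [show 3 * (0 : ℤ) + j = j by ring, show 3 * ((0 : ℤ) - 1) + j = j - 3 by ring,
    show 3 * ((0 : ℤ) + 1) + j = j + 3 by ring, show 3 * (0 : ℤ) + (j - 1) = j - 1 by ring,
    show 3 * (0 : ℤ) + (j + 1) = j + 1 by ring] at h
  rw [h, slab]
  congr 2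
  refine Finset.prod_congr rfl fun i _ => ?_
  congr 1; ring

theorem tauVal_congr {y y' : ℤ → ℝ} {s : ℕ} {j : ℤ}
    (h : ∀ i, |i - j| ≤ 3 * ((s : ℤ) - 2) → y i = y' i) : tauVal y s j = tauVal y' s j := by
  refine eval₂Hom_congr' rfl ?_ rfl
  rintro ⟨a, b⟩ hv -
  refine h _ ?_
  by_contra hc
  have h0 : degreeOf (a, b) (tau s 0 j) = 0 :=
    degreeOf_tau (fun k _ => octaAt k) (by
      have h1 := abs_add_le (3 * a) (b - j)
      rw [abs_mul] at h1
      have h2 := abs_nonneg (b - j)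
      rw [show 3 * a + (b - j) = 3 * a + b - j by ring, show |(3 : ℤ)| = 3 from rfl] at h1
      simp only [sub_zero] at *
      omega)
  classical
  rw [degreeOf_def, Multiset.count_eq_zero, ← Multiset.mem_toFinset, ← vars_def] at h0
  exact h0 hv

theorem tauVal_eq_zero {y : ℤ → ℝ} {m k : ℕ} {z : ℤ}
    (hy : ∀ t : ℤ, 0 ≤ t → t < m → y (z + 4 * t) = -1) {t r : ℤ} (ht : 0 ≤ t) (htk : t + k < m)
    (hr : 0 ≤ r) (hrk : r ≤ k) : tauVal y (k + 2) (z + 4 * t + 2 * r + k) = 0 := by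
  have h := eval_tau_eq_zero (k := k) (f := fun v => y (z + (3 * v.1 + v.2)))
    (fun t h0 h1 => by rw [← hy t h0 h1]; congr 1; ring) ht htk hr hrk
  rw [eval_tau (fun j => y (z + j))] at h
  rw [← h, tauVal, tauVal, show z + 4 * t + 2 * r + k = 3 * (t + r) + (t + k - r) + z by ring]
  have e := tau_add (k + 2) 0 (3 * (t + r) + (t + k - r)) 0 z
  rw [add_zero] at e
  rw [e, eval_rename]
  congr 2
  ext v
  simp only [Function.comp_apply]
  congr 1; ring

theorem tauVal_add_period {y : ℤ → ℝ} {p : ℤ} (h : ∀ j, y (j + p) = y j) (s : ℕ) (j : ℤ) :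
    tauVal y s (j + p) = tauVal y s j := by
  have e := tau_add s 0 j 0 p
  rw [add_zero] at e
  rw [tauVal, e, eval_rename, tauVal]
  congr 2
  ext v
  rw [Function.comp_apply, ← h (3 * v.1 + v.2), add_assoc, add_zero]

end Pentagram

namespace Pentagram

/-! ### Determinants -/

/-- The matrix is `1 + U * V` with `U` having two columns, and `det (1 + U * V) = det (1 + V * U)`
leaves a determinant of size two. -/
theorem det_updateCol_updateCol_one {ι : Type*} [Fintype ι] [DecidableEq ι] {i j : ι} (hij : i ≠ j)
    (u v : ι → ℝ) : ((1 : Matrix ι ι ℝ).updateCol i u |>.updateCol j v).det =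
      u i * v j - v i * u j := by
  set U : Matrix ι (Fin 2) ℝ := Matrix.of fun a b => if b = 0 then u a - (1 : Matrix ι ι ℝ) a i
    else v a - (1 : Matrix ι ι ℝ) a j with hU
  set V : Matrix (Fin 2) ι ℝ := Matrix.of fun b a => if b = 0 then (1 : Matrix ι ι ℝ) i a
    else (1 : Matrix ι ι ℝ) j a with hV
  have h : ((1 : Matrix ι ι ℝ).updateCol i u).updateCol j v = 1 + U * V := by
    ext a b
    rw [Matrix.add_apply, Matrix.mul_apply, Fin.sum_univ_two, Matrix.updateCol_apply,
      Matrix.updateCol_apply]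
    by_cases hbj : b = j
    · subst hbj
      simp [hU, hV, Matrix.one_apply, hij]
    · by_cases hbi : b = i
      · subst hbi
        simp [hU, hV, hbj, Matrix.one_apply, Ne.symm hbj]
      · simp [hU, hV, hbj, hbi, Matrix.one_apply, Ne.symm hbj, Ne.symm hbi]
  rw [h, Matrix.det_one_add_mul_comm, Matrix.det_fin_two]
  simp only [Matrix.add_apply, Matrix.mul_apply]
  simp [hU, hV, Matrix.one_apply, hij, hij.symm]

/-- The Desnanot-Jacobi identity for an invertible matrix. -/
theorem det_mul_det_interior {s : ℕ} (A : Matrix (Fin (s + 2)) (Fin (s + 2)) ℝ) (hA : A.det ≠ 0) :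
    A.det * (A.submatrix (fun p : Fin s => p.succ.castSucc) fun q => q.succ.castSucc).det =
      (A.submatrix Fin.castSucc Fin.castSucc).det * (A.submatrix Fin.succ Fin.succ).det -
        (A.submatrix Fin.castSucc Fin.succ).det * (A.submatrix Fin.succ Fin.castSucc).det := by
  have h0l : (0 : Fin (s + 2)) ≠ Fin.last (s + 1) := by simp [Fin.ext_iff]
  -- The identity with its outer columns replaced by those of the adjugate. The outer columns of `A
  -- * B` are `A.det` times unit vectors, so both determinants are computable and one factor `A.det`
  -- cancels.
  set B := ((1 : Matrix (Fin (s + 2)) (Fin (s + 2)) ℝ).updateCol 0 fun a => A.adjugate a 0).updateCol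
    (Fin.last (s + 1)) fun a => A.adjugate a (Fin.last (s + 1)) with hB
  have hdB : B.det = (A.submatrix Fin.castSucc Fin.castSucc).det *
      (A.submatrix Fin.succ Fin.succ).det -
        (A.submatrix Fin.castSucc Fin.succ).det * (A.submatrix Fin.succ Fin.castSucc).det := by
    rw [hB, det_updateCol_updateCol_one h0l]
    simp only [Matrix.adjugate_fin_succ_eq_det_submatrix]
    have e1 : (Fin.last (s + 1)).succAbove = Fin.castSucc := by ext1 a; simp
    have e2 : (0 : Fin (s + 2)).succAbove = Fin.succ := by ext1 a; simp
    rw [e1, e2]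
    simp only [Fin.val_zero, Fin.val_last, add_zero, zero_add, pow_zero, one_mul]
    have e3 : ((-1 : ℝ) ^ (s + 1)) * (-1) ^ (s + 1) = 1 := by rw [← mul_pow]; simp
    rw [pow_add]
    linear_combination ((A.submatrix Fin.castSucc Fin.castSucc).det *
      (A.submatrix Fin.succ Fin.succ).det - (A.submatrix Fin.castSucc Fin.succ).det *
        (A.submatrix Fin.succ Fin.castSucc).det) * e3
  have hAB : (A * B).det = A.det * (A.det *
      (A.submatrix (fun p : Fin s => p.succ.castSucc) fun q => q.succ.castSucc).det) := by
    have hcol : ∀ a b, (A * B) a b = if b = Fin.last (s + 1) then (if a = b then A.det else 0)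
        else if b = 0 then (if a = b then A.det else 0) else A a b := by
      intro a b
      have hadj : ∀ b, ∑ c, A a c * A.adjugate c b = if a = b then A.det else 0 := by
        intro b
        have := congrFun (congrFun A.mul_adjugate a) b
        rw [Matrix.mul_apply] at this
        rw [this, Matrix.smul_apply, Matrix.one_apply]; simp
      rw [Matrix.mul_apply]
      simp only [hB, Matrix.updateCol_apply]
      split_ifs with h1 h2 h3 h4
      · subst h1; rw [hadj, if_pos h2]
      · subst h1; rw [hadj, if_neg h2]
      · subst h3; rw [hadj, if_pos h4]
      · subst h3; rw [hadj, if_neg h4]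
      · simp [Matrix.one_apply]
    rw [Matrix.det_succ_column_zero, Fin.sum_univ_succ, Finset.sum_eq_zero, add_zero, hcol,
      if_neg h0l, if_pos rfl, if_pos rfl, Fin.val_zero, pow_zero, one_mul]
    · congr 1
      rw [Matrix.det_succ_column _ (Fin.last s), Fin.sum_univ_castSucc, Finset.sum_eq_zero,
        zero_add]
      · rw [Matrix.submatrix_apply, hcol]
        simp only [Fin.succAbove_zero, Fin.succ_last, if_true]
        rw [← two_mul, pow_mul]
        simp only [even_two, Even.neg_pow, one_pow, one_mul]
        congr 2
        ext p q
        simp only [Matrix.submatrix_apply, Fin.succAbove_last, hcol]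
        rw [if_neg, if_neg]
        · rfl
        · simp
        · rw [Fin.succ_castSucc]; exact (Fin.castSucc_lt_last _).ne
      · intro p _
        have hz : (A * B) (Fin.succAbove 0 p.castSucc) (Fin.last s).succ = 0 := by
          rw [hcol, if_pos (Fin.succ_last _), if_neg]
          rw [Fin.succAbove_zero, Fin.succ_castSucc]; exact (Fin.castSucc_lt_last _).ne
        rw [Matrix.submatrix_apply, hz]; simp
    · intro p _
      rw [hcol, if_neg h0l, if_pos rfl, if_neg (Fin.succ_ne_zero _)]; simp
  rw [Matrix.det_mul, hdB] at hAB
  exact (mul_left_cancel₀ hA hAB).symm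

/-- The determinant of the matrix `g (l + 2p + q)`. -/
noncomputable def stretchDet (g : ℤ → ℝ) (l : ℤ) (s : ℕ) : ℝ :=
  (Matrix.of fun p q : Fin s => g (l + 2 * (p : ℕ) + (q : ℕ))).det

theorem stretchDet_condensation {g : ℤ → ℝ} {l : ℤ} {s : ℕ} (h : stretchDet g l (s + 2) ≠ 0) :
    stretchDet g l (s + 2) * stretchDet g (l + 3) s =
      stretchDet g l (s + 1) * stretchDet g (l + 3) (s + 1) -
        stretchDet g (l + 1) (s + 1) * stretchDet g (l + 2) (s + 1) := by
  have := det_mul_det_interior _ h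
  simp only [stretchDet]
  convert this using 2 <;> congr 1
  all_goals first
    | (ext p q; simp only [Matrix.submatrix_apply, Matrix.of_apply]; congr 1; simp; try ring)
    | (congr 1; ext p q; simp only [Matrix.submatrix_apply, Matrix.of_apply]; congr 1; simp; try ring)

/-- A sequence all of whose stretched determinants are nonzero. -/
noncomputable def gaussSeq (v : ℤ) : ℝ := (2 : ℝ) ^ (v * v)

theorem gaussSeq_pos (v : ℤ) : 0 < gaussSeq v := zpow_pos two_pos _

/-- Expanding `(l + 2p + q)²`, everything except the cross term `4pq` factors out of rows and
columns, and a Vandermonde matrix in the numbers `2 ^ (4p)` remains. -/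
theorem stretchDet_gaussSeq_ne_zero (l : ℤ) (s : ℕ) : stretchDet gaussSeq l s ≠ 0 := by
  have h : (Matrix.of fun p q : Fin s => gaussSeq (l + 2 * (p : ℕ) + (q : ℕ))) =
      Matrix.of fun p q : Fin s => (2 : ℝ) ^ ((l + 2 * ((p : ℕ) : ℤ)) * (l + 2 * ((p : ℕ) : ℤ))) *
        (Matrix.of fun p q : Fin s => (2 : ℝ) ^ (((q : ℕ) : ℤ) * (q : ℕ) + 2 * l * (q : ℕ)) *
          Matrix.vandermonde (fun p : Fin s => (2 : ℝ) ^ (4 * (p : ℕ))) p q) p q := by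
    ext p q
    simp only [Matrix.of_apply, Matrix.vandermonde_apply, gaussSeq]
    rw [← pow_mul, ← zpow_natCast, ← zpow_add₀ two_ne_zero, ← zpow_add₀ two_ne_zero]
    congr 1; push_cast; ring
  rw [stretchDet, h, Matrix.det_mul_column, Matrix.det_mul_row]
  refine mul_ne_zero (Finset.prod_ne_zero_iff.2 fun _ _ => (zpow_pos two_pos _).ne')
    (mul_ne_zero (Finset.prod_ne_zero_iff.2 fun _ _ => (zpow_pos two_pos _).ne') ?_)
  rw [Matrix.det_vandermonde_ne_zero_iff]
  intro p q h
  have := pow_right_injective₀ (two_pos (α := ℝ)) (by norm_num) h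
  exact Fin.ext (by omega)

/-- The determinants of `g + t * gaussSeq` are the values of a nonzero polynomial in `t`. -/
theorem exists_polynomial_stretchDet (g : ℤ → ℝ) (l : ℤ) (s : ℕ) :
    ∃ P : Polynomial ℝ, P ≠ 0 ∧ ∀ t, P.eval t = stretchDet (fun v => g v + t * gaussSeq v) l s := by
  set A : Matrix (Fin s) (Fin s) ℝ := Matrix.of fun p q => gaussSeq (l + 2 * (p : ℕ) + (q : ℕ))
  set B : Matrix (Fin s) (Fin s) ℝ := Matrix.of fun p q => g (l + 2 * (p : ℕ) + (q : ℕ))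
  refine ⟨((Polynomial.X : Polynomial ℝ) • A.map Polynomial.C + B.map Polynomial.C).det, ?_, ?_⟩
  · intro h
    have := Polynomial.coeff_det_X_add_C_card A B
    rw [h, Polynomial.coeff_zero] at this
    exact stretchDet_gaussSeq_ne_zero l s this.symm
  · intro t
    rw [← Polynomial.coe_evalRingHom, RingHom.map_det, stretchDet]
    congr 1
    ext p q
    simp [A, B]
    ring

/-- The coefficients `y` for which `tau` is given by determinants. -/
noncomputable def detCoef (g : ℤ → ℝ) (j : ℤ) : ℝ :=
  if Even j then -(g ((j - 4) / 2 + 1) * g ((j - 4) / 2 + 2)) / (g ((j - 4) / 2) * g ((j - 4) / 2 + 3))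
  else -1

theorem detCoef_even (g : ℤ → ℝ) (l : ℤ) :
    detCoef g (2 * l + 4) = -(g (l + 1) * g (l + 2)) / (g l * g (l + 3)) := by
  rw [detCoef, if_pos ⟨l + 2, by ring⟩, show (2 * l + 4 - 4) / 2 = l by omega]

theorem detCoef_odd (g : ℤ → ℝ) {j : ℤ} (hj : ¬ Even j) : detCoef g j = -1 := by
  rw [detCoef, if_neg hj]

theorem slab_eq_prod_range {M : Type*} [CommMonoid M] (f : ℤ → M) (k : ℕ) :
    slab f k = ∏ t ∈ Finset.range (2 * k + 1), f ((t : ℤ) - k) := by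
  refine Finset.prod_bij' (fun i _ => (i + k).toNat) (fun t _ => (t : ℤ) - k) ?_ ?_ ?_ ?_ ?_ <;>
    simp only [Finset.mem_Icc, Finset.mem_range] <;> intros
  · omega
  · omega
  · omega
  · omega
  · congr 1; omega

/-- The product of `g (l + 3i)` for `i < s`. -/
noncomputable def diagProd (g : ℤ → ℝ) (l : ℤ) (s : ℕ) : ℝ :=
  ∏ i ∈ Finset.range s, g (l + 3 * (i : ℤ))

theorem diagProd_succ (g : ℤ → ℝ) (l : ℤ) (s : ℕ) :
    diagProd g l (s + 1) = diagProd g l s * g (l + 3 * s) := Finset.prod_range_succ _ _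

theorem diagProd_succ' (g : ℤ → ℝ) (l : ℤ) (s : ℕ) :
    diagProd g l (s + 1) = g l * diagProd g (l + 3) s := by
  rw [diagProd, Finset.prod_range_succ', mul_comm]
  simp only [Nat.cast_zero, mul_zero, add_zero]
  congr 1
  refine Finset.prod_congr rfl fun i _ => ?_
  congr 1; push_cast; ring

/-- The slab alternates `s + 1` even indices with `s` odd ones, so the signs multiply to `-1`. This
is the minus sign that turns the octahedron recurrence into the condensation identity. -/
theorem slab_detCoef {g : ℤ → ℝ} (hg : ∀ v, 0 < g v) (l : ℤ) (s : ℕ) :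
    slab (fun i => detCoef g (2 * l + 3 * s + 4 + 3 * i)) s *
      (diagProd g l (s + 1) * diagProd g (l + 3) (s + 1)) =
        -(diagProd g (l + 1) (s + 1) * diagProd g (l + 2) (s + 1)) := by
  have h : slab (fun i => detCoef g (2 * l + 3 * s + 4 + 3 * i)) s =
      ∏ t ∈ Finset.range (2 * s + 1), detCoef g (2 * l + 4 + 3 * t) := by
    rw [slab_eq_prod_range]
    refine Finset.prod_congr rfl fun i _ => ?_
    congr 1; ring
  rw [h]
  clear h
  have hg' := fun v => (hg v).ne'
  induction s with
  | zero =>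
    have e := detCoef_even g l
    simp only [mul_zero, zero_add, Finset.range_one, Finset.prod_singleton, Nat.cast_zero, add_zero,
      diagProd]
    rw [e]
    field_simp [hg']
  | succ s ih =>
    rw [show 2 * (s + 1) + 1 = 2 * s + 1 + 1 + 1 by ring, Finset.prod_range_succ,
      Finset.prod_range_succ, detCoef_odd g (j := 2 * l + 4 + 3 * ((2 * s + 1 : ℕ) : ℤ)),
      show 2 * l + 4 + 3 * ((2 * s + 1 + 1 : ℕ) : ℤ) = 2 * (l + 3 * (s + 1)) + 4 by push_cast; ring,
      detCoef_even]
    · rw [diagProd_succ g l, diagProd_succ g (l + 3), diagProd_succ g (l + 1),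
        diagProd_succ g (l + 2)]
      push_cast
      rw [show l + 3 + 3 * ((s : ℤ) + 1) = l + 3 * (s + 1) + 3 by ring,
        show l + 1 + 3 * ((s : ℤ) + 1) = l + 3 * (s + 1) + 1 by ring,
        show l + 2 + 3 * ((s : ℤ) + 1) = l + 3 * (s + 1) + 2 by ring]
      have h1 := hg' (l + 3 * (s + 1))
      have h2 := hg' (l + 3 * (s + 1) + 3)
      field_simp
      linear_combination (g (l + 3 * (s + 1) + 1) * g (l + 3 * (s + 1) + 2)) * ih
    · push_cast; rw [Int.not_even_iff]; omega

theorem continuousAt_tauVal_detCoef {g : ℤ → ℝ} (hg : ∀ v, 0 < g v) (s : ℕ) (j : ℤ) :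
    ContinuousAt (fun t : ℝ => tauVal (detCoef fun v => g v + t * gaussSeq v) s j) 0 := by
  have hP := (MvPolynomial.continuous_eval (tau s 0 j)).continuousAt (x := fun v : ℤ × ℤ =>
    detCoef (fun v => g v + (0 : ℝ) * gaussSeq v) (3 * v.1 + v.2))
  refine ContinuousAt.comp (f := fun (t : ℝ) (v : ℤ × ℤ) =>
    detCoef (fun v => g v + t * gaussSeq v) (3 * v.1 + v.2)) hP (continuousAt_pi.2 fun v => ?_)
  simp only [detCoef]
  split_ifs
  · refine ContinuousAt.div (by fun_prop) (by fun_prop) ?_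
    simp only [zero_mul, add_zero]
    exact (mul_pos (hg _) (hg _)).ne'
  · fun_prop

/-- After multiplication by `diagProd`, the recurrence for `tauVal` is `stretchDet_condensation`.
Condensation and the division in the induction need nonzero determinants, so `g` is replaced by `g +
t * gaussSeq`, for which they are nonzero for all small `t > 0`, and then `t → 0`. -/
theorem tauVal_detCoef {g : ℤ → ℝ} (hg : ∀ v, 0 < g v) (l : ℤ) (s : ℕ) :
    tauVal (detCoef g) s (2 * l + 3 * s - 2) * diagProd g l s = stretchDet g l s := by
  induction s using Nat.strong_induction_on generalizing l g with
  | _ s ih =>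
    match s, ih with
    | 0, _ => simp [diagProd, stretchDet]
    | 1, _ => simp [diagProd, stretchDet]
    | s + 2, ih =>
      set G : ℝ → ℤ → ℝ := fun t v => g v + t * gaussSeq v with hG
      have key : ∀ t : ℝ, 0 ≤ t → stretchDet (G t) (l + 3) s ≠ 0 → stretchDet (G t) l (s + 2) ≠ 0 →
          tauVal (detCoef (G t)) (s + 2) (2 * l + 3 * (s + 2 : ℕ) - 2) * diagProd (G t) l (s + 2) =
            stretchDet (G t) l (s + 2) := by
        intro t ht h1 h2
        have hpos : ∀ v, 0 < G t v := fun v =>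
          add_pos_of_pos_of_nonneg (hg v) (mul_nonneg ht (gaussSeq_pos v).le)
        generalize G t = g at *
        have hr := tauVal_rec (detCoef g) s (2 * l + 3 * s + 4)
        have i0 := ih s (by omega) hpos (l + 3)
        have i1 := ih (s + 1) (by omega) hpos l
        have i2 := ih (s + 1) (by omega) hpos (l + 3)
        have i3 := ih (s + 1) (by omega) hpos (l + 1)
        have i4 := ih (s + 1) (by omega) hpos (l + 2)
        have c := stretchDet_condensation h2
        have sl := slab_detCoef hpos l s
        push_cast at *
        rw [show 2 * (l + 3) + 3 * (s : ℤ) - 2 = 2 * l + 3 * s + 4 by ring] at i0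
        rw [show 2 * l + 3 * ((s : ℤ) + 1) - 2 = 2 * l + 3 * s + 4 - 3 by ring] at i1
        rw [show 2 * (l + 3) + 3 * ((s : ℤ) + 1) - 2 = 2 * l + 3 * s + 4 + 3 by ring] at i2
        rw [show 2 * (l + 1) + 3 * ((s : ℤ) + 1) - 2 = 2 * l + 3 * s + 4 - 1 by ring] at i3
        rw [show 2 * (l + 2) + 3 * ((s : ℤ) + 1) - 2 = 2 * l + 3 * s + 4 + 1 by ring] at i4
        rw [show 2 * l + 3 * ((s : ℤ) + 2) - 2 = 2 * l + 3 * s + 4 by ring]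
        have d1 : diagProd g l (s + 2) * diagProd g (l + 3) s =
            diagProd g l (s + 1) * diagProd g (l + 3) (s + 1) := by
          rw [diagProd_succ' g l (s + 1), diagProd_succ' g l s]; ring
        refine mul_right_cancel₀ h1 ?_
        rw [c, ← i0, ← i1, ← i2, ← i3, ← i4]
        linear_combination (diagProd g l (s + 2) * diagProd g (l + 3) s) * hr +
          (tauVal (detCoef g) (s + 1) (2 * l + 3 * s + 4 - 3) *
            tauVal (detCoef g) (s + 1) (2 * l + 3 * s + 4 + 3) +
            slab (fun i => detCoef g (2 * l + 3 * s + 4 + 3 * i)) s *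
            (tauVal (detCoef g) (s + 1) (2 * l + 3 * s + 4 - 1) *
            tauVal (detCoef g) (s + 1) (2 * l + 3 * s + 4 + 1))) * d1 +
          tauVal (detCoef g) (s + 1) (2 * l + 3 * s + 4 - 1) *
            tauVal (detCoef g) (s + 1) (2 * l + 3 * s + 4 + 1) * sl
      obtain ⟨P, hP0, hP⟩ := exists_polynomial_stretchDet g (l + 3) s
      obtain ⟨Q, hQ0, hQ⟩ := exists_polynomial_stretchDet g l (s + 2)
      have hev : ∀ᶠ t in nhdsWithin (0 : ℝ) (Set.Ioi 0), (P * Q).eval t ≠ 0 := by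
        have hfin : ((P * Q).roots.toFinset : Set ℝ).Finite := Finset.finite_toSet _
        have := (hfin.subset (Set.sdiff_subset (t := {(0 : ℝ)}))).isClosed.isOpen_compl.mem_nhds (x := (0 : ℝ)) (by simp)
        filter_upwards [nhdsWithin_le_nhds this, self_mem_nhdsWithin] with t ht ht0 hroot
        apply ht
        refine ⟨?_, (ne_of_gt ht0)⟩
        simp only [Finset.mem_coe, Multiset.mem_toFinset]
        exact (Polynomial.mem_roots (mul_ne_zero hP0 hQ0)).2 hroot
      have hL : ContinuousAt (fun t : ℝ => tauVal (detCoef (G t)) (s + 2)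
          (2 * l + 3 * (s + 2 : ℕ) - 2) * diagProd (G t) l (s + 2)) 0 := by
        refine (continuousAt_tauVal_detCoef hg _ _).mul ?_
        simp only [diagProd, hG]
        fun_prop
      have hR : ContinuousAt (fun t : ℝ => stretchDet (G t) l (s + 2)) 0 := by
        have : (fun t : ℝ => stretchDet (G t) l (s + 2)) = fun t => Q.eval t := by
          ext t; rw [hQ]
        rw [this]; exact Q.continuous.continuousAt
      have hL' := hL.tendsto.mono_left (nhdsWithin_le_nhds (s := Set.Ioi 0))
      have hR' := hR.tendsto.mono_left (nhdsWithin_le_nhds (s := Set.Ioi 0))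
      have := tendsto_nhds_unique_of_eventuallyEq hL' hR' (by
        filter_upwards [hev, self_mem_nhdsWithin] with t ht ht0
        rw [Polynomial.eval_mul, hP, hQ] at ht
        exact key t (le_of_lt ht0) (left_ne_zero_of_mul ht) (right_ne_zero_of_mul ht))
      simpa [hG] using this

end Pentagram

namespace Pentagram

/-! ### Nonvanishing of `tau` -/

/-- A matrix each of whose columns has an entry that is the only nonzero one of its row has
nonzero determinant. -/
theorem det_ne_zero_of_isolated {ι : Type*} [Fintype ι] [DecidableEq ι] (A : Matrix ι ι ℝ)
    (h : ∀ q, ∃ p, A p q ≠ 0 ∧ ∀ q', q' ≠ q → A p q' = 0) : A.det ≠ 0 := by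
  intro h0
  obtain ⟨v, hv, hAv⟩ := Matrix.exists_mulVec_eq_zero_iff.2 h0
  apply hv
  ext q
  obtain ⟨p, hp, hp'⟩ := h q
  have := congrFun hAv p
  rw [Matrix.mulVec, dotProduct, Finset.sum_eq_single q] at this
  · simpa [hp] using this
  · intro q' _ hq'
    rw [hp' q' hq', zero_mul]
  · simp

/-- The first index congruent to `e - l` modulo `2`, the number of such indices below `s`, and a
residue of the other parity for which the two classes together form a permutation matrix. -/
theorem exists_complement (s : ℕ) (hs : 1 ≤ s) (l e : ℤ) : ∃ e' : ℤ, (e' - e) % 2 = 1 ∧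
    ∀ q : ℤ, 0 ≤ q → q < s → ∃ p : ℤ, 0 ≤ p ∧ p < s ∧
      ((2 * s : ℤ) ∣ l + 2 * p + q - e ∨ (2 * s : ℤ) ∣ l + 2 * p + q - e') ∧
      ∀ q' : ℤ, 0 ≤ q' → q' < s → q' ≠ q →
        ¬ ((2 * s : ℤ) ∣ l + 2 * p + q' - e ∨ (2 * s : ℤ) ∣ l + 2 * p + q' - e') := by
  obtain ⟨b, hb⟩ : ∃ b : ℤ, b = (e - l) % 2 := ⟨_, rfl⟩
  obtain ⟨B, hB⟩ : ∃ B : ℤ, B = (s + 1 - b) / 2 := ⟨_, rfl⟩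
  have hs' : (0 : ℤ) < s := by omega
  have two : ∀ x : ℤ, (2 * s : ℤ) ∣ x → x % 2 = 0 := fun x hx => by
    have := (Dvd.intro _ rfl).trans hx; omega
  have small : ∀ x : ℤ, (2 * s : ℤ) ∣ x → -(2 * s : ℤ) < x → x < 2 * s → x = 0 :=
    fun x hx h1 h2 => Int.eq_zero_of_abs_lt_dvd hx (abs_lt.2 ⟨h1, h2⟩)
  -- The columns of parity `b` meet the class of `e` in `B` cyclically consecutive rows, one row
  -- fewer for each next column. This `e'` makes the columns of the other parity continue with the
  -- remaining rows.
  refine ⟨e + 1 - 2 * b - 2 * B, by omega, fun q hq0 hqs => ?_⟩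
  obtain ⟨f, hf, hfp⟩ : ∃ f, (f = e ∧ q % 2 = b ∨ f = e + 1 - 2 * b - 2 * B ∧ q % 2 = 1 - b) ∧
      (f - l - q) % 2 = 0 := by
    by_cases h : q % 2 = b
    · exact ⟨e, Or.inl ⟨rfl, h⟩, by omega⟩
    · exact ⟨_, Or.inr ⟨rfl, by omega⟩, by omega⟩
  obtain ⟨w, hw⟩ : ∃ w, w = (f - l - q) / 2 := ⟨_, rfl⟩
  have hp0 := Int.emod_nonneg w hs'.ne'
  have hp1 := Int.emod_lt_of_pos w hs'
  have hdvd : (2 * s : ℤ) ∣ l + 2 * (w % s) + q - f :=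
    ⟨-(w / s), by
      have h1 := Int.emod_add_mul_ediv w s
      have h2 : 2 * w = f - l - q := by omega
      linear_combination 2 * h1 + h2⟩
  refine ⟨w % s, hp0, hp1, ?_, ?_⟩
  · rcases hf with ⟨rfl, -⟩ | ⟨rfl, -⟩
    · exact Or.inl hdvd
    · exact Or.inr hdvd
  · intro q' hq0' hqs' hne hor
    have sub : ∀ g, (2 * s : ℤ) ∣ l + 2 * (w % s) + q' - g → (2 * s : ℤ) ∣ q' - q + f - g :=
      fun g hg => by
        have := dvd_sub hg hdvd
        rwa [show l + 2 * (w % s) + q' - g - (l + 2 * (w % s) + q - f) = q' - q + f - g by ring]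
          at this
    rcases hor with h | h
    · have h1 := sub _ h
      have h2 := two _ h1
      have h3 := small _ h1 (by omega) (by omega)
      omega
    · have h1 := sub _ h
      have h2 := two _ h1
      have h3 := small _ h1 (by omega) (by omega)
      omega

/-- The neighbour of `v` in a partition of the integers into pairs. -/
def partner (n l₀ v : ℤ) : ℤ := if (v - l₀) % n % 2 = 0 then v + 1 else v - 1

/-- A deformation of the indicator sequence of two residue classes. -/
noncomputable def pairSeq (n l₀ e e' : ℤ) (s : ℕ) (t : ℝ) (v : ℤ) : ℝ :=
  if (2 * s : ℤ) ∣ v - e ∨ (2 * s : ℤ) ∣ v - e' then 1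
  else if (v - e) % 2 = 0 then
    t * (if (2 * s : ℤ) ∣ partner n l₀ v - e ∨ (2 * s : ℤ) ∣ partner n l₀ v - e' then 1 else t)
  else t

theorem pairSeq_pos (n l₀ e e' : ℤ) (s : ℕ) {t : ℝ} (ht : 0 < t) (v : ℤ) :
    0 < pairSeq n l₀ e e' s t v := by
  rw [pairSeq]
  split_ifs <;> positivity

theorem continuous_pairSeq (n l₀ e e' : ℤ) (s : ℕ) (v : ℤ) :
    Continuous fun t => pairSeq n l₀ e e' s t v := by
  simp only [pairSeq]
  split_ifs <;> fun_prop

theorem pairSeq_zero (n l₀ e e' : ℤ) (s : ℕ) (v : ℤ) : pairSeq n l₀ e e' s 0 v =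
    if (2 * s : ℤ) ∣ v - e ∨ (2 * s : ℤ) ∣ v - e' then 1 else 0 := by
  rw [pairSeq]
  split_ifs <;> simp

theorem pairSeq_of_bad {n l₀ e e' : ℤ} {s : ℕ} (t : ℝ) (hee : (e' - e) % 2 = 1) {v : ℤ}
    (hv : (v - e) % 2 = 0) (hv' : ¬ (2 * s : ℤ) ∣ v - e) :
    pairSeq n l₀ e e' s t v = t * pairSeq n l₀ e e' s t (partner n l₀ v) := by
  have two : ∀ x : ℤ, (2 * s : ℤ) ∣ x → x % 2 = 0 := fun x hx => by
    have := (Dvd.intro _ rfl).trans hx; omega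
  rw [pairSeq, if_neg, if_pos hv, pairSeq]
  · have : ¬ (partner n l₀ v - e) % 2 = 0 := by
      rw [partner]; split_ifs <;> omega
    rw [if_neg this]
  · rintro (h | h)
    · exact hv' h
    · have := two _ h; omega

/-- For `g = pairSeq`, the matrix of `stretchDet` tends for `t → 0` to the one of
`exists_complement`, whose determinant is nonzero, so some small `t > 0` works. The required values
`-1` say that `g` has the same ratio on consecutive pairs of a block. Since the class of `e` avoids
the blocks in the window, this ratio can be taken to be `t` throughout. -/
theorem exists_tauVal_ne_zero (n m l₀ : ℤ) (hm : 0 ≤ m) (hn : 2 * m + 1 < n) (s : ℕ) (hs : 1 ≤ s) (l e : ℤ)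
    (he : ∀ v, l ≤ v → v ≤ l + 3 * (s - 1) → (2 * s : ℤ) ∣ v - e → 2 * m + 1 < (v - l₀) % n) :
    ∃ Y : ℤ → ℝ, (∀ j, Y j ≠ 0) ∧ (∀ j, ¬ Even j → Y j = -1) ∧
      (∀ z, l ≤ z → z + 3 ≤ l + 3 * (s - 1) → (z - l₀) % n % 2 = 0 → (z - l₀) % n < 2 * m →
        Y (2 * z + 4) = -1) ∧
      tauVal Y s (2 * l + 3 * s - 2) ≠ 0 := by
  obtain ⟨e', hee, hcomp⟩ := exists_complement s hs l e
  have hcont : Continuous fun t => stretchDet (pairSeq n l₀ e e' s t) l s :=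
    Continuous.matrix_det (continuous_matrix fun p q => continuous_pairSeq _ _ _ _ _ _)
  have h0 : stretchDet (pairSeq n l₀ e e' s 0) l s ≠ 0 := by
    refine det_ne_zero_of_isolated _ fun q => ?_
    obtain ⟨p, hp0, hp1, hp2, hp3⟩ := hcomp q (by positivity) (by exact_mod_cast q.2)
    lift p to ℕ using hp0
    refine ⟨⟨p, by exact_mod_cast hp1⟩, ?_, fun q' hq' => ?_⟩
    · rw [Matrix.of_apply, pairSeq_zero, if_pos hp2]; exact one_ne_zero
    · rw [Matrix.of_apply, pairSeq_zero, if_neg]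
      exact hp3 q' (by positivity) (by exact_mod_cast q'.2)
        (fun h => hq' (Fin.ext (by exact_mod_cast h)))
  have hev := (hcont.continuousAt (x := 0)).eventually_ne h0
  obtain ⟨t, ht, ht0⟩ := ((hev.filter_mono (nhdsWithin_le_nhds (s := Set.Ioi (0 : ℝ)))).and
    self_mem_nhdsWithin).exists
  set g := pairSeq n l₀ e e' s t with hg
  have hpos : ∀ v, 0 < g v := pairSeq_pos n l₀ e e' s ht0
  have hpos' := fun v => (hpos v).ne'
  refine ⟨detCoef g, fun j => ?_, fun j hj => detCoef_odd g hj, fun z hz1 hz2 hz3 hz4 => ?_, ?_⟩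
  · rw [detCoef]
    split_ifs
    · exact div_ne_zero (neg_ne_zero.2 (mul_ne_zero (hpos' _) (hpos' _)))
        (mul_ne_zero (hpos' _) (hpos' _))
    · norm_num
  · have hadd : ∀ i : ℤ, 0 ≤ i → i ≤ 3 → (z + i - l₀) % n = (z - l₀) % n + i := by
      intro i hi0 hi3
      have h1 := Int.emod_nonneg (z - l₀) (show n ≠ 0 by omega)
      rw [show z + i - l₀ = (z - l₀) + i by ring, ← Int.emod_add_emod, Int.emod_eq_of_lt] <;> omega
    have a0 := hadd 0 (by norm_num) (by norm_num)
    have a1 := hadd 1 (by norm_num) (by norm_num)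
    have a2 := hadd 2 (by norm_num) (by norm_num)
    have a3 := hadd 3 (by norm_num) (by norm_num)
    have hnd : ∀ i : ℤ, 0 ≤ i → i ≤ 3 → ¬ (2 * s : ℤ) ∣ z + i - e := by
      intro i hi0 hi3 hd
      have := he _ (by omega) (by omega) hd
      rw [hadd i hi0 hi3] at this
      omega
    -- In each of the pairs `z, z + 1` and `z + 2, z + 3`, the entry with the parity of `e` is `t`
    -- times the other one.
    have e : g (z + 1) * g (z + 2) = g z * g (z + 3) := by
      by_cases hp : (z - e) % 2 = 0
      · have b0 := pairSeq_of_bad (n := n) (l₀ := l₀) (s := s) t hee hp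
          (by simpa using hnd 0 (by norm_num) (by norm_num))
        have b2 := pairSeq_of_bad (n := n) (l₀ := l₀) (s := s) t hee (v := z + 2) (by omega)
          (hnd 2 (by norm_num) (by norm_num))
        rw [partner, if_pos hz3] at b0
        rw [partner, if_pos (by omega), show z + 2 + 1 = z + 3 by ring] at b2
        rw [hg, b0, b2]; ring
      · have b1 := pairSeq_of_bad (n := n) (l₀ := l₀) (s := s) t hee (v := z + 1) (by omega)
          (hnd 1 (by norm_num) (by norm_num))
        have b3 := pairSeq_of_bad (n := n) (l₀ := l₀) (s := s) t hee (v := z + 3) (by omega)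
          (hnd 3 (by norm_num) (by norm_num))
        rw [partner, if_neg (by omega), show z + 1 - 1 = z by ring] at b1
        rw [partner, if_neg (by omega), show z + 3 - 1 = z + 2 by ring] at b3
        rw [hg, b1, b3]; ring
    rw [detCoef_even, e, neg_div, div_self (mul_ne_zero (hpos' _) (hpos' _))]
  · intro hz
    apply ht
    rw [← tauVal_detCoef hpos, hz, zero_mul]

/-- A residue that avoids the blocks, for the two critical sizes. -/
theorem exists_avoiding {n m l₀ l : ℤ} {s : ℕ} (hm : 1 ≤ m) (hn : 3 * m + 4 ≤ n)
    (hs : (s : ℤ) = m + 2 ∨ (s : ℤ) = m + 3) : ∃ e : ℤ, ∀ v, l ≤ v → v ≤ l + 3 * (s - 1) →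
      (2 * s : ℤ) ∣ v - e → 2 * m + 1 < (v - l₀) % n := by
  have hn0 : 0 < n := by omega
  -- An `e` in this middle range is the only member of its class modulo `2s` in the window `[l, l +
  -- 3(s - 1)]`.
  by_cases h : ∃ e, l + s - 2 ≤ e ∧ e ≤ l + 2 * s - 1 ∧ 2 * m + 1 < (e - l₀) % n
  · obtain ⟨e, h1, h2, h3⟩ := h
    refine ⟨e, fun v hv1 hv2 hd => ?_⟩
    have : v - e = 0 := Int.eq_zero_of_abs_lt_dvd hd (abs_lt.2 ⟨by omega, by omega⟩)
    rwa [show v = e by omega]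
  · push Not at h
    obtain ⟨r, hr⟩ : ∃ r, r = (l + s - 2 - l₀) % n := ⟨_, rfl⟩
    have hr0 : 0 ≤ r := hr ▸ Int.emod_nonneg _ hn0.ne'
    have hrn : r < n := hr ▸ Int.emod_lt_of_pos _ hn0
    have hadd : ∀ i : ℤ, 0 ≤ r + i → r + i < n → (l + s - 2 + i - l₀) % n = r + i := by
      intro i h1 h2
      rw [show l + s - 2 + i - l₀ = (l + s - 2 - l₀) + i by ring, ← Int.emod_add_emod, ← hr,
        Int.emod_eq_of_lt h1 h2]
    have hr1 : r ≤ 2 * m + 1 := hr ▸ h _ le_rfl (by omega)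
    have hr2 : r + (s + 1) ≤ 2 * m + 1 := by
      by_contra hc
      have := h (l + s - 2 + (2 * m + 2 - r)) (by omega) (by omega)
      rw [hadd _ (by omega) (by omega)] at this
      omega
    -- Now the middle range lies inside one block. This is the place just before that block; the
    -- only other member of its class in the window is `2s` further on, at offset `2s - 1 > 2m + 1`
    -- and hence beyond the block.
    refine ⟨l + s - 2 - r - 1, fun v hv1 hv2 hd => ?_⟩
    obtain ⟨c, hc⟩ := hd
    have hc0 : -1 < c := by
      by_contra hcn
      have : (2 * s : ℤ) * c ≤ 2 * s * (-1) := by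
        refine mul_le_mul_of_nonneg_left (by omega) (by omega)
      omega
    have hc1 : c < 2 := by
      by_contra hcn
      have : (2 * s : ℤ) * 2 ≤ 2 * s * c := by
        refine mul_le_mul_of_nonneg_left (by omega) (by omega)
      omega
    interval_cases c
    · rw [show v - l₀ = l + s - 2 + (-r - 1) - l₀ + n * 0 by omega]
      have h1 : (l + s - 2 + (n - r - 1) - l₀) % n = r + (n - r - 1) :=
        hadd _ (by omega) (by omega)
      rw [show l + s - 2 + (-r - 1) - l₀ + n * 0 = l + s - 2 + (n - r - 1) - l₀ + n * (-1) by ring,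
        Int.add_mul_emod_self_left, h1]
      omega
    · rw [show v - l₀ = l + s - 2 + (2 * s - r - 1) - l₀ by omega, hadd _ (by omega) (by omega)]
      omega

end Pentagram

namespace Pentagram

/-! ### Brackets of vectors in space -/

/-- The determinant of three vectors. -/
def br (a b c : Fin 3 → ℝ) : ℝ := a ⬝ᵥ (b ⨯₃ c)

theorem br_eq (a b c : Fin 3 → ℝ) : br a b c =
    a 0 * (b 1 * c 2 - b 2 * c 1) + a 1 * (b 2 * c 0 - b 0 * c 2) +
      a 2 * (b 0 * c 1 - b 1 * c 0) := by
  simp [br, cross_apply, dotProduct, Fin.sum_univ_three]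

theorem br_rev (a b c : Fin 3 → ℝ) : br a b c = -br c b a := by
  simp only [br_eq]; ring

theorem br_cycle (a b c : Fin 3 → ℝ) : br a b c = br b c a := by
  simp only [br_eq]; ring

theorem cross_dot (a b c : Fin 3 → ℝ) : (a ⨯₃ b) ⬝ᵥ c = br a b c := by
  simp only [br_eq]; simp [cross_apply, dotProduct, Fin.sum_univ_three]; ring

theorem cross_cross_cross (a b c : Fin 3 → ℝ) : (a ⨯₃ b) ⨯₃ (b ⨯₃ c) = br a b c • b := by
  ext i
  fin_cases i <;> simp [br_eq, cross_apply] <;> ring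

theorem cross_cross_self (a b c : Fin 3 → ℝ) : a ⨯₃ ((a ⨯₃ b) ⨯₃ c) = (a ⬝ᵥ c) • (a ⨯₃ b) := by
  ext i
  fin_cases i <;> simp [dotProduct, Fin.sum_univ_three, cross_apply] <;> ring

theorem cross_cross_self' (a b c : Fin 3 → ℝ) : b ⨯₃ ((a ⨯₃ b) ⨯₃ c) = (b ⬝ᵥ c) • (a ⨯₃ b) := by
  ext i
  fin_cases i <;> simp [dotProduct, Fin.sum_univ_three, cross_apply] <;> ring

theorem cross_cross_left (n a b : Fin 3 → ℝ) : (n ⨯₃ a) ⨯₃ (n ⨯₃ b) = br n a b • n := by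
  ext i
  fin_cases i <;> simp [br_eq, cross_apply] <;> ring

theorem br_pluecker (a b c d e : Fin 3 → ℝ) :
    br a c d * br b c e - br a b c * br c d e = br a c e * br b c d := by
  simp only [br_eq]; ring

theorem br_cross_cross (x a b c : Fin 3 → ℝ) :
    br x (a ⨯₃ b) (b ⨯₃ c) = br a b c * (x ⬝ᵥ b) := by
  rw [br, cross_cross_cross, dotProduct_smul, smul_eq_mul]

theorem br_smul_smul_smul (x y z : ℝ) (a b c : Fin 3 → ℝ) :
    br (x • a) (y • b) (z • c) = x * y * z * br a b c := by
  simp only [br_eq, Pi.smul_apply, smul_eq_mul]; ring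

theorem ne_zero_of_br {a b c : Fin 3 → ℝ} (h : br a b c ≠ 0) : a ≠ 0 ∧ b ≠ 0 ∧ c ≠ 0 := by
  refine ⟨?_, ?_, ?_⟩ <;> rintro rfl <;> simp [br_eq] at h

theorem cross_ne_zero_of_br {a b c : Fin 3 → ℝ} (h : br a b c ≠ 0) : a ⨯₃ b ≠ 0 ∧ b ⨯₃ c ≠ 0 ∧
    a ⨯₃ c ≠ 0 := by
  refine ⟨fun h0 => h ?_, fun h0 => h ?_, fun h0 => h ?_⟩
  · rw [← cross_dot, h0, zero_dotProduct]
  · rw [br, h0, dotProduct_zero]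
  · rw [br_cycle, br, ← cross_anticomm, h0, neg_zero, dotProduct_zero]

theorem independent_mk_iff {a b c : Fin 3 → ℝ} (ha : a ≠ 0) (hb : b ≠ 0) (hc : c ≠ 0) :
    Projectivization.Independent ![Projectivization.mk ℝ a ha, Projectivization.mk ℝ b hb,
      Projectivization.mk ℝ c hc] ↔ br a b c ≠ 0 := by
  obtain ⟨s, hs⟩ := Projectivization.exists_smul_eq_mk_rep ℝ a ha
  obtain ⟨t, ht⟩ := Projectivization.exists_smul_eq_mk_rep ℝ b hb
  obtain ⟨u, hu⟩ := Projectivization.exists_smul_eq_mk_rep ℝ c hc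
  rw [Projectivization.independent_iff]
  have e : (Projectivization.rep ∘ ![Projectivization.mk ℝ a ha, Projectivization.mk ℝ b hb,
      Projectivization.mk ℝ c hc] : Fin 3 → Fin 3 → ℝ) =
      (![s • a, t • b, u • c] : Matrix (Fin 3) (Fin 3) ℝ) := by
    ext i; fin_cases i <;> simp [hs, ht, hu]
  rw [e]
  have h := Matrix.linearIndependent_rows_iff_isUnit (A := (![s • a, t • b, u • c] :
    Matrix (Fin 3) (Fin 3) ℝ))
  refine h.trans (((Matrix.isUnit_iff_isUnit_det _).trans isUnit_iff_ne_zero).trans ?_)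
  rw [← triple_product_eq_det]
  change br ((s : ℝ) • a) ((t : ℝ) • b) ((u : ℝ) • c) ≠ 0 ↔ _
  rw [br_smul_smul_smul]
  simp

theorem join_mk {a b : Fin 3 → ℝ} (ha : a ≠ 0) (hb : b ≠ 0) (h : a ⨯₃ b ≠ 0) :
    join (Projectivization.mk ℝ a ha) (Projectivization.mk ℝ b hb) =
      Projectivization.mk ℝ (a ⨯₃ b) h := Projectivization.cross_mk_of_cross_ne_zero _ _ h

theorem meet_mk {a b : Fin 3 → ℝ} (ha : a ≠ 0) (hb : b ≠ 0) (h : a ⨯₃ b ≠ 0) :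
    meet (Projectivization.mk ℝ a ha) (Projectivization.mk ℝ b hb) =
      Projectivization.mk ℝ (a ⨯₃ b) h := Projectivization.cross_mk_of_cross_ne_zero _ _ h

/-- All four points lie on the line with normal `N = p ⨯₃ q`, so each cross product in the cross
ratio is a bracket expression times `N`, and `N ⬝ᵥ N` cancels. -/
theorem cornerRatio_mk {p q r s u : Fin 3 → ℝ} (hp : p ≠ 0) (hq : q ≠ 0) (hr : r ≠ 0) (hs : s ≠ 0)
    (hu : u ≠ 0) (h1 : br p q s ≠ 0) (h2 : br p r s ≠ 0) (h3 : br q s u ≠ 0) :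
    cornerRatio (Projectivization.mk ℝ p hp) (Projectivization.mk ℝ q hq)
      (Projectivization.mk ℝ r hr) (Projectivization.mk ℝ s hs) (Projectivization.mk ℝ u hu) =
      br p q s * br r s u / (br p r s * br q s u) := by
  have n0 := (cross_ne_zero_of_br h1).1
  have m1 := (cross_ne_zero_of_br h2).2.1
  have m2 := (cross_ne_zero_of_br h3).2.1
  have eB := cross_cross_self p q (r ⨯₃ s)
  have eD := cross_cross_self' p q (s ⨯₃ u)
  rw [show p ⬝ᵥ r ⨯₃ s = br p r s from rfl] at eB
  rw [show q ⬝ᵥ s ⨯₃ u = br q s u from rfl] at eD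
  have hB : (p ⨯₃ q) ⨯₃ (r ⨯₃ s) ≠ 0 := by
    intro h0
    rw [h0, map_zero] at eB
    exact smul_ne_zero h2 n0 eB.symm
  have hD : (p ⨯₃ q) ⨯₃ (s ⨯₃ u) ≠ 0 := by
    intro h0
    rw [h0, map_zero] at eD
    exact smul_ne_zero h3 n0 eD.symm
  have hn : (p ⨯₃ q) ⬝ᵥ (p ⨯₃ q) ≠ 0 := by simpa using n0
  rw [cornerRatio, chi, join_mk _ _ n0, join_mk _ _ m1, join_mk _ _ m2, meet_mk _ _ hB,
    meet_mk _ _ hD, crossRatio_mk, eB, cross_cross_left (p ⨯₃ q), br_cross_cross (p ⨯₃ q), cross_dot p q s,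
    ← cross_anticomm q ((p ⨯₃ q) ⨯₃ (s ⨯₃ u)), eD]
  generalize hN : p ⨯₃ q = N at *
  have hN' : q ⨯₃ p = -N := by rw [← cross_anticomm, hN]
  simp only [hN', neg_dotProduct, dotProduct_neg, smul_dotProduct, dotProduct_smul, smul_eq_mul]
  field_simp

/-! ### Brackets of polygons -/

variable {n c : ℕ}

/-- Representatives of the vertices of a polygon. -/
def TwistedPolygon.IsLift (A : TwistedPolygon n c) (v : ℤ → Fin 3 → ℝ) : Prop :=
  ∀ r, ∃ h : v r ≠ 0, A.vertex r = Projectivization.mk ℝ (v r) h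

theorem TwistedPolygon.exists_isLift (A : TwistedPolygon n c) : ∃ v, A.IsLift v :=
  ⟨fun r => (A.vertex r).rep, fun r => ⟨(A.vertex r).rep_nonzero, (A.vertex r).mk_rep.symm⟩⟩

/-- The bracket of three consecutive vectors. -/
def br012 (v : ℤ → Fin 3 → ℝ) (r : ℤ) : ℝ := br (v r) (v (r + 1)) (v (r + 2))

/-- The bracket of the vectors with indices `r`, `r + 1`, `r + 3`. -/
def br013 (v : ℤ → Fin 3 → ℝ) (r : ℤ) : ℝ := br (v r) (v (r + 1)) (v (r + 3))

/-- The bracket of the vectors with indices `r`, `r + 2`, `r + 3`. -/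
def br023 (v : ℤ → Fin 3 → ℝ) (r : ℤ) : ℝ := br (v r) (v (r + 2)) (v (r + 3))

/-- The bracket of the vectors with indices `r`, `r + 2`, `r + 4`. -/
def br024 (v : ℤ → Fin 3 → ℝ) (r : ℤ) : ℝ := br (v r) (v (r + 2)) (v (r + 4))

/-- Brackets that do not vanish for lifts of polygons. -/
def IsGeneral (v : ℤ → Fin 3 → ℝ) : Prop := ∀ r, br012 v r ≠ 0 ∧ br013 v r ≠ 0 ∧ br023 v r ≠ 0

theorem generalPosition_mk_iff {v : ℤ → Fin 3 → ℝ} (hv : ∀ r, v r ≠ 0) :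
    (∀ r, GeneralPosition (Projectivization.mk ℝ _ (hv r)) (Projectivization.mk ℝ _ (hv (r + 1)))
      (Projectivization.mk ℝ _ (hv (r + 2))) (Projectivization.mk ℝ _ (hv (r + 3)))) ↔
      IsGeneral v := by
  simp only [GeneralPosition, independent_mk_iff]
  constructor
  · intro h r
    exact ⟨(h r).1, (h r).2.1, (h r).2.2.1⟩
  · intro h r
    refine ⟨(h r).1, (h r).2.1, (h r).2.2, ?_⟩
    have := (h (r + 1)).1
    rwa [br012, show r + 1 + 1 = r + 2 by ring, show r + 1 + 2 = r + 3 by ring] at this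

theorem TwistedPolygon.IsLift.isGeneral {A : TwistedPolygon n c} {v : ℤ → Fin 3 → ℝ}
    (h : A.IsLift v) : IsGeneral v := by
  choose hv hA using h
  rw [← generalPosition_mk_iff hv]
  simpa only [hA] using A.generalPosition

theorem TwistedPolygon.IsLift.x_even {A : TwistedPolygon n c} {v : ℤ → Fin 3 → ℝ}
    (h : A.IsLift v) (r : ℤ) : A.x (c + 2 * (r + 2)) =
      br013 v r * br012 v (r + 2) / (br023 v r * br023 v (r + 1)) := by
  have hg := h.isGeneral
  choose hv hA using h
  have e : ((c : ℤ) + 2 * (r + 2) - c) / 2 = r + 2 := by omega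
  rw [TwistedPolygon.x, if_pos (by rw [add_sub_cancel_left]; exact even_two_mul _), e,
    add_sub_cancel_right, show r + 2 - 1 = r + 1 by ring, show r + 2 + 1 = r + 3 by ring,
    show r + 2 + 2 = r + 4 by ring]
  have h1 := (hg r).2.1
  have h2 := (hg r).2.2
  have h3 := (hg (r + 1)).2.2
  rw [br023, br013, br012, br023] at *
  rw [show r + 1 + 2 = r + 3 by ring, show r + 1 + 3 = r + 4 by ring,
    show r + 2 + 1 = r + 3 by ring, show r + 2 + 2 = r + 4 by ring] at *
  simp only [hA]
  exact cornerRatio_mk _ _ _ _ _ h1 h2 h3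

theorem TwistedPolygon.IsLift.x_odd {A : TwistedPolygon n c} {v : ℤ → Fin 3 → ℝ}
    (h : A.IsLift v) (r : ℤ) : A.x (c + 2 * (r + 2) + 1) =
      br023 v (r + 1) * br012 v r / (br013 v (r + 1) * br013 v r) := by
  have hg := h.isGeneral
  choose hv hA using h
  have e : ((c : ℤ) + 2 * (r + 2) + 1 - c) / 2 = r + 2 := by omega
  rw [TwistedPolygon.x, if_neg (by
    rw [show (c : ℤ) + 2 * (r + 2) + 1 - c = 2 * (r + 2) + 1 by ring]; simp), e,
    add_sub_cancel_right, show r + 2 - 1 = r + 1 by ring, show r + 2 + 1 = r + 3 by ring,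
    show r + 2 + 2 = r + 4 by ring]
  have h1 := (hg (r + 1)).2.2
  have h2 := (hg (r + 1)).2.1
  have h3 := (hg r).2.1
  rw [br023, br012, br013, br013] at *
  rw [show r + 1 + 1 = r + 2 by ring, show r + 1 + 2 = r + 3 by ring,
    show r + 1 + 3 = r + 4 by ring] at *
  simp only [hA]
  rw [cornerRatio_mk _ _ _ _ _ (by rwa [br_rev, neg_ne_zero]) (by rwa [br_rev, neg_ne_zero])
    (by rwa [br_rev, neg_ne_zero]), br_rev (v (r + 4)), br_rev (v (r + 2)) (v (r + 1)),
    br_rev (v (r + 4)) (v (r + 2)), br_rev (v (r + 3)) (v (r + 1)), neg_mul_neg, neg_mul_neg]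

theorem TwistedPolygon.x_ne_zero (A : TwistedPolygon n c) (j : ℤ) : A.x j ≠ 0 := by
  obtain ⟨v, hv⟩ := A.exists_isLift
  have hg := hv.isGeneral
  rcases Int.even_or_odd' (j - c - 4) with ⟨r, hr | hr⟩
  · rw [show j = c + 2 * (r + 2) by omega, hv.x_even]
    exact div_ne_zero (mul_ne_zero (hg _).2.1 (hg _).1) (mul_ne_zero (hg _).2.2 (hg _).2.2)
  · rw [show j = c + 2 * (r + 2) + 1 by omega, hv.x_odd]
    exact div_ne_zero (mul_ne_zero (hg _).2.2 (hg _).1) (mul_ne_zero (hg _).2.1 (hg _).2.1)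

/-- A three-term Plücker relation. It identifies `x_{2k} x_{2k+1} = 1` with collinearity of
`A_{k-2}, A_k, A_{k+2}`. -/
theorem TwistedPolygon.IsLift.one_sub {A : TwistedPolygon n c} {v : ℤ → Fin 3 → ℝ}
    (h : A.IsLift v) (r : ℤ) : 1 - A.x (c + 2 * (r + 2)) * A.x (c + 2 * (r + 2) + 1) =
      br024 v r * br012 v (r + 1) / (br023 v r * br013 v (r + 1)) := by
  have hg := h.isGeneral
  rw [h.x_even, h.x_odd]
  have h1 := (hg r).2.1
  have h2 := (hg r).2.2
  have h3 := (hg (r + 1)).2.2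
  have h4 := (hg (r + 1)).2.1
  have e := br_pluecker (v r) (v (r + 1)) (v (r + 2)) (v (r + 3)) (v (r + 4))
  field_simp
  simp only [br012, br013, br023, br024]
  rw [show r + 1 + 1 = r + 2 by ring, show r + 1 + 2 = r + 3 by ring,
    show r + 1 + 3 = r + 4 by ring, show r + 2 + 1 = r + 3 by ring,
    show r + 2 + 2 = r + 4 by ring]
  linear_combination e

/-! ### The pentagram map on brackets -/

/-- The short diagonals of a polygon. -/
def diag (v : ℤ → Fin 3 → ℝ) (r : ℤ) : Fin 3 → ℝ := v r ⨯₃ v (r + 2)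

/-- Representatives of the vertices of the image under the pentagram map. -/
def pent (v : ℤ → Fin 3 → ℝ) (r : ℤ) : Fin 3 → ℝ := diag v (r - 1) ⨯₃ diag v r

theorem pent_succ (v : ℤ → Fin 3 → ℝ) (r : ℤ) :
    pent v (r + 1) = diag v r ⨯₃ diag v (r + 1) := by
  rw [pent, add_sub_cancel_right]

theorem br_cross_cross_cross_left (p q r s u : Fin 3 → ℝ) :
    br (p ⨯₃ q) (q ⨯₃ r) (s ⨯₃ u) = br p q r * br q s u := by
  rw [← br_cycle, br_cycle, ← br_cycle, br_cross_cross, cross_dot, br_cycle s, br_cycle u]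

theorem br_cross_cross_cross_right (p q r s u : Fin 3 → ℝ) :
    br (p ⨯₃ q) (r ⨯₃ s) (s ⨯₃ u) = br r s u * br p q s := by
  rw [br_cross_cross, cross_dot]

theorem br_cross_cross_cross_outer (p q r s u : Fin 3 → ℝ) :
    br (p ⨯₃ r) (q ⨯₃ s) (r ⨯₃ u) = br p r u * br q r s := by
  simp only [br_eq]
  simp [cross_apply]
  ring

theorem br_diag (v : ℤ → Fin 3 → ℝ) (r : ℤ) :
    br (diag v r) (diag v (r + 1)) (diag v (r + 2)) = br024 v r * br012 v (r + 1) := by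
  simp only [diag, br024, br012, show r + 1 + 2 = r + 3 by ring, show r + 2 + 2 = r + 4 by ring,
    show r + 1 + 1 = r + 2 by ring]
  exact br_cross_cross_cross_outer _ _ _ _ _

theorem br023_diag (v : ℤ → Fin 3 → ℝ) (r : ℤ) :
    br (diag v r) (diag v (r + 2)) (diag v (r + 3)) = br024 v r * br013 v (r + 2) := by
  simp only [diag, br024, br013, show r + 2 + 2 = r + 4 by ring, show r + 3 + 2 = r + 5 by ring,
    show r + 2 + 1 = r + 3 by ring, show r + 2 + 3 = r + 5 by ring]
  exact br_cross_cross_cross_left _ _ _ _ _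

theorem br013_diag (v : ℤ → Fin 3 → ℝ) (r : ℤ) :
    br (diag v r) (diag v (r + 1)) (diag v (r + 3)) = br024 v (r + 1) * br023 v r := by
  simp only [diag, br024, br023, show r + 1 + 2 = r + 3 by ring, show r + 3 + 2 = r + 5 by ring,
    show r + 1 + 4 = r + 5 by ring]
  exact br_cross_cross_cross_right _ _ _ _ _

theorem br012_pent (v : ℤ → Fin 3 → ℝ) (r : ℤ) : br012 (pent v) (r + 1) =
    br024 v r * br012 v (r + 1) * (br024 v (r + 1) * br012 v (r + 2)) := by
  rw [← show r + 1 + 1 = r + 2 by ring, ← br_diag, ← br_diag, br012, pent_succ, pent_succ,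
    show r + 1 + 2 = r + 1 + 1 + 1 by ring, pent_succ, br_cross_cross_cross_left,
    show r + 2 = r + 1 + 1 by ring]

theorem br013_pent (v : ℤ → Fin 3 → ℝ) (r : ℤ) : br013 (pent v) (r + 1) =
    br024 v r * br012 v (r + 1) * (br024 v (r + 1) * br013 v (r + 3)) := by
  rw [show r + 3 = r + 1 + 2 by ring, ← br_diag, ← br023_diag, br013, pent_succ, pent_succ,
    show r + 1 + 3 = r + 1 + 2 + 1 by ring, pent_succ, br_cross_cross_cross_left,
    show r + 2 = r + 1 + 1 by ring]

theorem br023_pent (v : ℤ → Fin 3 → ℝ) (r : ℤ) : br023 (pent v) (r + 1) =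
    br024 v (r + 2) * br012 v (r + 3) * (br024 v (r + 1) * br023 v r) := by
  rw [show r + 3 = r + 2 + 1 by ring, ← br_diag, ← br013_diag, br023, pent_succ,
    show r + 1 + 2 = r + 2 + 1 by ring, pent_succ,
    show r + 1 + 3 = r + 2 + 1 + 1 by ring, pent_succ, br_cross_cross_cross_right,
    show r + 3 = r + 2 + 1 by ring, show r + 2 + 2 = r + 2 + 1 + 1 by ring]

theorem diag_ne_zero {v : ℤ → Fin 3 → ℝ} (hg : IsGeneral v) (r : ℤ) : diag v r ≠ 0 :=
  (cross_ne_zero_of_br (hg r).1).2.2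

theorem pent_ne_zero {v : ℤ → Fin 3 → ℝ} (hg : IsGeneral v) (r : ℤ) : pent v r ≠ 0 := by
  have h1 := br_cross_cross_cross_right (v (r - 1)) (v (r - 1 + 2)) (v r) (v (r + 2)) (v (r - 1))
  have h2 : br (v (r - 1)) (v r) (v (r + 2)) ≠ 0 := by
    have := (hg (r - 1)).2.1
    rwa [br013, sub_add_cancel, show r - 1 + 3 = r + 2 by ring] at this
  have h3 : br (v (r - 1)) (v (r - 1 + 2)) (v (r + 2)) ≠ 0 := by
    have := (hg (r - 1)).2.2
    rwa [br023, show r - 1 + 3 = r + 2 by ring] at this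
  rw [← br_cycle (v (r - 1)) (v r)] at h1
  exact (cross_ne_zero_of_br (h1.trans_ne (mul_ne_zero h2 h3))).1

theorem TwistedPolygon.IsLift.join_eq {A : TwistedPolygon n c} {v : ℤ → Fin 3 → ℝ}
    (h : A.IsLift v) (r : ℤ) : join (A.vertex r) (A.vertex (r + 2)) =
      Projectivization.mk ℝ (diag v r) (diag_ne_zero h.isGeneral r) := by
  have h' := h
  choose hv hA using h'
  rw [hA, hA]
  exact join_mk _ _ _

theorem TwistedPolygon.IsLift.join_eq' {A : TwistedPolygon n c} {v : ℤ → Fin 3 → ℝ}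
    (h : A.IsLift v) (r : ℤ) : join (A.vertex (r - 1)) (A.vertex (r + 1)) =
      Projectivization.mk ℝ (diag v (r - 1)) (diag_ne_zero h.isGeneral (r - 1)) := by
  rw [← h.join_eq, show r - 1 + 2 = r + 1 by ring]

theorem TwistedPolygon.IsLift.meet_join {A : TwistedPolygon n c} {v : ℤ → Fin 3 → ℝ}
    (h : A.IsLift v) (r : ℤ) :
    meet (join (A.vertex (r - 1)) (A.vertex (r + 1))) (join (A.vertex r) (A.vertex (r + 2))) =
      Projectivization.mk ℝ (pent v r) (pent_ne_zero h.isGeneral r) := by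
  rw [h.join_eq, h.join_eq']
  exact meet_mk _ _ _

theorem TwistedPolygon.IsLift.isPentagram_iff {A : TwistedPolygon n c}
    {B : TwistedPolygon n (c + 1)} {v : ℤ → Fin 3 → ℝ} (h : A.IsLift v) :
    A.IsPentagram B ↔ B.IsLift (pent v) := by
  refine forall_congr' fun r => ?_
  rw [h.meet_join]
  exact ⟨fun e => ⟨_, e⟩, fun ⟨_, e⟩ => e⟩

theorem TwistedPolygon.IsPentagram.br024_ne_zero {A : TwistedPolygon n c}
    {B : TwistedPolygon n (c + 1)} (hAB : A.IsPentagram B) {v : ℤ → Fin 3 → ℝ} (h : A.IsLift v)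
    (r : ℤ) : br024 v r ≠ 0 := by
  have := ((h.isPentagram_iff.1 hAB).isGeneral (r + 1)).1
  rw [br012_pent] at this
  exact left_ne_zero_of_mul (left_ne_zero_of_mul this)

theorem TwistedPolygon.IsPentagram.one_sub_ne_zero {A : TwistedPolygon n c}
    {B : TwistedPolygon n (c + 1)} (hAB : A.IsPentagram B) {j : ℤ} (hj : Even (j - c)) :
    1 - A.x j * A.x (j + 1) ≠ 0 := by
  obtain ⟨v, hv⟩ := A.exists_isLift
  have hg := hv.isGeneral
  obtain ⟨r, hr⟩ := hj
  obtain rfl : j = c + 2 * (r - 2 + 2) := by omega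
  rw [hv.one_sub]
  exact div_ne_zero (mul_ne_zero (hAB.br024_ne_zero hv _) (hg _).1)
    (mul_ne_zero (hg _).2.2 (hg _).2.1)

theorem TwistedPolygon.IsPentagram.x_even {A : TwistedPolygon n c}
    {B : TwistedPolygon n (c + 1)} (hAB : A.IsPentagram B) {j : ℤ} (hj : Even (j - (c + 1))) :
    B.x j * (1 - A.x (j + 1) * A.x (j + 2)) = A.x (j - 1) * (1 - A.x (j - 3) * A.x (j - 2)) := by
  obtain ⟨v, hv⟩ := A.exists_isLift
  have hg := hv.isGeneral
  have hw := hv.isPentagram_iff.1 hAB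
  have hc := hAB.br024_ne_zero hv
  obtain ⟨r, hr⟩ := hj
  obtain rfl : j = (c + 1 : ℕ) + 2 * (r - 3 + 1 + 2) := by push_cast; omega
  generalize r - 3 = r
  rw [show ((c + 1 : ℕ) + 2 * (r + 1 + 2) + 1 : ℤ) = c + 2 * (r + 2 + 2) by push_cast; ring,
    show ((c + 1 : ℕ) + 2 * (r + 1 + 2) + 2 : ℤ) = c + 2 * (r + 2 + 2) + 1 by push_cast; ring,
    show ((c + 1 : ℕ) + 2 * (r + 1 + 2) - 1 : ℤ) = c + 2 * (r + 1 + 2) by push_cast; ring,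
    show ((c + 1 : ℕ) + 2 * (r + 1 + 2) - 3 : ℤ) = c + 2 * (r + 2) by push_cast; ring,
    show ((c + 1 : ℕ) + 2 * (r + 1 + 2) - 2 : ℤ) = c + 2 * (r + 2) + 1 by push_cast; ring,
    hv.one_sub, hv.one_sub, hw.x_even, hv.x_even, show r + 1 + 2 = r + 2 + 1 by ring, br013_pent,
    br012_pent, br023_pent, br023_pent]
  simp only [add_assoc]
  norm_num only
  have a1 := hc (r + 1)
  have a2 := hc (r + 2)
  have a3 := hc (r + 3)
  have b1 := (hg (r + 3)).1
  have b2 := (hg (r + 4)).1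
  have d1 := (hg (r + 3)).2.1
  have d2 := (hg (r + 1)).2.1
  have e1 := (hg (r + 2)).2.2
  have e2 := (hg (r + 1)).2.2
  have e3 := (hg r).2.2
  field_simp

theorem TwistedPolygon.IsPentagram.x_odd {A : TwistedPolygon n c}
    {B : TwistedPolygon n (c + 1)} (hAB : A.IsPentagram B) {j : ℤ} (hj : Even (j - c)) :
    B.x j * (1 - A.x (j - 2) * A.x (j - 1)) = A.x (j + 1) * (1 - A.x (j + 2) * A.x (j + 3)) := by
  obtain ⟨v, hv⟩ := A.exists_isLift
  have hg := hv.isGeneral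
  have hw := hv.isPentagram_iff.1 hAB
  have hc := hAB.br024_ne_zero hv
  obtain ⟨r, hr⟩ := hj
  obtain rfl : j = (c + 1 : ℕ) + 2 * (r - 4 + 1 + 2) + 1 := by push_cast; omega
  generalize r - 4 = r
  rw [show ((c + 1 : ℕ) + 2 * (r + 1 + 2) + 1 - 2 : ℤ) = c + 2 * (r + 1 + 2) by push_cast; ring,
    show ((c + 1 : ℕ) + 2 * (r + 1 + 2) + 1 - 1 : ℤ) = c + 2 * (r + 1 + 2) + 1 by push_cast; ring,
    show ((c + 1 : ℕ) + 2 * (r + 1 + 2) + 1 + 1 : ℤ) = c + 2 * (r + 2 + 2) + 1 by push_cast; ring,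
    show ((c + 1 : ℕ) + 2 * (r + 1 + 2) + 1 + 2 : ℤ) = c + 2 * (r + 3 + 2) by push_cast; ring,
    show ((c + 1 : ℕ) + 2 * (r + 1 + 2) + 1 + 3 : ℤ) = c + 2 * (r + 3 + 2) + 1 by push_cast; ring,
    hv.one_sub, hv.one_sub, hw.x_odd, hv.x_odd, br013_pent,
    br012_pent, br023_pent, br013_pent]
  simp only [add_assoc]
  norm_num only
  have a1 := hc (r + 1)
  have a2 := hc (r + 2)
  have a3 := hc r
  have b1 := (hg (r + 1)).1
  have b2 := (hg (r + 2)).1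
  have d1 := (hg (r + 3)).2.1
  have d2 := (hg (r + 4)).2.1
  have d3 := (hg (r + 2)).2.1
  have e1 := (hg (r + 3)).2.2
  have e2 := (hg (r + 1)).2.2
  field_simp

theorem isGeneral_pent {v : ℤ → Fin 3 → ℝ} (hg : IsGeneral v) (hc : ∀ r, br024 v r ≠ 0) :
    IsGeneral (pent v) := by
  intro r
  obtain ⟨r, rfl⟩ : ∃ s, r = s + 1 := ⟨r - 1, by ring⟩
  rw [br012_pent, br013_pent, br023_pent]
  exact ⟨mul_ne_zero (mul_ne_zero (hc _) (hg _).1) (mul_ne_zero (hc _) (hg _).1),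
    mul_ne_zero (mul_ne_zero (hc _) (hg _).1) (mul_ne_zero (hc _) (hg _).2.1),
    mul_ne_zero (mul_ne_zero (hc _) (hg _).1) (mul_ne_zero (hc _) (hg _).2.2)⟩

/-- The brackets of `pent v` factor into brackets of `v`, and `br024` is the only factor that can
vanish. The image has the same monodromy as `A`, because joins transform by the cofactor map and
meets transform back. -/
theorem TwistedPolygon.exists_isPentagram (A : TwistedPolygon n c)
    (h : ∀ j, Even (j - (c : ℤ)) → 1 - A.x j * A.x (j + 1) ≠ 0) :
    ∃ B : TwistedPolygon n (c + 1), A.IsPentagram B := by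
  obtain ⟨v, hv⟩ := A.exists_isLift
  have hg := hv.isGeneral
  have hc : ∀ r, br024 v r ≠ 0 := by
    intro r h0
    refine h (c + 2 * (r + 2)) (by simp) ?_
    rw [hv.one_sub, h0]
    simp
  have hw := pent_ne_zero hg
  obtain ⟨φ, hφ⟩ := A.twisted
  obtain ⟨ψ, d, hd, h1, h2⟩ := exists_cofactor φ
  have hne : ∀ r, A.vertex (r - 1) ≠ A.vertex (r + 1) := by
    intro r
    have := (ne_of_independent (A.generalPosition (r - 1)).1).2.1
    rwa [show r - 1 + 2 = r + 1 by ring] at this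
  have hne' : ∀ r, join (A.vertex (r - 1)) (A.vertex (r + 1)) ≠
      join (A.vertex r) (A.vertex (r + 2)) := by
    intro r
    rw [hv.join_eq, hv.join_eq', Ne, Projectivization.mk_eq_mk_iff_crossProduct_eq_zero]
    exact hw r
  refine ⟨⟨fun r => Projectivization.mk ℝ _ (hw r), ⟨φ, fun r => ?_⟩,
    (generalPosition_mk_iff hw).2 (isGeneral_pent hg hc)⟩, fun r => (hv.meet_join r).symm⟩
  rw [← hv.meet_join, ← hv.meet_join, ← meet_act hd h2 (hne' r), ← join_act h1 (hne r),
    ← join_act h1, ← hφ, ← hφ, ← hφ, ← hφ]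
  · congr 3 <;> ring
  · have := hne (r + 1)
    rwa [add_sub_cancel_right, add_assoc] at this

theorem TwistedPolygon.x_add_period (A : TwistedPolygon n c) (j : ℤ) :
    A.x (j + 2 * n) = A.x j := by
  obtain ⟨φ, h⟩ := A.twisted
  let B : TwistedPolygon n c := ⟨fun r => A.vertex (r + n), ⟨φ, fun r => by rw [h]⟩, fun r => by
    have := A.generalPosition (r + n)
    simp only [show r + 1 + (n : ℤ) = r + n + 1 by ring, show r + 2 + (n : ℤ) = r + n + 2 by ring,
      show r + 3 + (n : ℤ) = r + n + 3 by ring]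
    exact this⟩
  have hAB : A.x = B.x := TwistedPolygon.x_congr ⟨φ, h⟩
  have e : (j + 2 * n - c) / 2 = (j - c) / 2 + n := by omega
  have e' : Even (j + 2 * n - (c : ℤ)) ↔ Even (j - (c : ℤ)) := by
    rw [show j + 2 * n - (c : ℤ) = j - c + 2 * n by ring, Int.even_add]; simp
  refine Eq.trans ?_ (congrFun hAB j).symm
  simp only [TwistedPolygon.x, e, e', B, sub_add_eq_add_sub, add_right_comm]

/-! ### Polygons with given coordinates -/

theorem exists_orbit {X : Type*} (Φ : ℤ → X ≃ X) (s₀ : X) :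
    ∃ s : ℤ → X, s 0 = s₀ ∧ ∀ r, s (r + 1) = Φ r (s r) := by
  let f : ℕ → X := fun k => Nat.rec s₀ (fun k a => Φ k a) k
  let g : ℕ → X := fun k => Nat.rec s₀ (fun k a => (Φ (Int.negSucc k)).symm a) k
  refine ⟨fun r => Int.casesOn r f (fun k => g (k + 1)), rfl, fun r => ?_⟩
  cases r with
  | ofNat k => rfl
  | negSucc k =>
    have : Φ (Int.negSucc k) (g (k + 1)) = g k := (Φ (Int.negSucc k)).apply_symm_apply _
    cases k with
    | zero => exact this.symm
    | succ k => exact this.symm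

theorem orbit_unique {X : Type*} {Φ : ℤ → X ≃ X} {s s' : ℤ → X} (hs : ∀ r, s (r + 1) = Φ r (s r))
    (hs' : ∀ r, s' (r + 1) = Φ r (s' r)) (h : s 0 = s' 0) (r : ℤ) : s r = s' r := by
  induction r with
  | zero => exact h
  | succ k ih => rw [hs, hs', ih]
  | pred k ih =>
    have h1 := hs (-k - 1)
    have h2 := hs' (-k - 1)
    rw [sub_add_cancel] at h1 h2
    rw [ih, h2] at h1
    exact ((Φ _).injective h1).symm

/-- One step of the recursion that produces the vertices of a polygon. -/
noncomputable def stepEquiv (β γ : ℝ) (hγ : γ ≠ 0) : ((Fin 3 → ℝ) × (Fin 3 → ℝ) × (Fin 3 → ℝ)) ≃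
    ((Fin 3 → ℝ) × (Fin 3 → ℝ) × (Fin 3 → ℝ)) where
  toFun s := (s.2.1, s.2.2, s.2.2 + β • s.2.1 + γ • s.1)
  invFun s := (γ⁻¹ • (s.2.2 - s.2.1 - β • s.1), s.1, s.2.1)
  left_inv s := by simp [add_sub_right_comm, smul_smul, hγ]
  right_inv s := by simp [smul_smul, hγ]

theorem linearIndependent_of_br {u : Fin 3 → Fin 3 → ℝ} (hu : br (u 0) (u 1) (u 2) ≠ 0) :
    LinearIndependent ℝ u := by
  have h := Matrix.linearIndependent_rows_iff_isUnit (A := (u : Matrix (Fin 3) (Fin 3) ℝ))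
  refine h.2 (((Matrix.isUnit_iff_isUnit_det _).trans isUnit_iff_ne_zero).2 ?_)
  rw [show u = ![u 0, u 1, u 2] by ext t; fin_cases t <;> rfl, ← triple_product_eq_det]
  exact hu

theorem exists_linearEquiv {e u : Fin 3 → Fin 3 → ℝ} (he : br (e 0) (e 1) (e 2) ≠ 0)
    (hu : br (u 0) (u 1) (u 2) ≠ 0) :
    ∃ φ : (Fin 3 → ℝ) ≃ₗ[ℝ] (Fin 3 → ℝ), ∀ t, φ (e t) = u t := by
  let b := basisOfLinearIndependentOfCardEqFinrank (linearIndependent_of_br he) (by simp)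
  let b' := basisOfLinearIndependentOfCardEqFinrank (linearIndependent_of_br hu) (by simp)
  refine ⟨b.equiv b' (Equiv.refl _), fun t => ?_⟩
  have h1 : e t = b t := by simp [b]
  have h2 : u t = b' t := by simp [b']
  rw [h1, h2, Module.Basis.equiv_apply, Equiv.refl_apply]

theorem exists_recurrence (n : ℕ) (β γ : ℤ → ℝ) (hγ : ∀ r, γ r ≠ 0) (hβn : ∀ r, β (r + n) = β r)
    (hγn : ∀ r, γ (r + n) = γ r) : ∃ v : ℤ → Fin 3 → ℝ,
      (∀ r, v (r + 3) = v (r + 2) + β r • v (r + 1) + γ r • v r) ∧ (∀ r, br012 v r ≠ 0) ∧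
      ∃ φ : (Fin 3 → ℝ) ≃ₗ[ℝ] (Fin 3 → ℝ), ∀ r, v (r + n) = φ (v r) := by
  obtain ⟨s, hs0, hs⟩ := exists_orbit (fun r => stepEquiv (β r) (γ r) (hγ r))
    (![1, 0, 0], ![0, 1, 0], ![0, 0, 1])
  have h1 : ∀ r, (s (r + 1)).1 = (s r).2.1 := fun r => by rw [hs]; rfl
  have h2 : ∀ r, (s (r + 1)).2.1 = (s r).2.2 := fun r => by rw [hs]; rfl
  have h3 : ∀ r, (s (r + 1)).2.2 = (s r).2.2 + β r • (s r).2.1 + γ r • (s r).1 :=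
    fun r => by rw [hs]; rfl
  set v : ℤ → Fin 3 → ℝ := fun r => (s r).1 with hv
  have e1 : ∀ r, (s r).2.1 = v (r + 1) := fun r => (h1 r).symm
  have e2 : ∀ r, (s r).2.2 = v (r + 2) := fun r => by
    rw [← h2, ← h1, add_assoc, one_add_one_eq_two]
  have hrec : ∀ r, v (r + 3) = v (r + 2) + β r • v (r + 1) + γ r • v r := fun r => by
    have := h3 r
    rwa [e1, e2, e2, add_assoc, show (1 : ℤ) + 2 = 3 by norm_num] at this
  have hd : ∀ r, br012 v (r + 1) = γ r * br012 v r := fun r => by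
    rw [br012, show r + 1 + 2 = r + 3 by ring, show r + 1 + 1 = r + 2 by ring, hrec, br012]
    simp only [br_eq, Pi.add_apply, Pi.smul_apply, smul_eq_mul]
    ring
  have hd0 : ∀ r, br012 v r ≠ 0 := by
    intro r
    induction r with
    | zero =>
      rw [br012, ← e1, ← e2, hv]
      simp [hs0, br_eq]
    | succ k ih => rw [hd]; exact mul_ne_zero (hγ _) ih
    | pred k ih =>
      rw [← sub_add_cancel (-k : ℤ) 1, hd] at ih
      exact right_ne_zero_of_mul ih
  refine ⟨v, hrec, hd0, ?_⟩
  obtain ⟨φ, hφ⟩ := exists_linearEquiv (e := ![v 0, v 1, v 2]) (u := ![v n, v (n + 1), v (n + 2)])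
    (by simpa [br012] using hd0 0) (by simpa [br012] using hd0 n)
  refine ⟨φ, fun r => ?_⟩
  have := orbit_unique (Φ := fun r => stepEquiv (β r) (γ r) (hγ r)) (s := fun r => s (r + n))
    (s' := fun r => (φ (s r).1, φ (s r).2.1, φ (s r).2.2)) (fun r => by
      rw [add_right_comm, hs]; simp only [hβn, hγn]) (fun r => by
      simp [h1, h2, h3, stepEquiv]) (by
      have p0 := hφ 0
      have p1 := hφ 1
      have p2 := hφ 2
      simp at p0 p1 p2
      simp only [e1, e2, zero_add]
      rw [show (s 0).1 = v 0 from rfl, p0, p1, p2, ← e1, ← e2]) r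
  exact congrArg Prod.fst this

/-- The lift is sought with coefficient `1` at `v (r + 2)` in its recurrence. Then `br013 = br012`
and `br023 = -β * br012`, so the odd coordinates determine `β` and the even ones then determine `γ`.
Periodic coefficients give the monodromy. -/
theorem exists_polygon {n : ℕ} (c : ℕ) {x : ℤ → ℝ} (hx : ∀ j, x j ≠ 0)
    (hxn : ∀ j, x (j + 2 * n) = x j) : ∃ A : TwistedPolygon n c, ∀ j, A.x j = x j := by
  set β : ℤ → ℝ := fun r => -x (c + 2 * r + 3) with hβ
  set γ : ℤ → ℝ := fun r => x (c + 2 * r + 2) * β (r - 1) * β r with hγ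
  have hβ0 : ∀ r, β r ≠ 0 := fun r => neg_ne_zero.2 (hx _)
  have hγ0 : ∀ r, γ r ≠ 0 := fun r => mul_ne_zero (mul_ne_zero (hx _) (hβ0 _)) (hβ0 _)
  have hβn : ∀ r, β (r + n) = β r := fun r => by
    simp only [hβ]
    rw [show (c : ℤ) + 2 * (r + n) + 3 = c + 2 * r + 3 + 2 * n by ring, hxn]
  have hγn : ∀ r, γ (r + n) = γ r := fun r => by
    simp only [hγ]
    rw [show r + (n : ℤ) - 1 = r - 1 + n by ring, hβn, hβn,
      show (c : ℤ) + 2 * (r + n) + 2 = c + 2 * r + 2 + 2 * n by ring, hxn]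
  obtain ⟨v, hv, hd, φ, hφ⟩ := exists_recurrence n β γ hγ0 hβn hγn
  have hd' : ∀ r, br012 v (r + 1) = γ r * br012 v r := fun r => by
    rw [br012, show r + 1 + 2 = r + 3 by ring, show r + 1 + 1 = r + 2 by ring, hv, br012]
    simp only [br_eq, Pi.add_apply, Pi.smul_apply, smul_eq_mul]
    ring
  have he : ∀ r, br013 v r = br012 v r := fun r => by
    rw [br013, hv, br012]
    simp only [br_eq, Pi.add_apply, Pi.smul_apply, smul_eq_mul]
    ring
  have hh : ∀ r, br023 v r = -β r * br012 v r := fun r => by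
    rw [br023, hv, br012]
    simp only [br_eq, Pi.add_apply, Pi.smul_apply, smul_eq_mul]
    ring
  have hv0 : ∀ r, v r ≠ 0 := fun r => (ne_zero_of_br (hd r)).1
  have hg : IsGeneral v := fun r => ⟨hd r, (he r).trans_ne (hd r),
    (hh r).trans_ne (mul_ne_zero (neg_ne_zero.2 (hβ0 r)) (hd r))⟩
  let A : TwistedPolygon n c := ⟨fun r => Projectivization.mk ℝ _ (hv0 r), ⟨φ, fun r => by
    rw [act_mk]
    congr 1
    exact hφ r⟩, (generalPosition_mk_iff hv0).2 hg⟩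
  have hA : A.IsLift v := fun r => ⟨hv0 r, rfl⟩
  refine ⟨A, fun j => ?_⟩
  rcases Int.even_or_odd' (j - c - 4) with ⟨r, hr | hr⟩
  · obtain rfl : j = c + 2 * (r + 2) := by omega
    rw [hA.x_even, he, hh, hh, show r + 2 = r + 1 + 1 by ring, hd', hd']
    have e : γ (r + 1) = x (c + 2 * (r + 1 + 1)) * β r * β (r + 1) := by
      simp only [hγ]
      rw [add_sub_cancel_right, show (c : ℤ) + 2 * (r + 1) + 2 = c + 2 * (r + 1 + 1) by ring]
    have b1 := hβ0 r
    have b2 := hβ0 (r + 1)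
    have b3 := hγ0 r
    have b4 := hd r
    rw [e]
    field_simp
  · obtain rfl : j = c + 2 * (r + 2) + 1 := by omega
    rw [hA.x_odd, he, he, hh]
    have e : β (r + 1) = -x (c + 2 * (r + 2) + 1) := by
      simp only [hβ]
      rw [show (c : ℤ) + 2 * (r + 1) + 3 = c + 2 * (r + 2) + 1 by ring]
    have b1 := hd r
    have b2 := hd (r + 1)
    rw [e]
    field_simp

/-! ### Collinear vertices -/

theorem br_eq_zero_of_finrank_le {M : Submodule ℝ (Fin 3 → ℝ)} (hM : Module.finrank ℝ M ≤ 2)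
    {a b c : Fin 3 → ℝ} (ha : a ∈ M) (hb : b ∈ M) (hc : c ∈ M) : br a b c = 0 := by
  by_contra h
  have h1 : LinearIndependent ℝ ![a, b, c] := linearIndependent_of_br (by simpa using h)
  have h2 : LinearIndependent ℝ (![⟨a, ha⟩, ⟨b, hb⟩, ⟨c, hc⟩] : Fin 3 → M) := by
    refine LinearIndependent.of_comp M.subtype ?_
    convert h1 using 1
    ext t : 1
    fin_cases t <;> rfl
  have := h2.fintype_card_le_finrank
  simp at this
  omega

theorem exists_submodule_finrank_le {N : Fin 3 → ℝ} (hN : N ≠ 0) :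
    ∃ M : Submodule ℝ (Fin 3 → ℝ), Module.finrank ℝ M ≤ 2 ∧ ∀ v, N ⬝ᵥ v = 0 → v ∈ M := by
  let f : (Fin 3 → ℝ) →ₗ[ℝ] ℝ :=
    { toFun := fun v => N ⬝ᵥ v
      map_add' := dotProduct_add N
      map_smul' := fun c v => dotProduct_smul c N v }
  refine ⟨LinearMap.ker f, ?_, fun v hv => hv⟩
  have h : LinearMap.ker f < ⊤ := by
    refine lt_top_iff_ne_top.2 fun e => hN ?_
    have : N ∈ LinearMap.ker f := e ▸ Submodule.mem_top
    exact dotProduct_self_eq_zero.1 this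
  have := Submodule.finrank_lt h.ne
  simp at this
  omega

theorem TwistedPolygon.IsLift.isCollinear_iff {A : TwistedPolygon n c} {v : ℤ → Fin 3 → ℝ}
    (h : A.IsLift v) (b : ℤ) (m : ℕ) :
    Projectivization.IsCollinear {P | ∃ t : ℕ, t ≤ m + 1 ∧ P = A.vertex (b + 2 * t)} ↔
      ∀ t : ℕ, t < m → br024 v (b + 2 * t) = 0 := by
  have hg := h.isGeneral
  choose hv hA using h
  constructor
  · rintro ⟨M, -, hM, hS⟩ t ht
    have key : ∀ t : ℕ, t ≤ m + 1 → v (b + 2 * t) ∈ M.submodule := fun t ht => by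
      rw [Projectivization.Subspace.mem_submodule_iff M (hv _)]
      exact hS ⟨t, ht, (hA _).symm⟩
    refine br_eq_zero_of_finrank_le hM (key t (by omega)) ?_ ?_
    · have := key (t + 1) (by omega)
      rwa [show b + 2 * ((t + 1 : ℕ) : ℤ) = b + 2 * t + 2 by push_cast; ring] at this
    · have := key (t + 2) (by omega)
      rwa [show b + 2 * ((t + 2 : ℕ) : ℤ) = b + 2 * t + 4 by push_cast; ring] at this
  · intro h0
    have hd := diag_ne_zero hg
    obtain ⟨M, hM, hM'⟩ := exists_submodule_finrank_le (hd b)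
    have key : ∀ t : ℕ, t ≤ m →
        diag v b ⬝ᵥ v (b + 2 * t) = 0 ∧ diag v b ⬝ᵥ v (b + 2 * t + 2) = 0 := by
      intro t
      induction t with
      | zero =>
        intro _
        simp only [diag, Nat.cast_zero, mul_zero, add_zero, cross_dot]
        constructor <;> simp only [br_eq] <;> ring
      | succ t ih =>
        intro ht
        obtain ⟨h1, h2⟩ := ih (by omega)
        rw [show b + 2 * ((t + 1 : ℕ) : ℤ) = b + 2 * t + 2 by push_cast; ring]
        refine ⟨h2, ?_⟩
        -- The next short diagonal is nonzero and has the same line as the first, so the next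
        -- collinear triple extends that line.
        obtain ⟨s, hs⟩ := exists_cross_eq_smul (hd b) h1 h2
        have h3 := h0 t (by omega)
        rw [br024, ← cross_dot, hs, smul_dotProduct, smul_eq_mul] at h3
        rw [show b + 2 * (t : ℤ) + 2 + 2 = b + 2 * t + 4 by ring]
        refine (mul_eq_zero.1 h3).resolve_left ?_
        rintro rfl
        exact hd (b + 2 * t) (by rw [diag, hs, zero_smul])
    refine ⟨M.projectivization, ?_, ?_, ?_⟩
    · rw [Projectivization.Subspace.submodule.apply_symm_apply]
      infer_instance
    · rw [Projectivization.Subspace.submodule.apply_symm_apply]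
      exact hM
    · rintro _ ⟨t, ht, rfl⟩
      rw [hA]
      refine (Submodule.mk_mem_projectivization_iff M (hv _)).2 (hM' _ ?_)
      rcases Nat.lt_or_ge m t with h1 | h1
      · have := (key m le_rfl).2
        obtain rfl : t = m + 1 := by omega
        rwa [show b + 2 * ((m + 1 : ℕ) : ℤ) = b + 2 * m + 2 by push_cast; ring]
      · exact (key t h1).1

theorem TwistedPolygon.isCollinear_iff (A : TwistedPolygon n c) (b : ℤ) (m : ℕ) :
    Projectivization.IsCollinear {P | ∃ t : ℕ, t ≤ m + 1 ∧ P = A.vertex (b + 2 * t)} ↔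
      ∀ t : ℕ, t < m →
        A.x (c + 2 * (b + 2 + 2 * t)) * A.x (c + 2 * (b + 2 + 2 * t) + 1) = 1 := by
  obtain ⟨v, hv⟩ := A.exists_isLift
  have hg := hv.isGeneral
  rw [hv.isCollinear_iff]
  refine forall_congr' fun t => imp_congr_right fun _ => ?_
  have h1 := hv.one_sub (b + 2 * t)
  rw [show b + 2 * (t : ℤ) + 2 = b + 2 + 2 * t by ring] at h1
  rw [eq_comm (b := (1 : ℝ)), ← sub_eq_zero (a := (1 : ℝ)), h1]
  simp [(hg _).1, (hg _).2.1, (hg _).2.2]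

end Pentagram

namespace Pentagram

variable {n c : ℕ}

/-! ### The pentagram map in coordinates -/

namespace PolygonSpace

theorem exists_rep (p : PolygonSpace n c) : ∃ A, mk A = p := Quotient.exists_rep p

theorem x_ne_zero (p : PolygonSpace n c) (j : ℤ) : p.x j ≠ 0 := by
  obtain ⟨A, rfl⟩ := p.exists_rep
  exact A.x_ne_zero j

theorem x_add_period (p : PolygonSpace n c) (j : ℤ) : p.x (j + 2 * n) = p.x j := by
  obtain ⟨A, rfl⟩ := p.exists_rep
  exact A.x_add_period j

theorem y_ne_zero (p : PolygonSpace n c) (j : ℤ) : p.y j ≠ 0 := by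
  have h1 := p.x_ne_zero j
  have h2 := p.x_ne_zero (j + 1)
  rw [y]
  split_ifs <;> simp [h1, h2]

theorem y_add_period (p : PolygonSpace n c) (j : ℤ) : p.y (j + 2 * n) = p.y j := by
  have e : Even (j + 2 * n - (c : ℤ)) ↔ Even (j - (c : ℤ)) := by
    rw [show j + 2 * n - (c : ℤ) = j - c + 2 * n by ring, Int.even_add]; simp
  rw [y, y, if_congr e rfl rfl, x_add_period, add_right_comm, x_add_period]

theorem exists_of_x {x : ℤ → ℝ} (c : ℕ) (hx : ∀ j, x j ≠ 0) (hxn : ∀ j, x (j + 2 * n) = x j) :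
    ∃ p : PolygonSpace n c, ∀ j, p.x j = x j := by
  obtain ⟨A, hA⟩ := exists_polygon c hx hxn
  exact ⟨mk A, hA⟩

theorem IsPentagram.one_sub_ne_zero {p : PolygonSpace n c} {q : PolygonSpace n (c + 1)}
    (h : p.IsPentagram q) {j : ℤ} (hj : Even (j - c)) : 1 - p.x j * p.x (j + 1) ≠ 0 := by
  obtain ⟨A, B, rfl, rfl, h⟩ := h
  exact h.one_sub_ne_zero hj

theorem IsPentagram.x_even {p : PolygonSpace n c} {q : PolygonSpace n (c + 1)}
    (h : p.IsPentagram q) {j : ℤ} (hj : Even (j - (c + 1))) :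
    q.x j * (1 - p.x (j + 1) * p.x (j + 2)) = p.x (j - 1) * (1 - p.x (j - 3) * p.x (j - 2)) := by
  obtain ⟨A, B, rfl, rfl, h⟩ := h
  exact h.x_even hj

theorem IsPentagram.x_odd {p : PolygonSpace n c} {q : PolygonSpace n (c + 1)}
    (h : p.IsPentagram q) {j : ℤ} (hj : Even (j - c)) :
    q.x j * (1 - p.x (j - 2) * p.x (j - 1)) = p.x (j + 1) * (1 - p.x (j + 2) * p.x (j + 3)) := by
  obtain ⟨A, B, rfl, rfl, h⟩ := h
  exact h.x_odd hj

theorem exists_isPentagram (p : PolygonSpace n c)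
    (h : ∀ j, Even (j - (c : ℤ)) → 1 - p.x j * p.x (j + 1) ≠ 0) : ∃ q, p.IsPentagram q := by
  obtain ⟨A, rfl⟩ := p.exists_rep
  obtain ⟨B, hB⟩ := A.exists_isPentagram h
  exact ⟨mk B, A, B, rfl, rfl, hB⟩

/-! ### Iterates of the pentagram map -/

/-- The monomial `∏_{|i| ≤ k} y_{j+3i}`. -/
noncomputable def ym (p : PolygonSpace n 0) (k : ℕ) (j : ℤ) : ℝ := slab (fun i => p.y (j + 3 * i)) k

/-- The monomial `∏_{|i| ≤ k - 1} y_{j+3i}`, to be read as `y_j⁻¹` for `k = 0`. -/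
noncomputable def ymPred (p : PolygonSpace n 0) : ℕ → ℤ → ℝ
  | 0, j => (p.y j)⁻¹
  | k + 1, j => p.ym k j

/-- The monomial factor of `x_j ∘ T^k` for `j ≡ k`. -/
noncomputable def monA (p : PolygonSpace n 0) : ℕ → ℤ → ℝ
  | 0, j => p.x j
  | k + 1, j => monA p k (j - 1) * p.ym k (j + 1) * (p.ym k (j - 3))⁻¹

/-- The monomial factor of `x_{j+1} ∘ T^k` for `j ≡ k`. -/
noncomputable def monB (p : PolygonSpace n 0) : ℕ → ℤ → ℝ
  | 0, j => p.x (j + 1)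
  | k + 1, j => monB p k (j + 1) * p.ym k (j - 1) * (p.ym k (j + 3))⁻¹

theorem ym_ne_zero (p : PolygonSpace n 0) (k : ℕ) (j : ℤ) : p.ym k j ≠ 0 := by
  rw [ym, slab]
  exact Finset.prod_ne_zero_iff.2 fun _ _ => p.y_ne_zero _

theorem ymPred_ne_zero (p : PolygonSpace n 0) (k : ℕ) (j : ℤ) : p.ymPred k j ≠ 0 := by
  cases k with
  | zero => exact inv_ne_zero (p.y_ne_zero j)
  | succ k => exact p.ym_ne_zero k j

theorem ymPred_mul_ym (p : PolygonSpace n 0) (k : ℕ) (j : ℤ) :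
    p.ymPred k j * p.ym (k + 1) j = p.ym k (j - 3) * p.ym k (j + 3) := by
  cases k with
  | zero =>
    have := p.y_ne_zero j
    simp only [ymPred, ym, slab_succ, slab_zero]
    norm_num
    field_simp
    ring_nf
  | succ k =>
    simp only [ymPred, ym]
    rw [← slab_shift_mul_slab_shift, mul_comm]
    congr 2 <;> · ext i; congr 1; ring

theorem monA_ne_zero (p : PolygonSpace n 0) (k : ℕ) (j : ℤ) : p.monA k j ≠ 0 := by
  induction k generalizing j with
  | zero => exact p.x_ne_zero j
  | succ k ih =>
    exact mul_ne_zero (mul_ne_zero (ih _) (p.ym_ne_zero _ _)) (inv_ne_zero (p.ym_ne_zero _ _))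

theorem monB_ne_zero (p : PolygonSpace n 0) (k : ℕ) (j : ℤ) : p.monB k j ≠ 0 := by
  induction k generalizing j with
  | zero => exact p.x_ne_zero _
  | succ k ih =>
    exact mul_ne_zero (mul_ne_zero (ih _) (p.ym_ne_zero _ _)) (inv_ne_zero (p.ym_ne_zero _ _))

/-- These are the monomial factors of the two kinds of products `x_j x_{j+1}` after `k` steps. The
two statements feed each other in the induction through `ymPred_mul_ym`. -/
theorem monA_mul_monB (p : PolygonSpace n 0) (k : ℕ) :
    (∀ j : ℤ, Even (j - k) → p.monA k j * p.monB k j * p.ym k j = -1) ∧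
      ∀ j : ℤ, Even (j + 1 - k) → p.monA k (j + 1) * p.monB k (j - 1) * p.ymPred k j = -1 := by
  induction k with
  | zero =>
    have h1 := p.x_ne_zero
    constructor
    · intro j hj
      simp only [monA, monB, ym, slab_zero, mul_zero, add_zero, y, if_pos hj]
      have h2 := h1 j
      have h3 := h1 (j + 1)
      field_simp
    · intro j hj
      have hj' : ¬ Even (j - (0 : ℕ)) := by
        rw [← Int.even_add_one]; convert hj using 1; ring
      simp only [monA, monB, ymPred, y, if_neg hj', sub_add_cancel]
      have h2 := h1 j
      have h3 := h1 (j + 1)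
      field_simp
  | succ k ih =>
    obtain ⟨ih1, ih2⟩ := ih
    constructor
    · intro j hj
      have hj1 : Even (j - 1 - k) := by convert hj using 1; push_cast; ring
      have hj2 : Even (j + 1 - k) := by
        rw [Int.even_iff] at hj1 ⊢; omega
      have e1 := ih1 _ hj1
      have e2 := ih1 _ hj2
      have e3 := ih2 _ hj2
      have e4 := p.ymPred_mul_ym k j
      have n1 := p.monA_ne_zero k (j + 1)
      have n2 := p.monB_ne_zero k (j - 1)
      have n3 := p.ymPred_ne_zero k j
      have n4 := p.ym_ne_zero k (j - 3)
      have n5 := p.ym_ne_zero k (j + 3)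
      simp only [monA, monB]
      have n6 := mul_ne_zero (mul_ne_zero n1 n2) n3
      field_simp
      apply mul_left_cancel₀ n6
      linear_combination (exp := 1) p.monA k (j - 1) * p.monB k (j - 1) * p.ym k (j - 1) *
        (p.monA k (j + 1) * p.monB k (j + 1) * p.ym k (j + 1)) * e4 +
        p.ym k (j - 3) * p.ym k (j + 3) * (p.monA k (j - 1) * p.monB k (j - 1) * p.ym k (j - 1) *
        e2 - e1) + p.ym k (j - 3) * p.ym k (j + 3) * e3
    · intro j hj
      have hj1 : Even (j - k) := by convert hj using 1; push_cast; ring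
      have e1 := ih1 _ hj1
      have n4 := p.ym_ne_zero k (j - 2)
      have n5 := p.ym_ne_zero k (j + 2)
      simp only [monA, monB, ymPred, add_sub_cancel_right, sub_add_cancel]
      rw [show j + 1 + 1 = j + 2 by ring, show j + 1 - 3 = j - 2 by ring,
        show j - 1 - 1 = j - 2 by ring, show j - 1 + 3 = j + 2 by ring]
      field_simp
      exact e1

/-- The values of the rational functions `x_j ∘ T^k` at `p`. -/
def IsValue (p : PolygonSpace n 0) (k : ℕ) (x : ℤ → ℝ) : Prop := ∀ j : ℤ, Even (j - k) →
  tauVal p.y k j ≠ 0 ∧ tauVal p.y (k + 1) (j + 1) ≠ 0 ∧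
  x j = p.monA k j * (tauVal p.y k (j + 2) * tauVal p.y (k + 1) (j - 3)) /
    (tauVal p.y k (j - 2) * tauVal p.y (k + 1) (j + 1)) ∧
  x (j + 1) = p.monB k j * (tauVal p.y k (j - 2) * tauVal p.y (k + 1) (j + 3)) /
    (tauVal p.y k (j + 2) * tauVal p.y (k + 1) (j - 1))

theorem IsValue.mul_even {p : PolygonSpace n 0} {k : ℕ} {x : ℤ → ℝ} (h : p.IsValue k x) {j : ℤ}
    (hj : Even (j - k)) :
    x j * x (j + 1) * (p.ym k j * (tauVal p.y (k + 1) (j + 1) * tauVal p.y (k + 1) (j - 1))) =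
      -(tauVal p.y (k + 1) (j - 3) * tauVal p.y (k + 1) (j + 3)) := by
  have e := (p.monA_mul_monB k).1 j hj
  obtain ⟨h1, h2, h3, h4⟩ := h j hj
  have a1 := (h (j - 2) (by rw [Int.even_iff] at hj ⊢; omega))
  have a2 := (h (j + 2) (by rw [Int.even_iff] at hj ⊢; omega)).1
  have a3 := a1.1
  have a4 := a1.2.1
  rw [show j - 2 + 1 = j - 1 by ring] at a4
  rw [h3, h4]
  field_simp
  linear_combination (tauVal p.y (k + 1) (j - 3) * tauVal p.y (k + 1) (j + 3)) * e

theorem IsValue.mul_odd {p : PolygonSpace n 0} {k : ℕ} {x : ℤ → ℝ} (h : p.IsValue k x) {j : ℤ}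
    (hj : Even (j + 1 - k)) :
    x j * x (j + 1) * (p.ymPred k j * (tauVal p.y k (j + 1) * tauVal p.y k (j - 1))) =
      -(tauVal p.y k (j - 3) * tauVal p.y k (j + 3)) := by
  have e := (p.monA_mul_monB k).2 j hj
  have hj' : Even (j - 1 - k) := by rw [Int.even_iff] at hj ⊢; omega
  obtain ⟨h1, h2, h3, -⟩ := h (j + 1) hj
  obtain ⟨h5, h6, -, h4⟩ := h (j - 1) hj'
  obtain ⟨-, a1, -⟩ := h (j - 3) (by rw [Int.even_iff] at hj' ⊢; omega)
  rw [show j - 3 + 1 = j - 2 by ring] at a1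
  rw [show j + 1 + 1 = j + 2 by ring] at h2
  rw [sub_add_cancel, show j - 1 - 2 = j - 3 by ring, show j - 1 + 3 = j + 2 by ring,
    show j - 1 + 2 = j + 1 by ring, show j - 1 - 1 = j - 2 by ring] at h4
  rw [show j + 1 + 2 = j + 3 by ring, show j + 1 - 3 = j - 2 by ring,
    show j + 1 - 2 = j - 1 by ring, show j + 1 + 1 = j + 2 by ring] at h3
  rw [h3, h4]
  field_simp
  linear_combination (tauVal p.y k (j - 3) * tauVal p.y k (j + 3)) * e

/-- The octahedron recurrence in geometric form: the next pentagram step can be carried out when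
`tauVal` at level `k + 2` does not vanish. -/
theorem IsValue.one_sub {p : PolygonSpace n 0} {k : ℕ} {x : ℤ → ℝ} (h : p.IsValue k x) {j : ℤ}
    (hj : Even (j - k)) : 1 - x j * x (j + 1) = tauVal p.y k j * tauVal p.y (k + 2) j /
      (p.ym k j * (tauVal p.y (k + 1) (j + 1) * tauVal p.y (k + 1) (j - 1))) := by
  have h1 := (h j hj).2.1
  have h2 := (h (j - 2) (by rw [Int.even_iff] at hj ⊢; omega)).2.1
  rw [show j - 2 + 1 = j - 1 by ring] at h2
  rw [eq_div_iff (mul_ne_zero (p.ym_ne_zero k j) (mul_ne_zero h1 h2)), sub_mul, h.mul_even hj,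
    tauVal_rec, ym]
  ring

theorem IsValue.isPentagram {p : PolygonSpace n 0} {k : ℕ} {q : PolygonSpace n k}
    (h : p.IsValue k q.x) {q' : PolygonSpace n (k + 1)} (hq : q.IsPentagram q') :
    p.IsValue (k + 1) q'.x := by
  have hF : ∀ j : ℤ, Even (j - k) → tauVal p.y (k + 2) j ≠ 0 := by
    intro j hj h0
    have := hq.one_sub_ne_zero hj
    rw [h.one_sub hj, h0] at this
    simp at this
  have hM := p.ym_ne_zero k
  intro j hj
  have hj1 : Even (j - 1 - k) := by convert hj using 1; push_cast; ring
  have hj2 : Even (j + 1 - k) := by rw [Int.even_iff] at hj1 ⊢; omega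
  have hj3 : Even (j - 3 - k) := by rw [Int.even_iff] at hj1 ⊢; omega
  have hj4 : Even (j + 3 - k) := by rw [Int.even_iff] at hj2 ⊢; omega
  have hj5 : Even (j - 5 - k) := by rw [Int.even_iff] at hj3 ⊢; omega
  obtain ⟨a1, a2, a3, a4⟩ := h _ hj1
  obtain ⟨b1, b2, b3, b4⟩ := h _ hj2
  obtain ⟨c1, c2, c3, c4⟩ := h _ hj3
  obtain ⟨d1, d2, d3, d4⟩ := h _ hj4
  obtain ⟨e1, e2, e3, e4⟩ := h _ hj5
  have f1 := hF _ hj1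
  have f2 := hF _ hj2
  have f3 := hF _ hj3
  have f4 := hF _ hj4
  have u1 := h.one_sub hj1
  have u2 := h.one_sub hj2
  have u3 := h.one_sub hj3
  have u4 := h.one_sub hj4
  have v1 := hq.x_even (j := j) (by exact_mod_cast hj)
  have v2 := hq.x_odd hj2
  have w1 := hq.one_sub_ne_zero hj1
  have w2 := hq.one_sub_ne_zero hj2
  have m1 := hM (j - 3)
  have m2 := hM (j + 1)
  have m3 := hM (j - 1)
  have m4 := hM (j + 3)
  simp only [sub_add_cancel, show j - 3 + 1 = j - 2 by ring, show j - 3 - 1 = j - 4 by ring,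
    show j + 1 + 1 = j + 2 by ring, show j + 1 - 1 = j by ring, show j - 1 - 1 = j - 2 by ring,
    show j + 3 + 1 = j + 4 by ring, show j + 3 - 1 = j + 2 by ring,
    show j + 1 - 2 = j - 1 by ring, show j + 1 + 2 = j + 3 by ring,
    show j + 1 + 3 = j + 4 by ring, show j - 5 + 1 = j - 4 by ring,
    show j - 1 + 2 = j + 1 by ring, show j - 1 - 3 = j - 4 by ring,
    show j - 1 - 2 = j - 3 by ring] at *
  refine ⟨a2, f2, ?_, ?_⟩
  · rw [← eq_div_iff w2] at v1
    rw [v1, u2, u3, a3, monA]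
    field_simp
  · rw [← eq_div_iff w1] at v2
    rw [v2, u1, u4, b4, monB]
    field_simp

theorem isValue_zero (p : PolygonSpace n 0) : p.IsValue 0 p.x := by
  intro j _
  simp [monA, monB]

theorem IsIterate.isValue {p : PolygonSpace n 0} {k : ℕ} {q : PolygonSpace n k}
    (h : IsIterate k p q) : p.IsValue k q.x := by
  induction k with
  | zero =>
    obtain rfl : q = p := h
    exact q.isValue_zero
  | succ k ih =>
    obtain ⟨q', h1, h2⟩ := h
    exact (ih h1).isPentagram h2

theorem exists_isIterate (p : PolygonSpace n 0) (k : ℕ)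
    (h : ∀ s ≤ k + 1, ∀ j : ℤ, Even (j - s) → tauVal p.y s j ≠ 0) : ∃ q, IsIterate k p q := by
  induction k with
  | zero => exact ⟨p, rfl⟩
  | succ k ih =>
    obtain ⟨q, hq⟩ := ih fun s hs => h s (by omega)
    have hv := hq.isValue
    obtain ⟨q', hq'⟩ := q.exists_isPentagram fun j hj => by
      rw [hv.one_sub hj]
      have h2 : Even (j - 2 - k) := by rw [Int.even_iff] at hj ⊢; omega
      have h3 := (hv _ h2).2.1
      rw [show j - 2 + 1 = j - 1 by ring] at h3
      refine div_ne_zero (mul_ne_zero (hv j hj).1 (h (k + 2) le_rfl j ?_))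
        (mul_ne_zero (p.ym_ne_zero k j) (mul_ne_zero (hv j hj).2.1 h3))
      rw [Int.even_iff] at hj ⊢; omega
    exact ⟨q', q, hq, hq'⟩

end PolygonSpace

end Pentagram

namespace Pentagram

variable {n : ℕ}

namespace PolygonSpace

/-! ### Laurent polynomials in the coordinates -/

/-- The product of the coordinates. -/
noncomputable def coordProd (p : PolygonSpace n 0) : ℝ := ∏ t, p.coords t

theorem coordProd_ne_zero (p : PolygonSpace n 0) : p.coordProd ≠ 0 :=
  Finset.prod_ne_zero_iff.2 fun _ _ => p.x_ne_zero _

/-- Laurent polynomials in the coordinates. -/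
def IsLaurent (φ : PolygonSpace n 0 → ℝ) : Prop :=
  ∃ (P : MvPolynomial (Fin (2 * n)) ℝ) (e : ℕ), ∀ p,
    φ p * p.coordProd ^ e = MvPolynomial.eval p.coords P

namespace IsLaurent

theorem eval_coords (P : MvPolynomial (Fin (2 * n)) ℝ) :
    IsLaurent fun p : PolygonSpace n 0 => MvPolynomial.eval p.coords P :=
  ⟨P, 0, fun p => by simp⟩

theorem const (r : ℝ) : IsLaurent fun _ : PolygonSpace n 0 => r :=
  ⟨MvPolynomial.C r, 0, fun p => by simp⟩

theorem coords (t : Fin (2 * n)) : IsLaurent fun p : PolygonSpace n 0 => p.coords t :=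
  ⟨MvPolynomial.X t, 0, fun p => by simp⟩

theorem eval_prod_X (p : PolygonSpace n 0) :
    MvPolynomial.eval p.coords (∏ t, MvPolynomial.X t) = p.coordProd := by
  simp [map_prod, coordProd]

theorem inv_coords (t : Fin (2 * n)) : IsLaurent fun p : PolygonSpace n 0 => (p.coords t)⁻¹ := by
  refine ⟨∏ s ∈ Finset.univ.erase t, MvPolynomial.X s, 1, fun p => ?_⟩
  have h : p.coords t ≠ 0 := p.x_ne_zero _
  rw [coordProd, ← Finset.mul_prod_erase _ _ (Finset.mem_univ t), pow_one, inv_mul_cancel_left₀ h]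
  simp [map_prod]

variable {φ ψ : PolygonSpace n 0 → ℝ}

theorem add (hφ : IsLaurent φ) (hψ : IsLaurent ψ) : IsLaurent fun p => φ p + ψ p := by
  obtain ⟨P, e, hP⟩ := hφ
  obtain ⟨Q, f, hQ⟩ := hψ
  refine ⟨P * (∏ t, MvPolynomial.X t) ^ f + Q * (∏ t, MvPolynomial.X t) ^ e, e + f, fun p => ?_⟩
  rw [map_add, map_mul, map_mul, map_pow, map_pow, eval_prod_X, ← hP, ← hQ]
  ring

theorem mul (hφ : IsLaurent φ) (hψ : IsLaurent ψ) : IsLaurent fun p => φ p * ψ p := by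
  obtain ⟨P, e, hP⟩ := hφ
  obtain ⟨Q, f, hQ⟩ := hψ
  refine ⟨P * Q, e + f, fun p => ?_⟩
  rw [map_mul, ← hP, ← hQ]
  ring

theorem neg (hφ : IsLaurent φ) : IsLaurent fun p => -φ p := by
  simpa using (const (-1)).mul hφ

theorem sub (hφ : IsLaurent φ) (hψ : IsLaurent ψ) : IsLaurent fun p => φ p - ψ p := by
  simpa [sub_eq_add_neg] using hφ.add hψ.neg

theorem pow (hφ : IsLaurent φ) (e : ℕ) : IsLaurent fun p => φ p ^ e := by
  induction e with
  | zero => simpa using const 1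
  | succ e ih => simpa [pow_succ] using ih.mul hφ

theorem prod {ι : Type*} (s : Finset ι) {f : ι → PolygonSpace n 0 → ℝ}
    (h : ∀ i ∈ s, IsLaurent (f i)) : IsLaurent fun p => ∏ i ∈ s, f i p := by
  classical
  induction s using Finset.induction_on with
  | empty => simpa using const 1
  | insert a s ha ih =>
    simp only [Finset.prod_insert ha]
    exact (h a (Finset.mem_insert_self a s)).mul
      (ih fun i hi => h i (Finset.mem_insert_of_mem hi))

theorem eval {σ : Type*} {f : σ → PolygonSpace n 0 → ℝ} (h : ∀ i, IsLaurent (f i))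
    (P : MvPolynomial σ ℝ) : IsLaurent fun p => MvPolynomial.eval (fun i => f i p) P := by
  induction P using MvPolynomial.induction_on with
  | C a => simpa using const a
  | add P Q hP hQ => simpa using hP.add hQ
  | mul_X P i hP => simpa using hP.mul (h i)

theorem comp (hφ : IsLaurent φ) {θ : PolygonSpace n 0 → PolygonSpace n 0}
    (h : ∀ t, IsLaurent fun p => (θ p).coords t) (h' : ∀ t, IsLaurent fun p => ((θ p).coords t)⁻¹) :
    IsLaurent fun p => φ (θ p) := by
  obtain ⟨P, e, hP⟩ := hφ
  have h1 : IsLaurent fun p => ((θ p).coordProd)⁻¹ := by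
    simpa only [coordProd, Finset.prod_inv_distrib] using prod Finset.univ fun t _ => h' t
  have h2 := (eval h P).mul (h1.pow e)
  convert h2 using 2 with p
  have := pow_ne_zero e (θ p).coordProd_ne_zero
  rw [inv_pow, eq_mul_inv_iff_mul_eq₀ this]
  exact hP (θ p)

end IsLaurent

/-- The position of `x_j` among the coordinates `x_1, …, x_{2n}`. -/
theorem exists_coords_eq (hn : 0 < n) (j : ℤ) : ∃ t : Fin (2 * n),
    ∀ (c : ℕ) (p : PolygonSpace n c), p.x j = p.coords t := by
  have h1 : (0 : ℤ) < 2 * n := by omega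
  have h2 := Int.emod_nonneg (j - 1) h1.ne'
  have h3 := Int.emod_lt_of_pos (j - 1) h1
  have h4 := Int.emod_add_mul_ediv (j - 1) (2 * n)
  refine ⟨⟨((j - 1) % (2 * n)).toNat, by omega⟩, fun c p => ?_⟩
  have hp : Function.Periodic p.x (2 * n) := fun j => p.x_add_period j
  rw [coords, Int.toNat_of_nonneg h2]
  have := hp.int_mul ((j - 1) / (2 * n)) ((j - 1) % (2 * n) + 1)
  rw [← this]
  congr 1
  push_cast
  linarith

theorem exists_of_coords (w : Fin (2 * n) → ℝ) (hw : ∀ t, w t ≠ 0) (hn : 0 < n) (c : ℕ) :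
    ∃ p : PolygonSpace n c, p.coords = w := by
  have h1 : (0 : ℤ) < 2 * n := by omega
  have h2 := fun j : ℤ => Int.emod_nonneg (j - 1) h1.ne'
  have h3 := fun j : ℤ => Int.emod_lt_of_pos (j - 1) h1
  obtain ⟨p, hp⟩ := exists_of_x (n := n) (x := fun j => w ⟨((j - 1) % (2 * n)).toNat, by
    have := h2 j
    have := h3 j
    omega⟩) c (fun j => hw _) (fun j => by
      congr 3
      rw [add_sub_right_comm, Int.add_emod_right])
  refine ⟨p, funext fun t => ?_⟩
  rw [coords, hp]
  congr 1
  ext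
  have : ((t : ℤ) + 1 - 1) % (2 * n) = t := by
    rw [add_sub_cancel_right, Int.emod_eq_of_lt] <;> omega
  simp only [this, Int.toNat_natCast]

theorem IsLaurent.x (hn : 0 < n) (j : ℤ) : IsLaurent fun p : PolygonSpace n 0 => p.x j := by
  obtain ⟨t, ht⟩ := exists_coords_eq hn j
  simpa only [ht] using IsLaurent.coords t

theorem IsLaurent.inv_x (hn : 0 < n) (j : ℤ) : IsLaurent fun p : PolygonSpace n 0 => (p.x j)⁻¹ := by
  obtain ⟨t, ht⟩ := exists_coords_eq hn j
  simpa only [ht] using IsLaurent.inv_coords t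

/-- The coordinate vectors fill the real torus. Multiplying the polynomials by all variables makes
the product vanish off the torus too, hence it is the zero polynomial. -/
theorem IsLaurent.eq_zero_or_eq_zero (hn : 0 < n) {φ ψ : PolygonSpace n 0 → ℝ} (hφ : IsLaurent φ)
    (hψ : IsLaurent ψ) (h : ∀ p, φ p * ψ p = 0) : (∀ p, φ p = 0) ∨ ∀ p, ψ p = 0 := by
  obtain ⟨P, e, hP⟩ := hφ
  obtain ⟨Q, f, hQ⟩ := hψ
  have h0 : P * Q * ∏ t, MvPolynomial.X t = 0 := by
    refine MvPolynomial.funext fun w => ?_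
    by_cases hw : ∀ t, w t ≠ 0
    · obtain ⟨p, rfl⟩ := exists_of_coords w hw hn 0
      rw [map_mul, map_mul, ← hP, ← hQ, mul_mul_mul_comm, h]
      simp
    · push Not at hw
      obtain ⟨t, ht⟩ := hw
      rw [map_mul, map_prod, Finset.prod_eq_zero (Finset.mem_univ t) (by simpa using ht)]
      simp
  have h1 : (∏ t, MvPolynomial.X t : MvPolynomial (Fin (2 * n)) ℝ) ≠ 0 :=
    Finset.prod_ne_zero_iff.2 fun t _ => MvPolynomial.X_ne_zero t
  have key : ∀ {φ : PolygonSpace n 0 → ℝ} {e : ℕ} {P : MvPolynomial (Fin (2 * n)) ℝ},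
      (∀ p, φ p * p.coordProd ^ e = MvPolynomial.eval p.coords P) → P = 0 → ∀ p, φ p = 0 := by
    rintro φ e P hP rfl p
    have := hP p
    rw [map_zero] at this
    exact (mul_eq_zero.1 this).resolve_right (pow_ne_zero _ p.coordProd_ne_zero)
  rcases mul_eq_zero.1 ((mul_eq_zero.1 h0).resolve_right h1) with h | h
  · exact Or.inl (key hP h)
  · exact Or.inr (key hQ h)

/-! ### Loci given by relations `x_j x_{j+1} = 1` -/

/-- The locus `x_{z+4s} x_{z+4s+1} = 1` for `s < m`. -/
def relLocus (n m : ℕ) (z : ℤ) : Set (PolygonSpace n 0) :=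
  {p | ∀ s : ℕ, s < m → p.x (z + 4 * s) * p.x (z + 4 * s + 1) = 1}

/-- Overwrite `x_{z+4s+1}` by the inverse of `x_{z+4s}`. The overwritten and the copied indices
differ in parity, also modulo `2n`, so the rule is consistent; it is monomial in the coordinates. -/
theorem exists_retraction (hn : 0 < n) (m : ℕ) (z : ℤ) :
    ∃ θ : PolygonSpace n 0 → PolygonSpace n 0, (∀ p, θ p ∈ relLocus n m z) ∧
      (∀ p ∈ relLocus n m z, (θ p).coords = p.coords) ∧
      (∀ t, IsLaurent fun p => (θ p).coords t) ∧ ∀ t, IsLaurent fun p => ((θ p).coords t)⁻¹ := by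
  classical
  let C : ℤ → Prop := fun j => ∃ s : ℕ, s < m ∧ ∃ l : ℤ, j = z + 4 * s + 1 + l * (2 * n)
  have hC : ∀ j, C (j + 2 * n) ↔ C j := by
    refine fun j => ⟨?_, ?_⟩
    · rintro ⟨s, hs, l, hl⟩
      exact ⟨s, hs, l - 1, by linarith⟩
    · rintro ⟨s, hs, l, hl⟩
      exact ⟨s, hs, l + 1, by linarith⟩
  have hex : ∀ p : PolygonSpace n 0, ∃ q : PolygonSpace n 0,
      ∀ j, q.x j = if C j then (p.x (j - 1))⁻¹ else p.x j := by
    refine fun p => exists_of_x 0 (fun j => ?_) fun j => ?_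
    · split_ifs
      · exact inv_ne_zero (p.x_ne_zero _)
      · exact p.x_ne_zero _
    · rw [if_congr (hC j) rfl rfl, add_sub_right_comm, x_add_period, x_add_period]
  choose θ hθ using hex
  refine ⟨θ, fun p s hs => ?_, fun p hp => funext fun t => ?_, fun t => ?_, fun t => ?_⟩
  · have h1 : ¬ C (z + 4 * s) := by
      rintro ⟨s', -, l, hl⟩
      have : (z + 4 * s) % 2 = (z + 4 * s' + 1 + 2 * (l * n)) % 2 := by
        rw [hl]; congr 1; ring
      omega
    rw [hθ, hθ, if_neg h1, if_pos ⟨s, hs, 0, by ring⟩, add_sub_cancel_right,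
      mul_inv_cancel₀ (p.x_ne_zero _)]
  · rw [coords, coords, hθ]
    split_ifs with h
    · obtain ⟨s, hs, l, hl⟩ := h
      have hper : Function.Periodic p.x (2 * n) := fun j => p.x_add_period j
      have e1 := hper.int_mul l (z + 4 * s)
      have e2 := hper.int_mul l (z + 4 * s + 1)
      rw [hl, show z + 4 * (s : ℤ) + 1 + l * (2 * n) - 1 = z + 4 * s + l * (2 * n) by ring]
      simp only [Int.cast_eq] at e1 e2
      rw [e1, e2]
      exact inv_eq_of_mul_eq_one_right (hp s hs)
    · rfl
  · simp only [coords, hθ]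
    split_ifs
    · exact IsLaurent.inv_x hn _
    · exact IsLaurent.x hn _
  · simp only [coords, hθ]
    split_ifs
    · simpa only [inv_inv] using IsLaurent.x hn _
    · exact IsLaurent.inv_x hn _

theorem IsLaurent.congr_coords {φ : PolygonSpace n 0 → ℝ} (hφ : IsLaurent φ)
    {p q : PolygonSpace n 0} (h : p.coords = q.coords) : φ p = φ q := by
  obtain ⟨P, e, hP⟩ := hφ
  have h1 := hP p
  have h2 : p.coordProd = q.coordProd := by rw [coordProd, coordProd, h]
  rw [h, ← hP q, h2] at h1
  exact mul_right_cancel₀ (pow_ne_zero _ q.coordProd_ne_zero) h1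

/-- Irreducibility of the locus, inherited from the torus by pulling back along the retraction. -/
theorem IsLaurent.eq_zero_or_eq_zero_on (hn : 0 < n) {m : ℕ} {z : ℤ} {φ ψ : PolygonSpace n 0 → ℝ}
    (hφ : IsLaurent φ) (hψ : IsLaurent ψ) (h : ∀ p ∈ relLocus n m z, φ p * ψ p = 0) :
    (∀ p ∈ relLocus n m z, φ p = 0) ∨ ∀ p ∈ relLocus n m z, ψ p = 0 := by
  obtain ⟨θ, h1, h2, h3, h4⟩ := exists_retraction hn m z
  rcases (hφ.comp h3 h4).eq_zero_or_eq_zero hn (hψ.comp h3 h4) fun p => h _ (h1 p) with h5 | h5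
  · exact Or.inl fun p hp => by rw [← h5 p, hφ.congr_coords (h2 p hp)]
  · exact Or.inr fun p hp => by rw [← h5 p, hψ.congr_coords (h2 p hp)]

theorem IsLaurent.exists_prod_ne_zero (hn : 0 < n) {m : ℕ} {z : ℤ} {ι : Type*} (s : Finset ι)
    {f : ι → PolygonSpace n 0 → ℝ} (hf : ∀ i ∈ s, IsLaurent (f i))
    (h : ∀ i ∈ s, ∃ p ∈ relLocus n m z, f i p ≠ 0) (hne : (relLocus n m z).Nonempty) :
    ∃ p ∈ relLocus n m z, ∏ i ∈ s, f i p ≠ 0 := by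
  classical
  induction s using Finset.induction_on with
  | empty => obtain ⟨p, hp⟩ := hne; exact ⟨p, hp, by simp⟩
  | insert a s ha ih =>
    by_contra! h0
    simp only [Finset.prod_insert ha] at h0
    have hs := prod s fun i hi => hf i (Finset.mem_insert_of_mem hi)
    rcases (hf a (Finset.mem_insert_self a s)).eq_zero_or_eq_zero_on hn hs h0 with h1 | h1
    · obtain ⟨p, hp, hp'⟩ := h a (Finset.mem_insert_self a s)
      exact hp' (h1 p hp)
    · obtain ⟨p, hp, hp'⟩ := ih (fun i hi => hf i (Finset.mem_insert_of_mem hi))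
        fun i hi => h i (Finset.mem_insert_of_mem hi)
      exact hp' (h1 p hp)

/-! ### Laurent polynomials in the formulas for the pentagram map -/

theorem IsLaurent.y (hn : 0 < n) (j : ℤ) : IsLaurent fun p : PolygonSpace n 0 => p.y j := by
  simp only [PolygonSpace.y]
  split_ifs
  · simp only [mul_inv]
    exact ((IsLaurent.inv_x hn _).mul (IsLaurent.inv_x hn _)).neg
  · exact ((IsLaurent.x hn _).mul (IsLaurent.x hn _)).neg

theorem IsLaurent.inv_y (hn : 0 < n) (j : ℤ) : IsLaurent fun p : PolygonSpace n 0 => (p.y j)⁻¹ := by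
  simp only [PolygonSpace.y]
  split_ifs
  · simp only [inv_neg, inv_inv]
    exact ((IsLaurent.x hn _).mul (IsLaurent.x hn _)).neg
  · simp only [inv_neg, mul_inv]
    exact ((IsLaurent.inv_x hn _).mul (IsLaurent.inv_x hn _)).neg

theorem IsLaurent.tauVal (hn : 0 < n) (s : ℕ) (j : ℤ) :
    IsLaurent fun p : PolygonSpace n 0 => tauVal p.y s j :=
  IsLaurent.eval (fun v : ℤ × ℤ => IsLaurent.y hn (3 * v.1 + v.2)) _

theorem IsLaurent.ym (hn : 0 < n) (k : ℕ) (j : ℤ) :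
    IsLaurent fun p : PolygonSpace n 0 => p.ym k j := by
  simp only [PolygonSpace.ym, slab]
  exact prod _ fun i _ => IsLaurent.y hn _

theorem IsLaurent.inv_ym (hn : 0 < n) (k : ℕ) (j : ℤ) :
    IsLaurent fun p : PolygonSpace n 0 => (p.ym k j)⁻¹ := by
  simp only [PolygonSpace.ym, slab, ← Finset.prod_inv_distrib]
  exact prod _ fun i _ => IsLaurent.inv_y hn _

theorem IsLaurent.ymPred (hn : 0 < n) (k : ℕ) (j : ℤ) :
    IsLaurent fun p : PolygonSpace n 0 => p.ymPred k j := by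
  cases k with
  | zero => exact IsLaurent.inv_y hn j
  | succ k => exact IsLaurent.ym hn k j

theorem IsLaurent.monA (hn : 0 < n) (k : ℕ) (j : ℤ) :
    IsLaurent fun p : PolygonSpace n 0 => p.monA k j := by
  induction k generalizing j with
  | zero => exact IsLaurent.x hn j
  | succ k ih => exact ((ih _).mul (IsLaurent.ym hn _ _)).mul (IsLaurent.inv_ym hn _ _)

theorem IsLaurent.monB (hn : 0 < n) (k : ℕ) (j : ℤ) :
    IsLaurent fun p : PolygonSpace n 0 => p.monB k j := by
  induction k generalizing j with
  | zero => exact IsLaurent.x hn _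
  | succ k ih => exact ((ih _).mul (IsLaurent.ym hn _ _)).mul (IsLaurent.inv_ym hn _ _)

end PolygonSpace

end Pentagram

namespace Pentagram

variable {n : ℕ}

theorem tauVal_pos {y : ℤ → ℝ} (hy : ∀ j, 0 < y j) (s : ℕ) : ∀ j, 0 < tauVal y s j := by
  induction s using Nat.strong_induction_on with
  | _ s ih =>
    match s, ih with
    | 0, _ => simp
    | 1, _ => simp
    | s + 2, ih =>
      intro j
      have h0 := ih s (by omega)
      have h1 := ih (s + 1) (by omega)
      have hM : 0 < slab (fun i => y (j + 3 * i)) s := by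
        rw [slab]
        exact Finset.prod_pos fun i _ => hy _
      have h2 : 0 < tauVal y s j * tauVal y (s + 2) j := by
        rw [tauVal_rec]
        have a1 := h1 (j - 3)
        have a2 := h1 (j + 3)
        have a3 := h1 (j - 1)
        have a4 := h1 (j + 1)
        positivity
      exact (mul_pos_iff_of_pos_left (h0 j)).1 h2

namespace PolygonSpace

/-! ### Vanishing and nonvanishing on the locus -/

theorem y_eq_of_mem_relLocus {m : ℕ} {a : ℤ} {p : PolygonSpace n 0}
    (hp : p ∈ relLocus n m (2 * a)) {t : ℤ} (h0 : 0 ≤ t) (ht : t < m) :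
    p.y (2 * a + 4 * t) = -1 := by
  lift t to ℕ using h0
  have := hp t (by exact_mod_cast ht)
  rw [y, if_pos (by rw [Int.even_iff]; omega), this, inv_one]

theorem tauVal_eq_zero_of_mem_relLocus {m k : ℕ} {a t r j : ℤ} {p : PolygonSpace n 0}
    (hp : p ∈ relLocus n m (2 * a)) (ht : 0 ≤ t) (htk : t + k < m) (hr : 0 ≤ r) (hrk : r ≤ k)
    (hj : j = 2 * a + 4 * t + 2 * r + k) : tauVal p.y (k + 2) j = 0 := by
  rw [hj]
  exact tauVal_eq_zero (fun t h0 ht => y_eq_of_mem_relLocus hp h0 ht) ht htk hr hrk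

/-- Starting from the value `1`, the products `x_j x_{j+1}` determine the coordinates one after
another. Only the last product of the period closes the cycle, so `2n - 1` consecutive values of `y`
are free. -/
theorem exists_y_eq (hn : 0 < n) (a : ℤ) {Y : ℤ → ℝ} (hY : ∀ j, Y j ≠ 0) :
    ∃ p : PolygonSpace n 0, ∀ j, 2 * a ≤ j → j ≤ 2 * a + 2 * n - 2 → p.y j = Y j := by
  have h1 : (0 : ℤ) < 2 * n := by omega
  let C : ℤ → ℝ := fun j => if Even j then -(Y j)⁻¹ else -Y j
  have hC : ∀ j, C j ≠ 0 := by
    intro j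
    simp only [C]
    split_ifs <;> simp [hY j]
  let u : ℕ → ℝ := fun d => Nat.rec 1 (fun d r => C (2 * a + d) / r) d
  have hu : ∀ d, u d ≠ 0 := by
    intro d
    induction d with
    | zero => exact one_ne_zero
    | succ d ih => exact div_ne_zero (hC _) ih
  have hu' : ∀ d, u (d + 1) * u d = C (2 * a + d) := fun d => div_mul_cancel₀ _ (hu d)
  obtain ⟨p, hp⟩ := exists_of_x (n := n) (x := fun j => u ((j - 2 * a) % (2 * n)).toNat) 0
    (fun j => hu _) (fun j => by
      simp only [add_sub_right_comm, Int.add_emod_right])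
  refine ⟨p, fun j hj hj' => ?_⟩
  have e1 : p.x j * p.x (j + 1) = C j := by
    rw [hp, hp, Int.emod_eq_of_lt (by omega) (by omega), Int.emod_eq_of_lt (by omega) (by omega),
      show (j + 1 - 2 * a).toNat = (j - 2 * a).toNat + 1 by omega, mul_comm, hu']
    congr 1
    omega
  rw [y, e1]
  simp only [C, Nat.cast_zero, sub_zero]
  split_ifs <;> simp

/-- By `tauVal_congr` this value sees only `y_i` with `2l + 4 ≤ i ≤ 2l + 6s - 8`. The condition `3 *
s ≤ n + 5` says that this window fits into the `2n - 1` free places of `exists_y_eq`. -/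
theorem exists_tauVal_ne_zero {m s : ℕ} {l₀ l e : ℤ} (hn : 2 * m + 1 < n) (hs : 1 ≤ s)
    (hs' : 3 * s ≤ n + 5) (he : ∀ v, l ≤ v → v ≤ l + 3 * (s - 1) → (2 * s : ℤ) ∣ v - e →
      2 * m + 1 < (v - l₀) % n) :
    ∃ p ∈ relLocus n m (2 * (l₀ + 2)), tauVal p.y s (2 * l + 3 * s - 2) ≠ 0 := by
  have hn' : (0 : ℤ) < n := by omega
  obtain ⟨Y, h1, h2, h3, h4⟩ := Pentagram.exists_tauVal_ne_zero n m l₀ (by omega)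
    (by exact_mod_cast hn) s hs l e he
  -- Outside the window the value `-1` is prescribed, so that the conditions of the locus hold there
  -- as well.
  obtain ⟨p, hp⟩ := exists_y_eq (n := n) (by omega) (l + 2)
    (Y := fun j => if j ≤ 2 * l + 6 * s - 8 then Y j else -1) (fun j => by
      split_ifs
      · exact h1 j
      · norm_num)
  refine ⟨p, fun t ht => ?_, ?_⟩
  · set j : ℤ := 2 * (l₀ + 2) + 4 * t with hj
    set w := (l₀ + 2 * t - l) % n with hw
    set d := (l₀ + 2 * t - l) / n with hd
    have w0 : 0 ≤ w := Int.emod_nonneg _ hn'.ne'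
    have w1 : w < n := Int.emod_lt_of_pos _ hn'
    have w2 : w + n * d = l₀ + 2 * t - l := Int.emod_add_mul_ediv _ _
    have e1 : j = 2 * (l + 2) + 2 * w + d * (2 * n) := by linarith
    have hper : Function.Periodic p.x (2 * n) := fun j => p.x_add_period j
    have x1 := hper.int_mul d (2 * (l + 2) + 2 * w)
    have x2 := hper.int_mul d (2 * (l + 2) + 2 * w + 1)
    simp only [Int.cast_eq] at x1 x2
    rw [e1, x1, add_right_comm _ _ (1 : ℤ), x2]
    have hy := hp (2 * (l + 2) + 2 * w) (by omega) (by omega)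
    have hY : p.y (2 * (l + 2) + 2 * w) = -1 := by
      rw [hy]
      split_ifs with hle
      · have e2 : (l + w - l₀) % n = 2 * t := by
          rw [show l + w - l₀ = 2 * t + n * (-d) by linarith, Int.add_mul_emod_self_left,
            Int.emod_eq_of_lt (by omega) (by omega)]
        have := h3 (l + w) (by omega) (by omega) (by omega) (by omega)
        rwa [show 2 * (l + w) + 4 = 2 * (l + 2) + 2 * w by ring] at this
      · rfl
    rw [y, if_pos (by rw [Int.even_iff]; omega), neg_inj, inv_eq_one] at hY
    exact hY
  · rw [tauVal_congr (y' := Y)]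
    · exact h4
    · intro v hv
      rw [abs_le] at hv
      rw [hp v (by omega) (by omega), if_pos (by omega)]

/-- The bound on `m` is used in full here: for `s = m + 3`, the window condition `3 * s ≤ n + 5` is
exactly `3 * m + 4 ≤ n`. -/
theorem exists_tauVal_ne_zero_of_avoiding {m s : ℕ} (l₀ : ℤ) {j : ℤ} (hm : 1 ≤ m)
    (hn : 3 * m + 4 ≤ n) (hs : s = m + 2 ∨ s = m + 3) (hj : Even (j - s)) :
    ∃ p ∈ relLocus n m (2 * (l₀ + 2)), tauVal p.y s j ≠ 0 := by
  obtain ⟨l, hl⟩ : ∃ l, j = 2 * l + 3 * s - 2 := ⟨(j + 2 - 3 * s) / 2, by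
    rw [Int.even_iff] at hj; omega⟩
  obtain ⟨e, he⟩ := exists_avoiding (n := n) (m := m) (l₀ := l₀) (l := l) (s := s)
    (by omega) (by omega) (by omega)
  rw [hl]
  exact exists_tauVal_ne_zero (by omega) (by omega) (by omega) he

/-- These places lie just to the right of the zero pattern at level `k + 1`. The class of `e = i + m
+ 1`, the first place after the block, meets the window only in `e`. -/
theorem exists_tauVal_ne_zero_of_le {m k : ℕ} (i : ℤ) {j : ℤ} (hk : k ≤ m) (hn : 3 * m + 4 ≤ n)
    (hj : j = 2 * i + 2 * m - k + 1 ∨ j = 2 * i + 2 * m - k + 3) :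
    ∃ p ∈ relLocus n m (2 * (i - m - 1 + 2)), tauVal p.y (k + 1) j ≠ 0 := by
  obtain ⟨l, hl, hl'⟩ : ∃ l, j = 2 * l + 3 * ((k + 1 : ℕ) : ℤ) - 2 ∧
      (l = i + m - 2 * k ∨ l = i + m + 1 - 2 * k) := by
    rcases hj with hj | hj
    · exact ⟨i + m - 2 * k, by push_cast; omega, Or.inl rfl⟩
    · exact ⟨i + m + 1 - 2 * k, by push_cast; omega, Or.inr rfl⟩
  rw [hl]
  refine exists_tauVal_ne_zero (e := i + m + 1) (by omega) (by omega) (by omega)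
    fun v h1 h2 h3 => ?_
  push_cast at h2 h3
  obtain rfl : v = i + m + 1 := by
    have := Int.eq_zero_of_abs_lt_dvd h3 (abs_lt.2 ⟨by omega, by omega⟩)
    omega
  rw [show i + m + 1 - (i - m - 1) = (2 * m + 2 : ℤ) by ring, Int.emod_eq_of_lt] <;> omega

/-! ### Density of the polygons at which the construction can be iterated. -/

theorem exists_forall_tauVal_ne_zero (n : ℕ) :
    ∃ p : PolygonSpace n 0, ∀ s j, tauVal p.y s j ≠ 0 := by
  obtain ⟨p, hp⟩ := exists_of_x (n := n) (x := fun j => if Even j then 1 else -1) 0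
    (fun j => by split_ifs <;> norm_num) (fun j => by
      have : Even (j + 2 * (n : ℤ)) ↔ Even j := by rw [Int.even_add]; simp
      rw [if_congr this rfl rfl])
  refine ⟨p, fun s j => (tauVal_pos (fun j => ?_) s j).ne'⟩
  simp only [y, hp, Int.even_add_one]
  split_ifs <;> norm_num

theorem exists_mem_Ico {f : ℤ → ℝ} (hn : 0 < n) (hf : ∀ j, f (j + 2 * n) = f j) (j : ℤ) :
    ∃ j' ∈ Finset.Ico (0 : ℤ) (2 * n), f j = f j' ∧ (Even (j' - j)) := by
  have h1 : (0 : ℤ) < 2 * n := by omega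
  have hper : Function.Periodic f (2 * n) := hf
  have e := hper.int_mul (j / (2 * n)) (j % (2 * n))
  have e' := Int.emod_add_mul_ediv j (2 * n)
  refine ⟨j % (2 * n), Finset.mem_Ico.2 ⟨Int.emod_nonneg _ h1.ne', Int.emod_lt_of_pos _ h1⟩,
    ?_, ?_⟩
  · rw [← e]
    congr 1
    simp only [Int.cast_eq]
    linarith
  · refine ⟨-(n * (j / (2 * n))), ?_⟩
    linarith

/-- The construction can be carried out `k` times wherever a certain product of values of `tauVal`
is nonzero. That product is nonzero at the point with all `y_j = 1`, so irreducibility of the torus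
applies. -/
theorem eq_zero_of_isIterate (hn : 0 < n) {k : ℕ} {φ : PolygonSpace n 0 → ℝ}
    (hφ : IsLaurent φ) (h : ∀ p q, IsIterate k p q → φ p = 0) (p : PolygonSpace n 0) : φ p = 0 := by
  have hG : IsLaurent fun p : PolygonSpace n 0 =>
      ∏ s ∈ Finset.range (k + 2), ∏ j ∈ Finset.Ico (0 : ℤ) (2 * n), tauVal p.y s j :=
    IsLaurent.prod _ fun s _ => IsLaurent.prod _ fun j _ => IsLaurent.tauVal hn s j
  refine (hφ.eq_zero_or_eq_zero hn hG fun p => ?_).resolve_right ?_ p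
  · by_cases h0 : ∏ s ∈ Finset.range (k + 2), ∏ j ∈ Finset.Ico (0 : ℤ) (2 * n), tauVal p.y s j = 0
    · rw [h0, mul_zero]
    · obtain ⟨q, hq⟩ := p.exists_isIterate k fun s hs j _ => by
        obtain ⟨j', hj', e, -⟩ := exists_mem_Ico hn
          (fun j => tauVal_add_period (fun j => p.y_add_period j) s j) j
        rw [e]
        exact Finset.prod_ne_zero_iff.1 (Finset.prod_ne_zero_iff.1 h0 s
          (Finset.mem_range.2 (by omega))) j' hj'
      rw [h p q hq, zero_mul]
  · obtain ⟨p, hp⟩ := exists_forall_tauVal_ne_zero n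
    exact fun h => Finset.prod_ne_zero_iff.2
      (fun s _ => Finset.prod_ne_zero_iff.2 fun j _ => hp s j) (h p)

/-! ### Regularity of iterates -/

theorem HasValueAt.exists_laurent (hn : 0 < n) {k : ℕ} {p : PolygonSpace n 0}
    {q : PolygonSpace n k} (h : HasValueAt k p q) (j : ℤ) : ∃ f g : PolygonSpace n 0 → ℝ,
      IsLaurent f ∧ IsLaurent g ∧ (∀ p' q', IsIterate k p' q' → q'.x j * g p' = f p') ∧
      g p ≠ 0 ∧ q.x j * g p = f p := by
  obtain ⟨t, ht⟩ := exists_coords_eq hn j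
  obtain ⟨f, g, h1, h2, h3⟩ := h t
  refine ⟨_, _, IsLaurent.eval_coords f, IsLaurent.eval_coords g, fun p' q' h' => ?_, h2, ?_⟩
  · rw [ht]
    exact h1 p' q' h'
  · rw [ht, h3, div_mul_cancel₀ _ h2]

theorem isNonsingularAt_of_laurent (hn : 0 < n) {k : ℕ} {p : PolygonSpace n 0}
    {f g : ℤ → PolygonSpace n 0 → ℝ} (hf : ∀ j, IsLaurent (f j)) (hg : ∀ j, IsLaurent (g j))
    (h : ∀ p' q', IsIterate k p' q' → ∀ j, q'.x j * g j p' = f j p')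
    (hfp : ∀ j, f j p ≠ 0) (hgp : ∀ j, g j p ≠ 0) : IsNonsingularAt k p := by
  -- The value must be a polygon, whose coordinates are nonzero; hence the numerators are required
  -- not to vanish either.
  obtain ⟨q, hq⟩ := exists_of_coords (fun t => f (t + 1) p / g (t + 1) p)
    (fun t => div_ne_zero (hfp _) (hgp _)) hn k
  refine ⟨q, fun t => ?_⟩
  obtain ⟨P, a, hP⟩ := hf (t + 1)
  obtain ⟨Q, b, hQ⟩ := hg (t + 1)
  have ha := pow_ne_zero a p.coordProd_ne_zero
  have hb := pow_ne_zero b p.coordProd_ne_zero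
  refine ⟨P * (∏ t, MvPolynomial.X t) ^ b, Q * (∏ t, MvPolynomial.X t) ^ a,
    fun p' q' h' => ?_, ?_, ?_⟩
  · have := h p' q' h' (t + 1)
    rw [map_mul, map_mul, map_pow, map_pow, IsLaurent.eval_prod_X, ← hP, ← hQ, ← this, coords]
    ring
  · rw [map_mul, map_pow, IsLaurent.eval_prod_X, ← hQ]
    exact mul_ne_zero (mul_ne_zero (hgp _) hb) ha
  · have := hgp (t + 1)
    rw [map_mul, map_mul, map_pow, map_pow, IsLaurent.eval_prod_X, ← hP, ← hQ, hq]
    field_simp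

theorem isNonsingularAt_of_tauVal_ne_zero (hn : 0 < n) {k : ℕ} {p : PolygonSpace n 0}
    (h : ∀ j : ℤ, Even (j - k) → tauVal p.y k j ≠ 0 ∧ tauVal p.y (k + 1) (j + 1) ≠ 0) :
    IsNonsingularAt k p := by
  classical
  refine isNonsingularAt_of_laurent hn
    (f := fun j p => if Even (j - k) then
      p.monA k j * (tauVal p.y k (j + 2) * tauVal p.y (k + 1) (j - 3)) else
      p.monB k (j - 1) * (tauVal p.y k (j - 1 - 2) * tauVal p.y (k + 1) (j - 1 + 3)))
    (g := fun j p => if Even (j - k) then tauVal p.y k (j - 2) * tauVal p.y (k + 1) (j + 1) else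
      tauVal p.y k (j - 1 + 2) * tauVal p.y (k + 1) (j - 1 - 1))
    (fun j => ?_) (fun j => ?_) (fun p' q' h' j => ?_) (fun j => ?_) (fun j => ?_)
  · split_ifs
    · exact (IsLaurent.monA hn _ _).mul ((IsLaurent.tauVal hn _ _).mul (IsLaurent.tauVal hn _ _))
    · exact (IsLaurent.monB hn _ _).mul ((IsLaurent.tauVal hn _ _).mul (IsLaurent.tauVal hn _ _))
  · split_ifs
    · exact (IsLaurent.tauVal hn _ _).mul (IsLaurent.tauVal hn _ _)
    · exact (IsLaurent.tauVal hn _ _).mul (IsLaurent.tauVal hn _ _)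
  · have hv := h'.isValue
    split_ifs with hj
    · obtain ⟨-, h2, h3, -⟩ := hv j hj
      have h1 := (hv (j - 2) (by rw [Int.even_iff] at hj ⊢; omega)).1
      rw [h3]
      field_simp
    · have hj' : Even (j - 1 - k) := by
        rw [Int.even_iff] at hj ⊢; omega
      obtain ⟨-, -, -, h3⟩ := hv (j - 1) hj'
      have h1 := (hv (j - 1 + 2) (by rw [Int.even_iff] at hj' ⊢; omega)).1
      have h2 := (hv (j - 3) (by rw [Int.even_iff] at hj' ⊢; omega)).2.1
      rw [show j - 3 + 1 = j - 1 - 1 by ring] at h2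
      rw [sub_add_cancel] at h3
      rw [h3]
      field_simp
  · have h1 : ∀ j : ℤ, Even (j - k) → tauVal p.y k j ≠ 0 := fun j hj => (h j hj).1
    have h2 : ∀ j : ℤ, Even (j - 1 - k) → tauVal p.y (k + 1) j ≠ 0 := fun j hj => by
      simpa using (h (j - 1) hj).2
    split_ifs with hj
    · exact mul_ne_zero (p.monA_ne_zero k j) (mul_ne_zero
        (h1 _ (by rw [Int.even_iff] at hj ⊢; omega)) (h2 _ (by rw [Int.even_iff] at hj ⊢; omega)))
    · exact mul_ne_zero (p.monB_ne_zero k _) (mul_ne_zero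
        (h1 _ (by rw [Int.even_iff] at hj ⊢; omega)) (h2 _ (by rw [Int.even_iff] at hj ⊢; omega)))
  · have h1 : ∀ j : ℤ, Even (j - k) → tauVal p.y k j ≠ 0 := fun j hj => (h j hj).1
    have h2 : ∀ j : ℤ, Even (j - 1 - k) → tauVal p.y (k + 1) j ≠ 0 := fun j hj => by
      simpa using (h (j - 1) hj).2
    split_ifs with hj
    · exact mul_ne_zero
        (h1 _ (by rw [Int.even_iff] at hj ⊢; omega)) (h2 _ (by rw [Int.even_iff] at hj ⊢; omega))
    · exact mul_ne_zero
        (h1 _ (by rw [Int.even_iff] at hj ⊢; omega)) (h2 _ (by rw [Int.even_iff] at hj ⊢; omega))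

/-! ### Singular and regular points of the iterates on the locus -/

/-- If `T^k` were regular, clearing denominators in the formula for `x_j x_{j+1}`
(`IsValue.mul_even`) would give an identity whose right hand side vanishes on the locus. The values
of `tauVal` on the other side do not vanish identically, so `f f'` would vanish there; but the
coordinates of a polygon are nonzero. -/
theorem isSingularAt_of_le {m k : ℕ} {i : ℤ} (hk : 1 ≤ k) (hkm : k ≤ m) (hn : 3 * m + 4 ≤ n)
    {p : PolygonSpace n 0} (hp : p ∈ relLocus n m (2 * (i - m - 1 + 2))) : IsSingularAt k p := by
  rintro ⟨q, hq⟩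
  have hn' : 0 < n := by omega
  -- Chosen so that `j - 3` is the rightmost place of the zero pattern at level `k + 1`, while `j -
  -- 1` and `j + 1` lie beyond it.
  obtain ⟨j, hj⟩ : ∃ j : ℤ, j = 2 * i + 2 * m - k + 2 := ⟨_, rfl⟩
  have hjk : Even (j - k) := by rw [Int.even_iff]; omega
  obtain ⟨f, g, hf, hg, h1, h2, h3⟩ := hq.exists_laurent hn' j
  obtain ⟨f', g', hf', hg', h1', h2', h3'⟩ := hq.exists_laurent hn' (j + 1)
  have hrel : ∀ p : PolygonSpace n 0,
      f p * f' p * (p.ym k j * (tauVal p.y (k + 1) (j + 1) * tauVal p.y (k + 1) (j - 1))) +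
      g p * g' p * (tauVal p.y (k + 1) (j - 3) * tauVal p.y (k + 1) (j + 3)) = 0 := by
    refine eq_zero_of_isIterate hn' (k := k)
      (((hf.mul hf').mul ((IsLaurent.ym hn' _ _).mul
        ((IsLaurent.tauVal hn' _ _).mul (IsLaurent.tauVal hn' _ _)))).add
      ((hg.mul hg').mul ((IsLaurent.tauVal hn' _ _).mul (IsLaurent.tauVal hn' _ _))))
      fun p q hpq => ?_
    rw [← h1 p q hpq, ← h1' p q hpq]
    linear_combination g p * g' p * hpq.isValue.mul_even hjk
  obtain ⟨k, rfl⟩ : ∃ k', k = k' + 1 := ⟨k - 1, by omega⟩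
  have hzero : ∀ p ∈ relLocus n m (2 * (i - m - 1 + 2)), f p * f' p *
      (tauVal p.y (k + 1 + 1) (j + 1) * tauVal p.y (k + 1 + 1) (j - 1)) = 0 := by
    intro p hp
    have h0 : tauVal p.y (k + 1 + 1) (j - 3) = 0 :=
      tauVal_eq_zero_of_mem_relLocus (t := m - 1 - k) (r := k) hp (by omega) (by omega) (by omega)
        le_rfl (by push_cast at hj; omega)
    have := hrel p
    rw [h0, zero_mul, mul_zero, add_zero, mul_left_comm] at this
    exact (mul_eq_zero.1 this).resolve_left (p.ym_ne_zero _ _)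
  have hff : f p * f' p ≠ 0 := by
    rw [← h3, ← h3']
    exact mul_ne_zero (mul_ne_zero (q.x_ne_zero _) h2) (mul_ne_zero (q.x_ne_zero _) h2')
  rcases (hf.mul hf').eq_zero_or_eq_zero_on hn' ((IsLaurent.tauVal hn' (k + 1 + 1) (j + 1)).mul
    (IsLaurent.tauVal hn' (k + 1 + 1) (j - 1))) hzero with h | h
  · exact hff (h p hp)
  · obtain ⟨p₁, hp₁, e₁⟩ := exists_tauVal_ne_zero_of_le (k := k + 1) (j := j + 1) i hkm hn
      (Or.inr (by rw [hj]; ring))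
    obtain ⟨p₂, hp₂, e₂⟩ := exists_tauVal_ne_zero_of_le (k := k + 1) (j := j - 1) i hkm hn
      (Or.inl (by rw [hj]; ring))
    rcases (IsLaurent.tauVal hn' _ _).eq_zero_or_eq_zero_on hn' (IsLaurent.tauVal hn' _ _) h
      with h | h
    · exact e₁ (h p₁ hp₁)
    · exact e₂ (h p₂ hp₂)

/-- For `k = m + 1` the pattern has ended at level `k + 1`, so the argument uses the single
coordinate `x_j`. Its denominator contains the rightmost zero `j - 2` of level `m + 1`, while its
numerator is not identically zero on the locus, so `g` would have to vanish. -/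
theorem isSingularAt_succ {m : ℕ} {i : ℤ} (hm : 1 ≤ m) (hn : 3 * m + 4 ≤ n)
    {p : PolygonSpace n 0} (hp : p ∈ relLocus n m (2 * (i - m - 1 + 2))) :
    IsSingularAt (m + 1) p := by
  rintro ⟨q, hq⟩
  have hn' : 0 < n := by omega
  obtain ⟨j, hj⟩ : ∃ j : ℤ, j = 2 * i + m + 1 := ⟨_, rfl⟩
  have hjk : Even (j - (m + 1 : ℕ)) := by rw [Int.even_iff]; omega
  obtain ⟨f, g, hf, hg, h1, h2, h3⟩ := hq.exists_laurent hn' j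
  have hrel : ∀ p : PolygonSpace n 0,
      f p * (tauVal p.y (m + 1) (j - 2) * tauVal p.y (m + 1 + 1) (j + 1)) -
      g p * (p.monA (m + 1) j * (tauVal p.y (m + 1) (j + 2) * tauVal p.y (m + 1 + 1) (j - 3))) =
        0 := by
    refine eq_zero_of_isIterate hn' (k := m + 1)
      ((hf.mul ((IsLaurent.tauVal hn' _ _).mul (IsLaurent.tauVal hn' _ _))).sub
      (hg.mul ((IsLaurent.monA hn' _ _).mul
        ((IsLaurent.tauVal hn' _ _).mul (IsLaurent.tauVal hn' _ _)))))
      fun p q hpq => ?_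
    have hv := hpq.isValue
    obtain ⟨-, e1, e2, -⟩ := hv j hjk
    have e3 := (hv (j - 2) (by rw [Int.even_iff] at hjk ⊢; omega)).1
    rw [← h1 p q hpq, e2]
    field_simp
    ring
  have hzero : ∀ p ∈ relLocus n m (2 * (i - m - 1 + 2)), g p *
      (tauVal p.y (m + 1) (j + 2) * tauVal p.y (m + 1 + 1) (j - 3)) = 0 := by
    intro p hp
    have h0 : tauVal p.y (m + 1) (j - 2) = 0 := by
      obtain ⟨m, rfl⟩ : ∃ m', m = m' + 1 := ⟨m - 1, by omega⟩
      exact tauVal_eq_zero_of_mem_relLocus (t := 0) (r := m) hp le_rfl (by omega) (by omega)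
        le_rfl (by push_cast at hj ⊢; omega)
    have := hrel p
    rw [h0, zero_mul, mul_zero, zero_sub, neg_eq_zero, mul_left_comm] at this
    exact (mul_eq_zero.1 this).resolve_left (p.monA_ne_zero _ _)
  rcases hg.eq_zero_or_eq_zero_on hn' ((IsLaurent.tauVal hn' _ _).mul
    (IsLaurent.tauVal hn' _ _)) hzero with h | h
  · exact h2 (h p hp)
  · obtain ⟨p₁, hp₁, e₁⟩ := exists_tauVal_ne_zero_of_le (j := j + 2) i le_rfl hn
      (Or.inr (by rw [hj]; ring))
    obtain ⟨p₂, hp₂, e₂⟩ := exists_tauVal_ne_zero_of_avoiding (j := j - 3) (i - m - 1) hm hn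
      (Or.inl rfl) (by rw [Int.even_iff] at hjk ⊢; omega)
    rcases (IsLaurent.tauVal hn' _ _).eq_zero_or_eq_zero_on hn' (IsLaurent.tauVal hn' _ _) h
      with h | h
    · exact e₁ (h p₁ hp₁)
    · exact e₂ (h p₂ hp₂)

/-- The open set is where the values of `tauVal` at levels `m + 2` and `m + 3`, one period of each
in the relevant parity, are nonzero. Each factor is nonzero somewhere on the locus, so density
follows from irreducibility. -/
theorem holdsGenerically_isNonsingularAt {m : ℕ} (i : ℤ) (hm : 1 ≤ m) (hn : 3 * m + 4 ≤ n) :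
    HoldsGenerically (relLocus n m (2 * (i - m - 1 + 2))) fun p => IsNonsingularAt (m + 2) p := by
  classical
  have hn' : 0 < n := by omega
  let I : Finset (ℕ × ℤ) := ({m + 2, m + 3} ×ˢ Finset.Ico (0 : ℤ) (2 * n)).filter
    fun v => Even (v.2 - v.1)
  have hI : ∀ v ∈ I, (v.1 = m + 2 ∨ v.1 = m + 3) ∧ Even (v.2 - v.1) := by
    intro v hv
    simp only [I, Finset.mem_filter, Finset.mem_product, Finset.mem_insert,
      Finset.mem_singleton] at hv
    exact ⟨hv.1.1, hv.2⟩
  have hL : ∀ v ∈ I, IsLaurent fun p : PolygonSpace n 0 => tauVal p.y v.1 v.2 :=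
    fun v _ => IsLaurent.tauVal hn' _ _
  have hne : ∀ v ∈ I, ∃ p ∈ relLocus n m (2 * (i - m - 1 + 2)), tauVal p.y v.1 v.2 ≠ 0 :=
    fun v hv => exists_tauVal_ne_zero_of_avoiding _ hm hn (hI v hv).1 (hI v hv).2
  obtain ⟨P, e, hP⟩ := IsLaurent.prod I hL
  refine ⟨P, fun p _ hp0 => ?_, fun h hh => ?_⟩
  · rw [← hP] at hp0
    have h0 := Finset.prod_ne_zero_iff.1 (left_ne_zero_of_mul hp0)
    have key : ∀ s : ℕ, s = m + 2 ∨ s = m + 3 → ∀ j : ℤ, Even (j - s) → tauVal p.y s j ≠ 0 := by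
      intro s hs j hj
      obtain ⟨j', hj', e, e'⟩ := exists_mem_Ico hn'
        (fun j => tauVal_add_period (fun j => p.y_add_period j) s j) j
      rw [e]
      refine h0 (s, j') ?_
      simp only [I, Finset.mem_filter, Finset.mem_product, Finset.mem_insert,
        Finset.mem_singleton]
      exact ⟨⟨hs, hj'⟩, by rw [Int.even_iff] at *; omega⟩
    exact isNonsingularAt_of_tauVal_ne_zero hn' fun j hj =>
      ⟨key _ (Or.inl rfl) j hj, key _ (Or.inr rfl) _ (by rw [Int.even_iff] at hj ⊢; omega)⟩
  · have h1 := (IsLaurent.prod I hL).eq_zero_or_eq_zero_on hn' (IsLaurent.eval_coords h)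
      (m := m) (z := 2 * (i - m - 1 + 2)) fun p hp => ?_
    · refine h1.resolve_left fun h2 => ?_
      obtain ⟨p₀, hp₀, -⟩ := exists_tauVal_ne_zero_of_avoiding (n := n) (j := ((m + 2 : ℕ) : ℤ))
        (i - m - 1) hm hn (Or.inl rfl) (by simp)
      obtain ⟨p, hp, hp'⟩ := IsLaurent.exists_prod_ne_zero hn' I hL hne ⟨p₀, hp₀⟩
      exact hp' (h2 p hp)
    · by_cases h2 : MvPolynomial.eval p.coords P = 0
      · rw [← hP] at h2
        have h3 : ∏ v ∈ I, tauVal p.y v.1 v.2 = 0 :=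
          (mul_eq_zero.1 h2).resolve_right (pow_ne_zero _ p.coordProd_ne_zero)
        rw [h3, zero_mul]
      · rw [hh p hp h2, mul_zero]

/-- The index `j` runs through the `m` zeros of `tauVal` at level `m + 1`. There the left side of
the recurrence vanishes, and comparison with `IsValue.mul_odd` gives `f f' = g g'` after cancelling
values of level `m + 2` that are not identically zero on the locus. -/
theorem HasValueAt.x_mul_x {m : ℕ} {i : ℤ} (hm : 1 ≤ m) (hn : 3 * m + 4 ≤ n)
    {p : PolygonSpace n 0} (hp : p ∈ relLocus n m (2 * (i - m - 1 + 2)))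
    {q : PolygonSpace n (m + 2)} (hq : HasValueAt (m + 2) p q) {t : ℕ} (ht : t < m) {j : ℤ}
    (hj : j = 2 * i - m + 1 + 2 * t) : q.x j * q.x (j + 1) = 1 := by
  have hn' : 0 < n := by omega
  have hjk : Even (j + 1 - (m + 2 : ℕ)) := by rw [Int.even_iff]; omega
  obtain ⟨f, g, hf, hg, h1, h2, h3⟩ := hq.exists_laurent hn' j
  obtain ⟨f', g', hf', hg', h1', h2', h3'⟩ := hq.exists_laurent hn' (j + 1)
  have hrel : ∀ p : PolygonSpace n 0,
      f p * f' p * (p.ymPred (m + 2) j *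
        (tauVal p.y (m + 2) (j + 1) * tauVal p.y (m + 2) (j - 1))) +
      g p * g' p * (tauVal p.y (m + 2) (j - 3) * tauVal p.y (m + 2) (j + 3)) = 0 := by
    refine eq_zero_of_isIterate hn' (k := m + 2)
      (((hf.mul hf').mul ((IsLaurent.ymPred hn' _ _).mul
        ((IsLaurent.tauVal hn' _ _).mul (IsLaurent.tauVal hn' _ _)))).add
      ((hg.mul hg').mul ((IsLaurent.tauVal hn' _ _).mul (IsLaurent.tauVal hn' _ _))))
      fun p q hpq => ?_
    rw [← h1 p q hpq, ← h1' p q hpq]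
    linear_combination g p * g' p * hpq.isValue.mul_odd hjk
  have hzero : ∀ p ∈ relLocus n m (2 * (i - m - 1 + 2)), (g p * g' p - f p * f' p) *
      (tauVal p.y (m + 2) (j - 3) * tauVal p.y (m + 2) (j + 3)) = 0 := by
    intro p hp
    have h0 : tauVal p.y (m + 1) j = 0 := by
      obtain ⟨m, rfl⟩ : ∃ m', m = m' + 1 := ⟨m - 1, by omega⟩
      exact tauVal_eq_zero_of_mem_relLocus (t := 0) (r := t) hp le_rfl (by omega) (by omega)
        (by omega) (by push_cast at hj ⊢; omega)
    have e1 := tauVal_rec p.y (m + 1) j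
    rw [h0, zero_mul] at e1
    have e2 := hrel p
    rw [ymPred, ym] at e2
    linear_combination e2 + f p * f' p * e1
  have hE : Even (j - 3 - (m + 2 : ℕ)) := by rw [Int.even_iff] at hjk ⊢; omega
  have hE' : Even (j + 3 - (m + 2 : ℕ)) := by rw [Int.even_iff] at hjk ⊢; omega
  have hfin : g p * g' p - f p * f' p = 0 := by
    rcases ((hg.mul hg').sub (hf.mul hf')).eq_zero_or_eq_zero_on hn' ((IsLaurent.tauVal hn' _ _).mul
      (IsLaurent.tauVal hn' _ _)) hzero with h | h
    · exact h p hp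
    · obtain ⟨p₁, hp₁, e₁⟩ := exists_tauVal_ne_zero_of_avoiding (n := n) (i - m - 1) hm hn
        (Or.inl rfl) hE
      obtain ⟨p₂, hp₂, e₂⟩ := exists_tauVal_ne_zero_of_avoiding (n := n) (i - m - 1) hm hn
        (Or.inl rfl) hE'
      rcases (IsLaurent.tauVal hn' _ _).eq_zero_or_eq_zero_on hn' (IsLaurent.tauVal hn' _ _) h
        with h | h
      · exact absurd (h p₁ hp₁) e₁
      · exact absurd (h p₂ hp₂) e₂
  rw [← h3, ← h3'] at hfin
  apply mul_right_cancel₀ (mul_ne_zero h2 h2')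
  linear_combination -hfin

theorem mem_XLocus_iff {m : ℕ} (i : ℤ) (p : PolygonSpace n 0) :
    p ∈ XLocus n 0 (arithProg ((i : ℚ) - ((m : ℚ) - 1)) ((i : ℚ) + ((m : ℚ) - 1)) 2) ↔
      p ∈ relLocus n m (2 * (i - m - 1 + 2)) := by
  have hy : ∀ a : ℤ, p.y (2 * a) = -1 ↔ p.x (2 * a) * p.x (2 * a + 1) = 1 := fun a => by
    rw [y, if_pos (by simp), neg_inj, inv_eq_one]
  constructor
  · intro h t ht
    have := h (2 * (i - m - 1 + 2) + 4 * t) ⟨t, by push_cast; ring, by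
      have : (t : ℚ) + 1 ≤ m := by exact_mod_cast ht
      push_cast
      linarith⟩
    rwa [show 2 * (i - m - 1 + 2) + 4 * (t : ℤ) = 2 * (i - m - 1 + 2 + 2 * t) by ring, hy,
      ← show 2 * (i - m - 1 + 2) + 4 * (t : ℤ) = 2 * (i - m - 1 + 2 + 2 * t) by ring] at this
  · rintro h j ⟨t, h1, h2⟩
    have e : j = 2 * (i - m - 1 + 2) + 4 * t := by
      have : (j : ℚ) = 2 * (i - m - 1 + 2) + 4 * t := by push_cast at h1; linarith
      exact_mod_cast this
    have ht : t < m := by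
      rw [h1] at h2
      have : (t : ℚ) < m := by push_cast at h2; linarith
      exact_mod_cast this
    have := h t ht
    rw [e]
    rwa [show 2 * (i - m - 1 + 2) + 4 * (t : ℤ) = 2 * (i - m - 1 + 2 + 2 * t) by ring, ← hy,
      ← show 2 * (i - m - 1 + 2) + 4 * (t : ℤ) = 2 * (i - m - 1 + 2 + 2 * t) by ring] at this

theorem mem_YLocus {m : ℕ} (i : ℤ) (q : PolygonSpace n (m + 2))
    (h : ∀ t : ℕ, t < m → q.x (2 * i - m + 1 + 2 * t) * q.x (2 * i - m + 1 + 2 * t + 1) = 1) :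
    q ∈ YLocus n (m + 2)
      (arithProg ((i : ℚ) - ((m : ℚ) - 1) / 2) ((i : ℚ) + ((m : ℚ) - 1) / 2) 1) := by
  rintro j ⟨t, h1, h2⟩
  have e : j = 2 * i - m + 1 + 2 * t := by
    have : (j : ℚ) = 2 * i - m + 1 + 2 * t := by push_cast at h1; linarith
    exact_mod_cast this
  have ht : t < m := by
    rw [h1] at h2
    have : (t : ℚ) < m := by push_cast at h2; linarith
    exact_mod_cast this
  rw [e, y, if_neg (by rw [Int.even_iff]; omega), h t ht]

end PolygonSpace

end Pentagram

open Pentagram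
theorem mainTheorem1 (n m : ℕ) (i : ℤ) (hm : 1 ≤ m) (hmn : (m : ℚ) < (n : ℚ) / 3 - 1)
    (S S' : Set ℚ)
    (hS : S = arithProg ((i : ℚ) - ((m : ℚ) - 1)) ((i : ℚ) + ((m : ℚ) - 1)) 2)
    (hS' : S' = arithProg ((i : ℚ) - ((m : ℚ) - 1) / 2) ((i : ℚ) + ((m : ℚ) - 1) / 2) 1) :
    (∀ A : TwistedPolygon n 0, PolygonSpace.mk A ∈ PolygonSpace.XLocus n 0 S ↔
      Projectivization.IsCollinear
        {P | ∃ t : ℕ, t ≤ m + 1 ∧ P = A.vertex (i - ((m : ℤ) + 1) + 2 * (t : ℤ))}) ∧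
    (∀ k : ℕ, 1 ≤ k → k ≤ m + 1 →
      ∀ p ∈ PolygonSpace.XLocus n 0 S, PolygonSpace.IsSingularAt k p) ∧
    PolygonSpace.HoldsGenerically (PolygonSpace.XLocus n 0 S)
      (fun p => PolygonSpace.IsNonsingularAt (m + 2) p) ∧
    (∀ p ∈ PolygonSpace.XLocus n 0 S, ∀ q : PolygonSpace n (m + 2),
      PolygonSpace.HasValueAt (m + 2) p q → q ∈ PolygonSpace.YLocus n (m + 2) S') := by
  -- The integral form of the strict inequality `m < n / 3 - 1`.
  have hn : 3 * m + 4 ≤ n := by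
    have : (3 * m + 3 : ℚ) < n := by linarith
    have : 3 * m + 3 < n := by exact_mod_cast this
    omega
  have hX : PolygonSpace.XLocus n 0 S = PolygonSpace.relLocus n m (2 * (i - m - 1 + 2)) := by
    rw [hS]
    exact Set.ext fun p => PolygonSpace.mem_XLocus_iff i p
  rw [hX]
  refine ⟨fun A => ?_, fun k hk hkm p hp => ?_,
    PolygonSpace.holdsGenerically_isNonsingularAt i hm hn, fun p hp q hq => ?_⟩
  · rw [A.isCollinear_iff]
    refine forall_congr' fun t => imp_congr_right fun _ => ?_
    rw [show ((0 : ℕ) : ℤ) + 2 * (i - (m + 1) + 2 + 2 * t) =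
      2 * (i - m - 1 + 2) + 4 * t by push_cast; ring]
    rfl
  · rcases Nat.lt_or_ge m k with h | h
    · obtain rfl : k = m + 1 := by omega
      exact PolygonSpace.isSingularAt_succ hm hn hp
    · exact PolygonSpace.isSingularAt_of_le hk h hn hp
  · rw [hS']
    exact PolygonSpace.mem_YLocus i q fun t ht => hq.x_mul_x hm hn hp ht rfl
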